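/- Let $X$ be an oriented smooth manifold of dimension $n+1\ge 1$ (without boundary) and let $\pi\colon Y\to X$ be a smooth fiber bundle with finite-dimensional fiber. Let $J^1(Y)\to Y$ be the first jet bundle, whose fiber over $y\in Y$, $x=\pi(y)$, consists of the linear maps $\gamma\colon T_xX\to T_yY$ with $T_y\pi\circ\gamma=\mathrm{id}$. Let $Z\subset\Lambda^{n+1}(Y)$ be the subbundle of the $(n+1)$-forms $z$ on $T_yY$ with $v\lrcorner(w\lrcorner z)=0$ for all vertical $v,w\in\ker T_y\pi$; it is identified with the bundle of affine maps $J^1(Y)_y\to\Lambda^{n+1}(X)_x$ by $z\mapsto(\gamma'\mapsto\gamma'^{*}z)$. Let $\Theta$ be the canonical $(n+1)$-form on $\Lambda^{n+1}(Y)$, $\Theta(z)(u_1,\dots,u_{n+1})=z(Tp\,u_1,\dots,Tp\,u_{n+1})$ with $p\colon\Lambda^{n+1}(Y)\to Y$ the projection, and let $\Omega=-d\Theta$. Let $\mathcal L\colon J^1(Y)\to\Lambda^{n+1}(X)$ be a smooth bundle map over $X$ (a Lagrangian density). Its covariant Legendre transformation $\mathbb F\mathcal L\colon J^1(Y)\to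 Z$ is the map over $Y$ given, through the identification above, by $$\mathbb F\mathcal L(\gamma)\cdot\gamma'=\mathcal L(\gamma)+\left.\frac{d}{d\varepsilon}\right|_{\varepsilon=0}\mathcal L(\gamma+\varepsilon(\gamma'-\gamma)),\qquad \gamma,\gamma'\in J^1(Y)_y .$$ Assume that $P_{\mathcal L}=\mathbb F\mathcal L(J^1(Y))$ is a smooth submanifold of $\Lambda^{n+1}(Y)$ and that $\mathbb F\mathcal L\colon J^1(Y)\to P_{\mathcal L}$ is a diffeomorphism (over $Y$), and let $\Omega_{\mathcal H}$ be the pull-back of $\Omega$ to $P_{\mathcal L}$. Let $\phi$ be a smooth section of $\pi$, with first jet $j^1(\phi)(x)=T_x\phi$, and let $\tilde j^1(\phi)=\mathbb F\mathcal L\circ j^1(\phi)\colon X\to P_{\mathcal L}$. Then the following are equivalent: (i) $\phi$ is a stationary point of the action $\int_X\mathcal L(j^1(\phi))$, that is, for every smooth vertical vector field $V$ on $Y$ that vanishes outside $\pi^{-1}(K)$ for a compact set $K\subset X$, $$\left.\frac{d}{d\lambda}\right|_{\lambda=0}\int_{K}\mathcal L(j^1(\phi_\lambda))=0,\qquad \phi_\lambda=\eta_\lambda\circ\phi,$$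 where $\eta_\lambda$ is the flow of $V$ (the curve $\phi_\lambda$ is defined for $|\lambda|$ small, and $\mathcal L(j^1(\phi_\lambda))$ does not depend on $\lambda$ outside $K$); (ii) $\tilde j^1(\phi)$ is a Hamiltonian section, that is, $\tilde j^1(\phi)^{*}(U\lrcorner\Omega_{\mathcal H})=0$ for all $U\in T(P_{\mathcal L})$. -/

import Mathlib

open Bundle Set Function Topology MeasureTheory
open scoped Manifold ContDiff Bundle

noncomputable section

namespace Multisymplectic

/-! ### Differential forms on a manifold -/

section Forms

variable {E : Type*} [NormedAddCommGroup E] [NormedSpace ℝ E]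
  {H : Type*} [TopologicalSpace H] (I : ModelWithCorners ℝ E H)
  {M : Type*} [TopologicalSpace M] [ChartedSpace H M]

/-- The space `Λᵏ(M)_p` of alternating `k`-forms on `T_p M`
(`Bundle.Trivial M ℝ p` is `ℝ`, seen as the fiber of the trivial line bundle). -/
abbrev FormAt (k : ℕ) (p : M) : Type _ :=
  TangentSpace I p [⋀^Fin k]→L[ℝ] Bundle.Trivial M ℝ p

variable (M) in
/-- The total space of the bundle `Λᵏ(M)` of `k`-forms on `M`. Its topology and its charts are those
of Mathlib's bundle of continuous alternating maps. -/
abbrev FormBundle (k : ℕ) : Type _ :=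
  TotalSpace (E [⋀^Fin k]→L[ℝ] ℝ) (fun p : M => FormAt I k p)

/-- The model with corners of the manifold `Λᵏ(M)`. -/
abbrev formModel (k : ℕ) :
    ModelWithCorners ℝ (E × (E [⋀^Fin k]→L[ℝ] ℝ)) (ModelProd H (E [⋀^Fin k]→L[ℝ] ℝ)) :=
  I.prod 𝓘(ℝ, E [⋀^Fin k]→L[ℝ] ℝ)

/-- The coordinate expression, in the preferred chart at `p₀`, of a differential `k`-form `α`:
its pull-back by the inverse of that chart. -/
def formInChart {k : ℕ} (α : ∀ p : M, TangentSpace I p [⋀^Fin k]→L[ℝ] ℝ) (p₀ : M) (u : E) :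
    E [⋀^Fin k]→L[ℝ] ℝ :=
  (α ((extChartAt I p₀).symm u)).compContinuousLinearMap
    (mfderiv 𝓘(ℝ, E) I (extChartAt I p₀).symm u)

/-- The exterior derivative of a differential form on a manifold without boundary, computed at `p` in
the preferred chart at `p`. -/
def extDerivForm {k : ℕ} (α : ∀ p : M, TangentSpace I p [⋀^Fin k]→L[ℝ] ℝ) (p : M) :
    TangentSpace I p [⋀^Fin (k + 1)]→L[ℝ] ℝ :=
  (extDeriv (formInChart I α p) (extChartAt I p p)).compContinuousLinearMap
    (mfderiv I 𝓘(ℝ, E) (extChartAt I p) p)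

/-- The tangent vectors at `p` to a submanifold `S` of `M`: the velocities at time `0` of the smooth
curves in `M` that stay in `S` and start at `p`. -/
def tangentVectors (S : Set M) (p : M) : Set (TangentSpace I p) :=
  {U | ∃ c : ℝ → M, ContMDiff 𝓘(ℝ, ℝ) I ∞ c ∧ (∀ t, c t ∈ S) ∧ c 0 = p ∧
    mfderiv 𝓘(ℝ, ℝ) I c 0 (1 : ℝ) = U}

variable [IsManifold I ∞ M]

/-- The canonical `k`-form on `Λᵏ(M)`: `Θ(z)(u₁, …, u_k) = z(Tπ u₁, …, Tπ u_k)`, where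
`π : Λᵏ(M) → M` is the projection. -/
def canonicalForm (k : ℕ) (z : FormBundle I M k) :
    TangentSpace (formModel I k) z [⋀^Fin k]→L[ℝ] ℝ :=
  ContinuousAlternatingMap.compContinuousLinearMap (N := ℝ) z.2
    (mfderiv (formModel I k) I (fun w : FormBundle I M k => w.1) z)

/-- The canonical `(k+1)`-form `Ω = -dΘ` on `Λᵏ(M)`. -/
def canonicalOmega (k : ℕ) (z : FormBundle I M k) :
    TangentSpace (formModel I k) z [⋀^Fin (k + 1)]→L[ℝ] ℝ :=
  -extDerivForm (formModel I k) (canonicalForm I k) z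

end Forms

/-! ### Oriented manifolds and integration of top-degree forms -/

section Integration

variable {n : ℕ} {X : Type*} [TopologicalSpace X]
  [ChartedSpace (EuclideanSpace ℝ (Fin (n + 1))) X]

variable (n X) in
/-- `X` is oriented by its atlas: all transition maps have positive Jacobian determinant. -/
def IsOrientedAtlas : Prop :=
  ∀ e ∈ atlas (EuclideanSpace ℝ (Fin (n + 1))) X, ∀ e' ∈ atlas (EuclideanSpace ℝ (Fin (n + 1))) X,
    ∀ u ∈ (e.symm.trans e').source, 0 < (fderiv ℝ (e.symm.trans e') u).det

variable [T2Space X] [SigmaCompactSpace X] [IsManifold (𝓡 (n + 1)) ∞ X]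

variable (n X) in
/-- A smooth partition of unity on `X` subordinate to the domains of the preferred charts. -/
def chartPartition : SmoothPartitionOfUnity X (𝓡 (n + 1)) X univ :=
  Classical.choose (SmoothPartitionOfUnity.exists_isSubordinate_chartAt_source (𝓡 (n + 1)) X)

/-- The integral `∫_K α` of an `(n+1)`-form `α` over a compact subset `K` of the oriented
`(n+1)`-manifold `X`: the sum over the partition of unity `ρ` of the Lebesgue integrals over the
chart domains of `ρᵢ α(∂₀, …, ∂ₙ)`. -/
def formIntegral (K : Set X) (α : ∀ x : X, TangentSpace (𝓡 (n + 1)) x [⋀^Fin (n + 1)]→L[ℝ] ℝ) : ℝ :=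
  ∑ᶠ i : X, ∫ u in (extChartAt (𝓡 (n + 1)) i).target ∩ (extChartAt (𝓡 (n + 1)) i).symm ⁻¹' K,
    chartPartition n X i ((extChartAt (𝓡 (n + 1)) i).symm u) *
      formInChart (𝓡 (n + 1)) α i u (fun μ => EuclideanSpace.single μ 1)

end Integration

/-! ### Fiber bundles and first jets -/

section Fields

variable {n : ℕ} {X : Type*} [TopologicalSpace X]
  [ChartedSpace (EuclideanSpace ℝ (Fin (n + 1))) X]
  {E : Type*} [NormedAddCommGroup E] [NormedSpace ℝ E]
  {Y : Type*} [TopologicalSpace Y] [ChartedSpace E Y]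

/-- `q : Y → X` is a smooth fiber bundle with typical fiber the manifold `F`: it has smooth local
trivializations near every point of `X`. -/
def IsSmoothFiberBundle (E' : Type*) [NormedAddCommGroup E'] [NormedSpace ℝ E']
    (F : Type*) [TopologicalSpace F] [ChartedSpace E' F]
    (q : C^∞⟮𝓘(ℝ, E), Y; 𝓡 (n + 1), X⟯) : Prop :=
  ∀ x : X, ∃ e : Trivialization F q, x ∈ e.baseSet ∧
    ContMDiffOn 𝓘(ℝ, E) ((𝓡 (n + 1)).prod 𝓘(ℝ, E')) ∞ e e.source ∧
    ContMDiffOn ((𝓡 (n + 1)).prod 𝓘(ℝ, E')) 𝓘(ℝ, E) ∞ e.toOpenPartialHomeomorph.symm e.target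

/-- The fiber at `y` of the pull-back bundle `q^*TX` is the vector space `T_{q(y)}X`. -/
instance instAddCommGroupPullbackTangent (q : C^∞⟮𝓘(ℝ, E), Y; 𝓡 (n + 1), X⟯) (y : Y) :
    AddCommGroup ((q *ᵖ (TangentSpace (𝓡 (n + 1)) : X → Type _)) y) :=
  inferInstanceAs (AddCommGroup (TangentSpace (𝓡 (n + 1)) (q y)))

variable [IsManifold (𝓡 (n + 1)) ∞ X] [IsManifold 𝓘(ℝ, E) ∞ Y]
  (q : C^∞⟮𝓘(ℝ, E), Y; 𝓡 (n + 1), X⟯)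

/-- The linear maps `T_{q(y)}X → T_yY`. -/
abbrev HomAt (y : Y) : Type _ :=
  (q *ᵖ (TangentSpace (𝓡 (n + 1)) : X → Type _)) y →L[ℝ] TangentSpace 𝓘(ℝ, E) y

/-- The total space of the vector bundle `Hom(q^*TX, TY)` over `Y`, a smooth manifold. -/
abbrev HomBundle : Type _ :=
  TotalSpace (EuclideanSpace ℝ (Fin (n + 1)) →L[ℝ] E) (fun y : Y => HomAt q y)

variable (n E) in
/-- The model with corners of the manifold `Hom(q^*TX, TY)`. -/
abbrev homModel : ModelWithCorners ℝ (E × (EuclideanSpace ℝ (Fin (n + 1)) →L[ℝ] E))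
    (ModelProd E (EuclideanSpace ℝ (Fin (n + 1)) →L[ℝ] E)) :=
  𝓘(ℝ, E).prod 𝓘(ℝ, EuclideanSpace ℝ (Fin (n + 1)) →L[ℝ] E)

/-- The tangent map `T_yq : T_yY → T_{q(y)}X`. -/
abbrev tangentProj (y : Y) : TangentSpace 𝓘(ℝ, E) y →L[ℝ] TangentSpace (𝓡 (n + 1)) (q y) :=
  mfderiv 𝓘(ℝ, E) (𝓡 (n + 1)) q y

/-- The first jet bundle `J¹(Y)`, a submanifold of `Hom(q^*TX, TY)`: its fiber over `y` consists of
the linear maps `γ : T_{q(y)}X → T_yY` with `T_yq ∘ γ = id`. Maps defined on `J¹(Y)` are written as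
maps on `Hom(q^*TX, TY)` whose values outside `J¹(Y)` play no role, and they are smooth if they are
smooth on the subset `J¹(Y)`. -/
def jetBundle : Set (HomBundle q) :=
  {w | ∀ v : TangentSpace (𝓡 (n + 1)) (q w.1), tangentProj q w.1 (w.2 v) = v}

/-- The first jet `j¹(φ)` of a section `φ`, `j¹(φ)(x) = T_xφ`
(note that `T_xX` is `T_{q(φ(x))}X`). -/
def firstJet (φ : X → Y) (x : X) : HomBundle q :=
  ⟨φ x, (mfderiv (𝓡 (n + 1)) 𝓘(ℝ, E) φ x : EuclideanSpace ℝ (Fin (n + 1)) →L[ℝ] E)⟩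

/-! ### The covariant Legendre transformation -/

/-- Lagrangian densities `ℒ : J¹(Y) → Λⁿ⁺¹(X)` as bundle maps over `X`:
`ℒ(γ)` is an `(n+1)`-form on `T_{q(y)}X` for `γ` over `y`. -/
abbrev Density : Type _ :=
  ∀ w : HomBundle q, FormAt (𝓡 (n + 1)) (n + 1) (q w.1)

variable {q}

/-- Smoothness of the Lagrangian density, as a map from `J¹(Y)` to the manifold `Λⁿ⁺¹(X)`. -/
def IsSmoothDensity (ℒ : Density q) : Prop :=
  ContMDiffOn (homModel n E) (formModel (𝓡 (n + 1)) (n + 1)) ∞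
    (fun w : HomBundle q => (⟨q w.1, ℒ w⟩ : FormBundle (𝓡 (n + 1)) X (n + 1))) (jetBundle q)

variable (q) in
/-- The fiber `Z_y` of the subbundle `Z ⊆ Λⁿ⁺¹(Y)`: the `(n+1)`-forms on `T_yY` that vanish
whenever two of their arguments are vertical. -/
def multiphaseFiber (y : Y) : Set (FormAt 𝓘(ℝ, E) (n + 1) y) :=
  {z | ∀ (u : Fin (n + 1) → TangentSpace 𝓘(ℝ, E) y) (i j : Fin (n + 1)), i ≠ j →
    tangentProj q y (u i) = 0 → tangentProj q y (u j) = 0 → z u = 0}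

/-- The value on the vectors `v₀, …, vₙ` of the form
`𝔽ℒ(γ) · γ' = ℒ(γ) + d/dε|_{ε = 0} ℒ(γ + ε(γ' - γ))`. -/
def legendreAffine (ℒ : Density q) (y : Y) (γ γ' : HomAt q y)
    (v : Fin (n + 1) → TangentSpace (𝓡 (n + 1)) (q y)) : ℝ :=
  ℒ ⟨y, γ⟩ v + deriv (fun ε : ℝ => (ℒ ⟨y, γ + ε • (γ' - γ)⟩ v : ℝ)) 0

/-- `z ∈ Z_y` represents `𝔽ℒ(γ)`, an affine map from `J¹(Y)_y` to `Λⁿ⁺¹(X)_{q(y)}`, under the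
isomorphism `Φ(z)(γ') = γ'^*z` between `Z_y` and the space of these affine maps. -/
def RepresentsLegendre (ℒ : Density q) (y : Y) (γ : HomAt q y)
    (z : FormAt 𝓘(ℝ, E) (n + 1) y) : Prop :=
  z ∈ multiphaseFiber q y ∧
    ∀ γ' : HomAt q y, (⟨y, γ'⟩ : HomBundle q) ∈ jetBundle q →
      ∀ v : Fin (n + 1) → TangentSpace (𝓡 (n + 1)) (q y),
        z (fun i => γ' (v i)) = legendreAffine ℒ y γ γ' v

/-- The covariant Legendre transformation `𝔽ℒ : J¹(Y) → Z ⊆ Λⁿ⁺¹(Y)`, where `𝔽ℒ(γ)` is the unique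
element of `Z_y` that represents the first order vertical Taylor approximation of `ℒ` at `γ`. -/
def legendre (ℒ : Density q) (w : HomBundle q) : FormBundle 𝓘(ℝ, E) Y (n + 1) :=
  ⟨w.1, Classical.epsilon (RepresentsLegendre ℒ w.1 w.2)⟩

/-- The primary constraint set `P_ℒ = 𝔽ℒ(J¹(Y))`. -/
def primaryConstraint (ℒ : Density q) : Set (FormBundle 𝓘(ℝ, E) Y (n + 1)) :=
  legendre ℒ '' jetBundle q

/-- `ℒ` is regular: `𝔽ℒ` is a diffeomorphism (over `Y`) of `J¹(Y)` onto `P_ℒ`, that is, a smooth map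
with a smooth inverse `P_ℒ → J¹(Y)`. Since `J¹(Y)` is a submanifold of `Hom(q^*TX, TY)`, this says
exactly that `P_ℒ` is a submanifold of `Λⁿ⁺¹(Y)` and `𝔽ℒ : J¹(Y) → P_ℒ` is a diffeomorphism. -/
def IsRegular (ℒ : Density q) : Prop :=
  ContMDiffOn (homModel n E) (formModel 𝓘(ℝ, E) (n + 1)) ∞ (legendre ℒ) (jetBundle q) ∧
  ∃ g : FormBundle 𝓘(ℝ, E) Y (n + 1) → HomBundle q,
    ContMDiffOn (formModel 𝓘(ℝ, E) (n + 1)) (homModel n E) ∞ g (primaryConstraint ℒ) ∧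
    ∀ w ∈ jetBundle q, g (legendre ℒ w) = w

/-! ### Hamiltonian sections -/

/-- The conjugate `𝔽ℒ ∘ j¹(φ)` of the first jet of `φ`. -/
def conjugateJet (ℒ : Density q) (φ : X → Y) (x : X) : FormBundle 𝓘(ℝ, E) Y (n + 1) :=
  legendre ℒ (firstJet q φ x)

/-- `z^*(U ⌟ Ω_ℋ) = 0` for all `U ∈ T(P_ℒ)`, where `Ω_ℋ` is the pull-back of the canonical
`(n+2)`-form to `P_ℒ`, so that `Ω_ℋ(U, u₀, …, uₙ)` is the value of the canonical form on vectors
tangent to `P_ℒ`. -/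
def IsHamiltonian (ℒ : Density q) (z : X → FormBundle 𝓘(ℝ, E) Y (n + 1)) : Prop :=
  ∀ x : X, ∀ U ∈ tangentVectors (formModel 𝓘(ℝ, E) (n + 1)) (primaryConstraint ℒ) (z x),
    ∀ v : Fin (n + 1) → TangentSpace (𝓡 (n + 1)) x,
      canonicalOmega 𝓘(ℝ, E) (n + 1) (z x)
        (Fin.cons U fun i =>
          mfderiv (𝓡 (n + 1)) (formModel 𝓘(ℝ, E) (n + 1)) z x (v i)) = 0

/-! ### Stationary points of the action -/

variable (q) in
/-- `V` is a smooth vertical vector field on `Y` that vanishes outside `q⁻¹(K)`. -/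
structure IsVerticalField (K : Set X) (V : ∀ y : Y, TangentSpace 𝓘(ℝ, E) y) : Prop where
  smooth : ContMDiff 𝓘(ℝ, E) 𝓘(ℝ, E).tangent ∞
    (fun y => (⟨y, V y⟩ : TangentBundle 𝓘(ℝ, E) Y))
  vertical : ∀ y, tangentProj q y (V y) = 0
  eq_zero : ∀ y, q y ∉ K → V y = 0

/-- `Φ t = η_t ∘ φ` for `|t| < ε`, where `η` is the (local, smooth) flow of `V`: `Φ` is smooth and
`t ↦ Φ t x` is the integral curve of `V` that starts at `φ x`. -/
structure IsVariation (V : ∀ y : Y, TangentSpace 𝓘(ℝ, E) y) (φ : X → Y) (ε : ℝ)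
    (Φ : ℝ → X → Y) : Prop where
  pos : 0 < ε
  smooth : ContMDiffOn (𝓘(ℝ, ℝ).prod (𝓡 (n + 1))) 𝓘(ℝ, E) ∞ (uncurry Φ) (Ioo (-ε) ε ×ˢ univ)
  start : Φ 0 = φ
  integralCurve : ∀ x, IsMIntegralCurveOn (I := 𝓘(ℝ, E)) (fun t => Φ t x) V (Ioo (-ε) ε)

/-- `φ` is a stationary point of the action `∫_X ℒ(j¹(φ))`: for every vertical vector field
supported over a compact set `K ⊆ X` and the corresponding variation `φ_t`, the derivative of
`∫_K ℒ(j¹(φ_t))` at `t = 0` exists and vanishes. (Outside `K` the integrand does not depend on `t`;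
the integral over all of `X` need not converge.) -/
def IsStationary [T2Space X] [SigmaCompactSpace X] (ℒ : Density q) (φ : X → Y) : Prop :=
  ∀ (K : Set X), IsCompact K → ∀ V : (∀ y : Y, TangentSpace 𝓘(ℝ, E) y), IsVerticalField q K V →
    ∀ (ε : ℝ) (Φ : ℝ → X → Y), IsVariation (n := n) V φ ε Φ →
      HasDerivAt (fun t => formIntegral K (fun x => ℒ (firstJet q (Φ t) x))) 0 0

end Fields

end Multisymplectic

end

/-! Both conditions are equivalent to the Euler–Lagrange equations, read in charts of `Y` whose
first component is a chart of `X` (`AdaptedChart`). In such a chart jets become triples `(a, y, v)`,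
the density becomes a function `L` of them, and a section becomes a function `f`. The pivot is
`eulerLagrange L f a c = ∂_y L · c - ∑_μ d/da^μ (∂L/∂v_μ · c)`, evaluated along the jet of `f`.

Hamiltonian side. The form `𝔽ℒ(w)`, evaluated on the graph of a velocity `v'`, is `L(w) + ∂_v L(w) ·
(v' - v)`; so the pull-back of `Θ` to jet space is the Cartan form. Its exterior derivative on a
vector `(0, c, σ)` and the vectors tangent to the jet of `f` is exactly `eulerLagrange L f a c`: the
dependence on `σ` cancels because the affine approximation has the same velocity derivative as `L`
(`extDeriv_cartan`, `canonicalOmega_legendreParam`). A general `ξ` differs from a vector of the form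
`(0, c, σ)` by a vector tangent to the jet, and this contributes nothing because `n + 2` vectors of
an `(n + 1)`-dimensional space are dependent (`canonicalOmega_conjugateJet`). Regularity supplies
the vectors: smoothness of `𝔽ℒ` makes the images of jet vectors tangent to `P_ℒ`, and the smooth
inverse lifts curves in `P_ℒ` back to jets.

Variational side. If two families of sections agree at `t = 0` and, for all `t`, off a compact set
`C` lying in one chart, the difference of their actions has derivative `∫_C eulerLagrange · (η₁ -
η₂)`, where `η₁`, `η₂` are their velocities at `t = 0`; the divergence term integrates to zero
(`hasDerivAt_integral_lagrangian`, `hasDerivAt_formIntegral_sub`). Orientation is what allows the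
integral over `X` to be computed in that single chart (`formIntegral_eq_of_support`).

Stationary implies Euler–Lagrange: the curve `f + t χ b` is the flow of a cut-off vertical field, so
the fundamental lemma of the calculus of variations applies. For the converse, a variation need not
fit into one chart. With a partition of unity `ρ` and partial sums `σ_S = ∑_{i ∈ S} ρ_i`, the
families `Φ (t σ_S(x)) x` interpolate between the constant family `φ` and the family `Φ t`; adding
one index to `S` changes the family only inside one chart, where the derivative of the action
changes by an integral of the vanishing Euler–Lagrange expression. -/

noncomputable section

set_option linter.unusedSectionVars false

namespace Multisymplectic

/-! ### Calculus of variations in coordinates -/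

section Coordinates

/-- The coordinate space of the base. -/
abbrev BaseSpace (n : ℕ) : Type := EuclideanSpace ℝ (Fin (n + 1))

/-- The coordinate space of first jets: base point, value, derivative. -/
abbrev JetSpace (n : ℕ) (B : Type*) [NormedAddCommGroup B] [NormedSpace ℝ B] : Type _ :=
  BaseSpace n × B × (BaseSpace n →L[ℝ] B)

/-- The coordinate vector `∂_μ`. -/
abbrev coordVec {n : ℕ} (μ : Fin (n + 1)) : BaseSpace n := EuclideanSpace.single μ (1 : ℝ)

variable {n : ℕ} {B : Type*} [NormedAddCommGroup B] [NormedSpace ℝ B]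

/-- The first jet of a function in coordinates. -/
def coordJet (f : BaseSpace n → B) (a : BaseSpace n) : JetSpace n B := (a, f a, fderiv ℝ f a)

/-- The linear map `c ↦ dx^μ ⊗ c` into the velocity component of the jet space. -/
def velocity (μ : Fin (n + 1)) : B →L[ℝ] JetSpace n B :=
  (ContinuousLinearMap.inr ℝ (BaseSpace n) (B × (BaseSpace n →L[ℝ] B))).comp
    ((ContinuousLinearMap.inr ℝ B (BaseSpace n →L[ℝ] B)).comp
      (ContinuousLinearMap.smulRightL ℝ (BaseSpace n) B (EuclideanSpace.proj μ)))

@[simp]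
theorem velocity_apply (μ : Fin (n + 1)) (c : B) :
    velocity μ c = ((0, 0, (EuclideanSpace.proj μ : BaseSpace n →L[ℝ] ℝ).smulRight c) :
      JetSpace n B) := rfl

/-- The Euler–Lagrange expression of the Lagrangian `L` along `f`, contracted with `c`. -/
def eulerLagrange (L : JetSpace n B → ℝ) (f : BaseSpace n → B) (a : BaseSpace n) (c : B) : ℝ :=
  fderiv ℝ L (coordJet f a) (0, c, 0) -
    ∑ μ, fderiv ℝ (fun a' => fderiv ℝ L (coordJet f a') (velocity μ c)) a (coordVec μ)

theorem sum_proj_smulRight (T : BaseSpace n →L[ℝ] B) :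
    ∑ μ, (EuclideanSpace.proj μ : BaseSpace n →L[ℝ] ℝ).smulRight (T (coordVec μ)) = T := by
  ext v
  have hv : v = ∑ μ, v μ • coordVec μ := by
    ext ν
    simp [Finset.sum_apply, Pi.single_apply]
  simp only [sum_apply, ContinuousLinearMap.smulRight_apply,
    PiLp.proj_apply]
  conv_rhs => rw [hv, map_sum]
  simp

theorem sum_velocity (T : BaseSpace n →L[ℝ] B) :
    ∑ μ, velocity μ (T (coordVec μ)) = ((0, 0, T) : JetSpace n B) := by
  conv_rhs => rw [← sum_proj_smulRight T]
  simp only [velocity_apply]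
  simp [Prod.ext_iff, Prod.fst_sum, Prod.snd_sum]

theorem fderiv_momentum {L : JetSpace n B → ℝ} {f : BaseSpace n → B} {a : BaseSpace n}
    (hL : DifferentiableAt ℝ (fun a' => fderiv ℝ L (coordJet f a')) a) (μ : Fin (n + 1)) (c : B)
    (v : BaseSpace n) :
    fderiv ℝ (fun a' => fderiv ℝ L (coordJet f a') (velocity μ c)) a v =
      fderiv ℝ (fun a' => fderiv ℝ L (coordJet f a')) a v (velocity μ c) := by
  have := hL.hasFDerivAt.clm_apply (hasFDerivAt_const (velocity μ c) a)
  rw [this.fderiv]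
  simp

/-- The scalar `r` is constant in `a`, so no derivative falls on it. It is applied with `r = χ a` at
a fixed point, to bring the first variation into the form required by the fundamental lemma. -/
theorem eulerLagrange_smul {L : JetSpace n B → ℝ} {f : BaseSpace n → B} {a : BaseSpace n}
    (hL : DifferentiableAt ℝ (fun a' => fderiv ℝ L (coordJet f a')) a) (r : ℝ) (c : B) :
    eulerLagrange L f a (r • c) = r * eulerLagrange L f a c := by
  have : ((0, r • c, 0) : JetSpace n B) = r • (0, c, 0) := by simp
  simp only [eulerLagrange, fderiv_momentum hL]
  rw [this, map_smul, mul_sub, Finset.mul_sum]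
  simp only [map_smul, smul_eq_mul]

/-- The first variation is the Euler–Lagrange expression plus a divergence. -/
theorem firstVariation_eq {L : JetSpace n B → ℝ} {f η : BaseSpace n → B} {a : BaseSpace n}
    (hL : DifferentiableAt ℝ (fun a' => fderiv ℝ L (coordJet f a')) a)
    (hη : DifferentiableAt ℝ η a) :
    fderiv ℝ L (coordJet f a) (0, η a, fderiv ℝ η a) = eulerLagrange L f a (η a) +
      ∑ μ, fderiv ℝ (fun a' => fderiv ℝ L (coordJet f a') (velocity μ (η a'))) a (coordVec μ) := by
  -- Product rule: the derivative of momentum times `η` has one term with `∂_μ η`, which sums to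
  -- `∂_v L · Dη` by `sum_velocity`, and one that cancels against the momentum term of
  -- `eulerLagrange`.
  have h1 : ∀ μ : Fin (n + 1),
      fderiv ℝ (fun a' => fderiv ℝ L (coordJet f a') (velocity μ (η a'))) a (coordVec μ) =
        fderiv ℝ L (coordJet f a) (velocity μ (fderiv ℝ η a (coordVec μ))) +
        fderiv ℝ (fun a' => fderiv ℝ L (coordJet f a')) a (coordVec μ) (velocity μ (η a)) := by
    intro μ
    have := hL.hasFDerivAt.clm_apply ((velocity μ).hasFDerivAt.comp a hη.hasFDerivAt)
    simp only [Function.comp_def] at this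
    rw [this.fderiv]
    simp
  simp only [eulerLagrange, h1, fderiv_momentum hL, Finset.sum_add_distrib]
  rw [← map_sum, sum_velocity]
  have : ((0, η a, fderiv ℝ η a) : JetSpace n B) = (0, η a, 0) + (0, 0, fderiv ℝ η a) := by simp
  rw [this, map_add]
  ring

/-- The derivative of the Lagrangian along a family of functions. -/
theorem hasDerivAt_coordJet_family {L : JetSpace n B → ℝ} {h : ℝ × BaseSpace n → B}
    {a : BaseSpace n} (hh : ContDiffAt ℝ 2 h (0, a))
    (hL : DifferentiableAt ℝ L (coordJet (fun a' => h (0, a')) a)) :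
    HasDerivAt (fun t => L (coordJet (fun a' => h (t, a')) a))
      (fderiv ℝ L (coordJet (fun a' => h (0, a')) a) (0, deriv (fun t => h (t, a)) 0,
        fderiv ℝ (fun a' => deriv (fun t => h (t, a')) 0) a)) 0 := by
  have hd : ∀ᶠ p in 𝓝 ((0 : ℝ), a), DifferentiableAt ℝ h p := by
    filter_upwards [hh.eventually (by simp)] with p hp
    exact hp.differentiableAt (by simp)
  have hD : DifferentiableAt ℝ (fderiv ℝ h) (0, a) :=
    (hh.fderiv_right (m := 1) (by norm_num)).differentiableAt (by simp)
  have hx : ∀ p : ℝ × BaseSpace n, DifferentiableAt ℝ h p →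
      fderiv ℝ (fun a' => h (p.1, a')) p.2 =
        (fderiv ℝ h p).comp (ContinuousLinearMap.inr ℝ ℝ (BaseSpace n)) := by
    intro p hp
    exact (HasFDerivAt.comp p.2 (f := fun a' => (p.1, a')) (by exact hp.hasFDerivAt)
      (hasFDerivAt_prodMk_right p.1 p.2)).fderiv
  have ht : ∀ p : ℝ × BaseSpace n, DifferentiableAt ℝ h p →
      HasDerivAt (fun t => h (t, p.2)) (fderiv ℝ h p (1, 0)) p.1 := by
    intro p hp
    have := (HasFDerivAt.comp p.1 (f := fun t => (t, p.2)) (by exact hp.hasFDerivAt)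
      (hasFDerivAt_prodMk_left p.1 p.2)).hasDerivAt
    simpa [Function.comp_def] using this
  have hd0 : DifferentiableAt ℝ h (0, a) := hd.self_of_nhds
  -- Symmetry of the second derivative lets `∂_t` be exchanged with the derivative in `a`, so that
  -- the velocity of the jet is the jet of the velocity.
  have hsym : IsSymmSndFDerivAt ℝ h (0, a) := hh.isSymmSndFDerivAt (by simp)
  have e1 : fderiv ℝ (fun a' => deriv (fun t => h (t, a')) 0) a =
      (fderiv ℝ (fderiv ℝ h) (0, a) (1, 0)).comp (ContinuousLinearMap.inr ℝ ℝ (BaseSpace n)) := by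
    have hc : Filter.Tendsto (fun a' : BaseSpace n => ((0 : ℝ), a')) (𝓝 a) (𝓝 (0, a)) :=
      (Continuous.prodMk_right (0 : ℝ)).continuousAt
    have : (fun a' => deriv (fun t => h (t, a')) 0) =ᶠ[𝓝 a]
        fun a' => fderiv ℝ h (0, a') (1, 0) := by
      filter_upwards [hc.eventually hd] with a' ha'
      exact (ht (0, a') ha').deriv
    rw [this.fderiv_eq]
    have h2 := (HasFDerivAt.comp a (f := fun a' => ((0 : ℝ), a')) (by exact hD.hasFDerivAt)
      (hasFDerivAt_prodMk_right (0 : ℝ) a)).clm_apply (hasFDerivAt_const ((1 : ℝ), (0 : BaseSpace n)) a)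
    simp only [Function.comp_def] at h2
    rw [h2.fderiv]
    ext v
    simpa using hsym (0, v) (1, 0)
  have e2 : HasDerivAt (fun t => coordJet (fun a' => h (t, a')) a)
      ((0, deriv (fun t => h (t, a)) 0,
        fderiv ℝ (fun a' => deriv (fun t => h (t, a')) 0) a) : JetSpace n B) 0 := by
    refine (hasDerivAt_const (0 : ℝ) a).prodMk (HasDerivAt.prodMk ?_ ?_)
    · exact (ht (0, a) hd0).differentiableAt.hasDerivAt
    · have hc : Filter.Tendsto (fun t : ℝ => (t, a)) (𝓝 0) (𝓝 (0, a)) :=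
        (Continuous.prodMk_left a).continuousAt
      have : (fun t => fderiv ℝ (fun a' => h (t, a')) a) =ᶠ[𝓝 0]
          fun t => (fderiv ℝ h (t, a)).comp (ContinuousLinearMap.inr ℝ ℝ (BaseSpace n)) := by
        filter_upwards [hc.eventually hd] with t ht'
        exact hx (t, a) ht'
      refine HasDerivAt.congr_of_eventuallyEq ?_ this
      rw [e1]
      have h2 := (HasFDerivAt.comp (0 : ℝ) (f := fun t => (t, a)) (by exact hD.hasFDerivAt)
        (hasFDerivAt_prodMk_left (0 : ℝ) a)).hasDerivAt
      have h3 := h2.clm_comp (hasDerivAt_const (0 : ℝ) (ContinuousLinearMap.inr ℝ ℝ (BaseSpace n)))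
      simpa [Function.comp_def] using h3
  exact hL.hasFDerivAt.comp_hasDerivAt (0 : ℝ) e2

end Coordinates

/-! ### Differentiation under the integral and the divergence theorem for compact support -/

section Integrals

variable {A : Type*} [NormedAddCommGroup A] [NormedSpace ℝ A] [MeasurableSpace A] [BorelSpace A]
  {m : Measure A}

/-- Differentiation under the integral over a compact set. -/
theorem hasDerivAt_integral_of_contDiffOn [IsFiniteMeasureOnCompacts m] {g : ℝ × A → ℝ}
    {D : Set (ℝ × A)} (hD : IsOpen D) (hg : ContDiffOn ℝ 1 g D) {C : Set A} (hC : IsCompact C)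
    (hCD : ∀ a ∈ C, ((0 : ℝ), a) ∈ D) :
    IntegrableOn (fun a => deriv (fun t => g (t, a)) 0) C m ∧
    HasDerivAt (fun t => ∫ a in C, g (t, a) ∂m)
      (∫ a in C, deriv (fun t => g (t, a)) 0 ∂m) 0 := by
  -- The tube lemma gives one `δ` with `[-δ, δ] × C ⊆ D`; this product is compact, so the
  -- `t`-derivative is bounded there by a constant, which is integrable over `C`.
  obtain ⟨V, W, hV, hW, h0V, hCW, hVW⟩ := generalized_tube_lemma (isCompact_singleton (x := (0 : ℝ)))
    hC hD (by rintro ⟨t, a⟩ ⟨ht, ha⟩; rw [mem_singleton_iff] at ht; subst ht; exact hCD a ha)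
  obtain ⟨δ, hδ, hδV⟩ := Metric.nhds_basis_closedBall.mem_iff.1
    (hV.mem_nhds (h0V (mem_singleton 0)))
  have hsub : Metric.closedBall (0 : ℝ) δ ×ˢ C ⊆ D := fun p hp => hVW ⟨hδV hp.1, hCW hp.2⟩
  have hderiv : ∀ p ∈ D, HasDerivAt (fun t => g (t, p.2)) (fderiv ℝ g p (1, 0)) p.1 := by
    intro p hp
    have hp' : DifferentiableAt ℝ g p :=
      (hg.contDiffAt (hD.mem_nhds hp)).differentiableAt (by simp)
    have := (HasFDerivAt.comp p.1 (f := fun t => (t, p.2)) (by exact hp'.hasFDerivAt)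
      (hasFDerivAt_prodMk_left p.1 p.2)).hasDerivAt
    simpa [Function.comp_def] using this
  have hcont : ContinuousOn (fun p => fderiv ℝ g p (1, 0)) D :=
    (hg.continuousOn_fderiv_of_isOpen hD le_rfl).clm_apply continuousOn_const
  obtain ⟨M, hM⟩ := ((isCompact_closedBall (0 : ℝ) δ).prod hC).exists_bound_of_continuousOn
    (hcont.mono hsub)
  have hCm : MeasurableSet C := hC.isClosed.measurableSet
  have hslice : ∀ t ∈ Metric.closedBall (0 : ℝ) δ, ∀ {φ : ℝ × A → ℝ}, ContinuousOn φ D →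
      ContinuousOn (fun a => φ (t, a)) C := fun t ht φ hφ =>
    (hφ.comp (Continuous.prodMk_right t).continuousOn fun a ha => hsub ⟨ht, ha⟩)
  have h0 : (0 : ℝ) ∈ Metric.closedBall (0 : ℝ) δ := Metric.mem_closedBall_self hδ.le
  have key := hasDerivAt_integral_of_dominated_loc_of_deriv_le (μ := m.restrict C) (x₀ := (0 : ℝ))
    (s := Metric.closedBall (0 : ℝ) δ) (F := fun t a => g (t, a))
    (F' := fun t a => fderiv ℝ g (t, a) (1, 0)) (bound := fun _ => M)
    (Metric.closedBall_mem_nhds 0 hδ)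
    (by
      filter_upwards [Metric.closedBall_mem_nhds (0 : ℝ) hδ] with t ht
      exact (hslice t ht hg.continuousOn).aestronglyMeasurable_of_isCompact hC hCm)
    ((hslice 0 h0 hg.continuousOn).integrableOn_compact hC)
    ((hslice 0 h0 hcont).aestronglyMeasurable_of_isCompact hC hCm)
    (by
      filter_upwards [ae_restrict_mem hCm] with a ha t ht
      exact hM (t, a) ⟨ht, ha⟩)
    (integrableOn_const (hC.measure_lt_top.ne))
    (by
      filter_upwards [ae_restrict_mem hCm] with a ha t ht
      exact hderiv (t, a) (hsub ⟨ht, ha⟩))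
  have heq : EqOn (fun a => deriv (fun t => g (t, a)) 0) (fun a => fderiv ℝ g (0, a) (1, 0)) C :=
    fun a ha => (hderiv (0, a) (hCD a ha)).deriv
  refine ⟨(integrableOn_congr_fun heq hCm).2 key.1, ?_⟩
  rw [setIntegral_congr_fun hCm heq]
  exact key.2

/-- The integral of a derivative of a compactly supported function vanishes. -/
theorem setIntegral_fderiv_eq_zero [FiniteDimensional ℝ A] [m.IsAddHaarMeasure]
    {P : A → ℝ} {U C : Set A} (hU : IsOpen U)
    (hP : ContDiffOn ℝ 1 P U) (hC : IsCompact C) (hCU : C ⊆ U) (h0 : ∀ a ∈ U, a ∉ C → P a = 0)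
    (v : A) : ∫ a in C, fderiv ℝ P a v ∂m = 0 := by
  -- Extension of `P` by zero: it is `C¹` everywhere because `P` vanishes on `U \ C` and `C` is
  -- closed.
  set Q : A → ℝ := U.indicator P
  have hloc : ∀ a ∈ U, Q =ᶠ[𝓝 a] P := fun a ha => by
    filter_upwards [hU.mem_nhds ha] with x hx using indicator_of_mem hx P
  have hloc' : ∀ a ∉ C, Q =ᶠ[𝓝 a] fun _ => 0 := fun a ha => by
    filter_upwards [hC.isClosed.isOpen_compl.mem_nhds ha] with x hx
    by_cases hxU : x ∈ U
    · simp only [Q, indicator_of_mem hxU, h0 x hxU hx]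
    · simp only [Q, indicator_of_notMem hxU]
  have hQ : ContDiff ℝ 1 Q := contDiff_iff_contDiffAt.2 fun a => by
    by_cases ha : a ∈ C
    · exact (hP.contDiffAt (hU.mem_nhds (hCU ha))).congr_of_eventuallyEq (hloc a (hCU ha))
    · exact contDiffAt_const.congr_of_eventuallyEq (hloc' a ha)
  have hsupp : HasCompactSupport Q := HasCompactSupport.intro hC fun a ha => (hloc' a ha).self_of_nhds
  have hQ' : Continuous fun a => fderiv ℝ Q a v :=
    (hQ.continuous_fderiv one_ne_zero).clm_apply continuous_const
  have hintg : ∫ a, fderiv ℝ Q a v ∂m = 0 := by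
    -- Integration by parts against the constant function `1`.
    have := integral_mul_fderiv_eq_neg_fderiv_mul_of_integrable (μ := m) (f := fun _ : A => (1 : ℝ))
      (g := Q) (v := v) (by simp)
      (by simpa using hQ'.integrable_of_hasCompactSupport (hsupp.fderiv_apply ℝ v))
      (by simpa using hQ.continuous.integrable_of_hasCompactSupport hsupp)
      (fun _ _ => differentiableAt_const _) (fun a _ => hQ.differentiable one_ne_zero a)
    simpa using this
  rw [← hintg, ← setIntegral_eq_integral_of_forall_compl_eq_zero (s := C)
    (f := fun a => fderiv ℝ Q a v)]
  · refine setIntegral_congr_fun hC.isClosed.measurableSet fun a ha => ?_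
    simp only [(hloc a (hCU ha)).fderiv_eq]
  · intro a ha
    rw [(hloc' a ha).fderiv_eq]
    simp

end Integrals

/-! ### The first variation of the action in coordinates -/

section Variation

variable {n : ℕ} {B : Type*} [NormedAddCommGroup B] [NormedSpace ℝ B]

theorem contDiffOn_coordJet_family {h : ℝ × BaseSpace n → B} {D : Set (ℝ × BaseSpace n)}
    (hD : IsOpen D) (hh : ContDiffOn ℝ ∞ h D) :
    ContDiffOn ℝ ∞ (fun p : ℝ × BaseSpace n => coordJet (fun a' => h (p.1, a')) p.2) D := by
  have hx : ∀ p ∈ D, coordJet (fun a' => h (p.1, a')) p.2 = (p.2, h p,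
        (fderiv ℝ h p).comp (ContinuousLinearMap.inr ℝ ℝ (BaseSpace n))) := by
    intro p hp
    have hp' : DifferentiableAt ℝ h p :=
      (hh.contDiffAt (hD.mem_nhds hp)).differentiableAt (by simp)
    have := (HasFDerivAt.comp p.2 (f := fun a' => (p.1, a')) (by exact hp'.hasFDerivAt)
      (hasFDerivAt_prodMk_right p.1 p.2)).fderiv
    simp only [coordJet]
    exact Prod.ext rfl (Prod.ext rfl this)
  refine ContDiffOn.congr ?_ hx
  exact contDiff_snd.contDiffOn.prodMk (hh.prodMk
    ((hh.fderiv_of_isOpen hD (by simp)).clm_comp contDiffOn_const))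

/-- The derivative of the difference of the actions of two families that agree outside a
compact set. -/
theorem hasDerivAt_integral_lagrangian {L : JetSpace n B → ℝ} {S : Set (JetSpace n B)}
    (hS : IsOpen S) (hL : ContDiffOn ℝ ∞ L S) {D : Set (ℝ × BaseSpace n)} (hD : IsOpen D)
    {C : Set (BaseSpace n)} (hC : IsCompact C) (hCD : ∀ a ∈ C, ((0 : ℝ), a) ∈ D)
    {h₁ h₂ : ℝ × BaseSpace n → B} (hh₁ : ContDiffOn ℝ ∞ h₁ D) (hh₂ : ContDiffOn ℝ ∞ h₂ D)
    (hS₁ : ∀ p ∈ D, coordJet (fun a' => h₁ (p.1, a')) p.2 ∈ S)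
    (hS₂ : ∀ p ∈ D, coordJet (fun a' => h₂ (p.1, a')) p.2 ∈ S)
    (h0 : ∀ a, ((0 : ℝ), a) ∈ D → h₁ (0, a) = h₂ (0, a))
    (heq : ∀ p ∈ D, p.2 ∉ C → h₁ p = h₂ p) :
    HasDerivAt (fun t => ∫ a in C, (L (coordJet (fun a' => h₁ (t, a')) a) -
        L (coordJet (fun a' => h₂ (t, a')) a)))
      (∫ a in C, eulerLagrange L (fun a' => h₁ (0, a')) a
        (deriv (fun t => h₁ (t, a)) 0 - deriv (fun t => h₂ (t, a)) 0)) 0 := by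
  have hCm : MeasurableSet C := hC.isClosed.measurableSet
  set g : ℝ × BaseSpace n → ℝ := fun p => L (coordJet (fun a' => h₁ (p.1, a')) p.2) -
    L (coordJet (fun a' => h₂ (p.1, a')) p.2) with hgdef
  have hg : ContDiffOn ℝ ∞ g D :=
    (hL.comp (contDiffOn_coordJet_family hD hh₁) hS₁).sub
      (hL.comp (contDiffOn_coordJet_family hD hh₂) hS₂)
  obtain ⟨hintg, hder⟩ := hasDerivAt_integral_of_contDiffOn (m := volume) hD
    (hg.of_le (by simp)) hC hCD
  have hU : IsOpen {a : BaseSpace n | ((0 : ℝ), a) ∈ D} := hD.preimage (Continuous.prodMk_right 0)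
  set U := {a : BaseSpace n | ((0 : ℝ), a) ∈ D} with hUdef
  set f : BaseSpace n → B := fun a' => h₁ (0, a') with hfdef
  set η : BaseSpace n → B := fun a => deriv (fun t => h₁ (t, a)) 0 - deriv (fun t => h₂ (t, a)) 0
    with hηdef
  have hderiv : ∀ {h : ℝ × BaseSpace n → B}, ContDiffOn ℝ ∞ h D →
      ContDiffOn ℝ ∞ (fun a => deriv (fun t => h (t, a)) 0) U := by
    intro h hh
    have : ContDiffOn ℝ ∞ (fun a => fderiv ℝ h (0, a) (1, 0)) U :=
      ((hh.fderiv_of_isOpen hD (m := ∞) (by simp)).comp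
        (contDiff_prodMk_right (0 : ℝ)).contDiffOn fun a ha => ha).clm_apply contDiffOn_const
    refine this.congr fun a ha => ?_
    have ha' : DifferentiableAt ℝ h (0, a) :=
      (hh.contDiffAt (hD.mem_nhds ha)).differentiableAt (by simp)
    have := (HasFDerivAt.comp (0 : ℝ) (f := fun t => (t, a)) (by exact ha'.hasFDerivAt)
      (hasFDerivAt_prodMk_left (0 : ℝ) a)).hasDerivAt
    simp only [Function.comp_def] at this
    simpa using this.deriv
  have hη : ContDiffOn ℝ ∞ η U := (hderiv hh₁).sub (hderiv hh₂)
  have hf : ContDiffOn ℝ ∞ (coordJet f) U :=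
    (contDiffOn_coordJet_family hD hh₁).comp (contDiff_prodMk_right (0 : ℝ)).contDiffOn
      fun a ha => ha
  have hfS : ∀ a ∈ U, coordJet f a ∈ S := fun a ha => hS₁ (0, a) ha
  have hp : ContDiffOn ℝ ∞ (fun a => fderiv ℝ L (coordJet f a)) U :=
    (hL.fderiv_of_isOpen hS (m := ∞) (by simp)).comp hf hfS
  have hpd : ∀ a ∈ U, DifferentiableAt ℝ (fun a => fderiv ℝ L (coordJet f a)) a := fun a ha =>
    (hp.contDiffAt (hU.mem_nhds ha)).differentiableAt (by simp)
  have hfeq : ∀ a ∈ U, coordJet (fun a' => h₂ (0, a')) a = coordJet f a := by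
    intro a ha
    have : (fun a' => h₂ (0, a')) =ᶠ[𝓝 a] f := by
      filter_upwards [hU.mem_nhds ha] with x hx using (h0 x hx).symm
    simp only [coordJet, this.fderiv_eq, this.self_of_nhds]
  -- Both families have the same jet at `t = 0`, hence the same `fderiv ℝ L` there; by linearity
  -- only the difference `η` of their velocities matters.
  have hvar : ∀ a ∈ U, deriv (fun t => g (t, a)) 0 =
      fderiv ℝ L (coordJet f a) (0, η a, fderiv ℝ η a) := by
    intro a ha
    have hLa : DifferentiableAt ℝ L (coordJet f a) :=
      (hL.contDiffAt (hS.mem_nhds (hfS a ha))).differentiableAt (by simp)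
    have d1 := hasDerivAt_coordJet_family (L := L) (h := h₁) (a := a)
      ((hh₁.contDiffAt (hD.mem_nhds ha)).of_le ENat.LEInfty.out) hLa
    have d2 := hasDerivAt_coordJet_family (L := L) (h := h₂) (a := a)
      ((hh₂.contDiffAt (hD.mem_nhds ha)).of_le ENat.LEInfty.out)
      (by rw [hfeq a ha]; exact hLa)
    rw [show deriv (fun t => g (t, a)) 0 = _ from (d1.fun_sub d2).deriv, hfeq a ha, ← map_sub]
    congr 1
    have e1 : DifferentiableAt ℝ (fun a => deriv (fun t => h₁ (t, a)) 0) a :=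
      ((hderiv hh₁).contDiffAt (hU.mem_nhds ha)).differentiableAt (by simp)
    have e2 : DifferentiableAt ℝ (fun a => deriv (fun t => h₂ (t, a)) 0) a :=
      ((hderiv hh₂).contDiffAt (hU.mem_nhds ha)).differentiableAt (by simp)
    simp only [hηdef, fderiv_fun_sub e1 e2, Prod.mk_sub_mk, sub_self]
  set P : Fin (n + 1) → BaseSpace n → ℝ := fun μ a => fderiv ℝ L (coordJet f a) (velocity μ (η a))
    with hPdef
  have hP : ∀ μ, ContDiffOn ℝ ∞ (P μ) U := fun μ =>
    hp.clm_apply ((velocity (n := n) (B := B) μ).contDiff.comp_contDiffOn hη :)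
  -- Outside `C` the families coincide for all small `t`, so `η`, and with it each flux `P μ`,
  -- vanishes there; this is what kills the divergence term.
  have hη0 : ∀ a ∈ U, a ∉ C → η a = 0 := by
    intro a ha haC
    have hc : Filter.Tendsto (fun t : ℝ => (t, a)) (𝓝 0) (𝓝 (0, a)) :=
      (Continuous.prodMk_left a).continuousAt
    have : (fun t => h₁ (t, a)) =ᶠ[𝓝 0] fun t => h₂ (t, a) := by
      filter_upwards [hc.eventually (hD.mem_nhds ha)] with t ht using heq (t, a) ht haC
    simp only [hηdef, this.deriv_eq, sub_self]
  have hPint : ∀ μ, ∫ a in C, fderiv ℝ (P μ) a (coordVec μ) = 0 := fun μ =>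
    setIntegral_fderiv_eq_zero hU ((hP μ).of_le (by simp)) hC hCD
      (fun a ha haC => by simp only [hPdef, hη0 a ha haC, map_zero]) _
  have hPi : ∀ μ, IntegrableOn (fun a => fderiv ℝ (P μ) a (coordVec μ)) C := fun μ =>
    ContinuousOn.integrableOn_compact hC
      ((((hP μ).continuousOn_fderiv_of_isOpen hU (by simp)).clm_apply continuousOn_const).mono hCD)
  have hEL : EqOn (fun a => eulerLagrange L f a (η a))
      (fun a => deriv (fun t => g (t, a)) 0 - ∑ μ, fderiv ℝ (P μ) a (coordVec μ)) C := by
    intro a ha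
    have haU : a ∈ U := hCD a ha
    have := firstVariation_eq (hpd a haU)
      ((hη.contDiffAt (hU.mem_nhds haU)).differentiableAt (by simp))
    simp only [hvar a haU, this, hPdef, add_sub_cancel_right]
  have hfin : ∫ a in C, eulerLagrange L f a (η a) = ∫ a in C, deriv (fun t => g (t, a)) 0 := by
    rw [setIntegral_congr_fun hCm hEL, integral_sub hintg (integrable_finsetSum _ fun μ _ => hPi μ),
      integral_finsetSum _ fun μ _ => hPi μ]
    simp [hPint]
  rw [hfin]
  exact hder

end Variation

/-! ### Forms in coordinates and the exterior derivative of the Cartan form -/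

section CoordinateForms

variable {n : ℕ} {B : Type*} [NormedAddCommGroup B] [NormedSpace ℝ B]

/-- The standard volume form of the coordinate space. -/
def volumeForm (n : ℕ) : BaseSpace n [⋀^Fin (n + 1)]→L[ℝ] ℝ where
  toMultilinearMap := (EuclideanSpace.basisFun (Fin (n + 1)) ℝ).toBasis.det.toMultilinearMap
  cont := by
    change Continuous fun v => (EuclideanSpace.basisFun (Fin (n + 1)) ℝ).toBasis.det v
    simp only [Module.Basis.det_apply]
    refine Continuous.matrix_det (continuous_matrix fun i j => ?_)
    simp only [Module.Basis.toMatrix_apply, OrthonormalBasis.coe_toBasis_repr_apply,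
      EuclideanSpace.basisFun_repr]
    fun_prop
  map_eq_zero_of_eq' := (EuclideanSpace.basisFun (Fin (n + 1)) ℝ).toBasis.det.map_eq_zero_of_eq'

theorem volumeForm_coordVec : volumeForm n coordVec = 1 := by
  have : (coordVec : Fin (n + 1) → BaseSpace n) =
      (EuclideanSpace.basisFun (Fin (n + 1)) ℝ).toBasis := by
    ext1 μ; simp [coordVec]
  rw [this]
  exact (EuclideanSpace.basisFun (Fin (n + 1)) ℝ).toBasis.det_self

/-- Forms of top degree are determined by their value on the coordinate vectors. -/
theorem topForm_apply (α : BaseSpace n [⋀^Fin (n + 1)]→L[ℝ] ℝ) (v : Fin (n + 1) → BaseSpace n) :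
    α v = volumeForm n v * α coordVec := by
  have h := AlternatingMap.eq_smul_basis_det (EuclideanSpace.basisFun (Fin (n + 1)) ℝ).toBasis
    α.toAlternatingMap
  have e : ((EuclideanSpace.basisFun (Fin (n + 1)) ℝ).toBasis : Fin (n + 1) → BaseSpace n) =
      coordVec := by
    ext1 μ; simp [coordVec]
  have := DFunLike.congr_fun h v
  rw [e] at this
  rw [mul_comm]
  exact this

/-- Expanding `w` in the basis, every term except the `μ`-th repeats a basis vector. This reads off
single momenta from the form built in `exists_form_of_affine`. -/
theorem volumeForm_update (μ : Fin (n + 1)) (w : BaseSpace n) :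
    volumeForm n (update coordVec μ w) = w μ := by
  have hw : w = ∑ ν, w ν • coordVec ν := by
    ext ν
    simp [Finset.sum_apply, Pi.single_apply]
  conv_lhs => rw [hw]
  have h := (volumeForm n).toMultilinearMap.map_update_sum Finset.univ μ
    (fun ν => w ν • coordVec ν) coordVec
  refine h.trans ?_
  rw [Finset.sum_eq_single μ]
  · rw [MultilinearMap.map_update_smul]
    have : (volumeForm n).toMultilinearMap (update coordVec μ (coordVec μ)) = 1 := by
      rw [update_eq_self]; exact volumeForm_coordVec
    rw [this]; simp
  · intro ν _ hν
    rw [MultilinearMap.map_update_smul]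
    have : (volumeForm n).toMultilinearMap (update coordVec μ (coordVec ν)) = 0 := by
      refine (volumeForm n).map_eq_zero_of_eq _ (i := μ) (j := ν) ?_ hν.symm
      simp [hν]
    rw [this]; simp
  · simp

/-- Every affine function of the velocity is represented by a form that vanishes on two vertical
vectors. -/
theorem exists_form_of_affine (ℓ : ℝ) (D : (BaseSpace n →L[ℝ] B) →L[ℝ] ℝ) (v : BaseSpace n →L[ℝ] B) :
    ∃ z : (BaseSpace n × B) [⋀^Fin (n + 1)]→L[ℝ] ℝ,
      (∀ (u : Fin (n + 1) → BaseSpace n × B) (i j : Fin (n + 1)), i ≠ j → (u i).1 = 0 →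
        (u j).1 = 0 → z u = 0) ∧
      ∀ v' : BaseSpace n →L[ℝ] B, z (fun μ => (coordVec μ, v' (coordVec μ))) = ℓ + D (v' - v) := by
  -- The momenta collected into a vector: the `μ`-th component of `S c` is `D (dx^μ ⊗ c)`.
  let S : B →L[ℝ] BaseSpace n := ∑ μ, (D.comp (ContinuousLinearMap.smulRightL ℝ (BaseSpace n) B
    (EuclideanSpace.proj μ))).smulRight (coordVec μ)
  have hS : ∀ c μ, S c μ = D ((EuclideanSpace.proj μ : BaseSpace n →L[ℝ] ℝ).smulRight c) := by
    intro c μ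
    simp only [S, sum_apply, ContinuousLinearMap.smulRight_apply]
    rw [WithLp.ofLp_sum, Finset.sum_apply, Finset.sum_eq_single μ]
    · simp
    · intro ν _ hν; simp [hν.symm]
    · simp
  -- The contact form `dy - v dx`, which vanishes on the graph of `v`.
  let w : BaseSpace n × B →L[ℝ] B := ContinuousLinearMap.snd ℝ _ _ -
    v.comp (ContinuousLinearMap.fst ℝ _ _)
  let g : BaseSpace n × B →L[ℝ] (BaseSpace n × B) [⋀^Fin n]→L[ℝ] ℝ :=
    (ContinuousAlternatingMap.compContinuousLinearMapCLM
      (ContinuousLinearMap.fst ℝ (BaseSpace n) B)).comp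
      ((volumeForm n).curryLeft.comp (S.comp w))
  -- The Cartan form: `ℓ` times the volume, plus the sum over the slots of the volume form with one
  -- argument replaced by the momentum vector of its contact part. On the graph of `v'` the second
  -- summand is the trace giving `D (v' - v)`.
  let z : (BaseSpace n × B) [⋀^Fin (n + 1)]→L[ℝ] ℝ :=
    ℓ • (volumeForm n).compContinuousLinearMap (ContinuousLinearMap.fst ℝ (BaseSpace n) B) +
      ContinuousAlternatingMap.alternatizeUncurryFin g
  have hz : ∀ u, z u = ℓ * volumeForm n (fun i => (u i).1) +
      ∑ i, volumeForm n (update (fun i => (u i).1) i (S ((u i).2 - v (u i).1))) := by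
    intro u
    simp only [z, ContinuousAlternatingMap.add_apply, ContinuousAlternatingMap.smul_apply,
      ContinuousAlternatingMap.alternatizeUncurryFin_apply, smul_eq_mul]
    congr 1
    refine Finset.sum_congr rfl fun i _ => ?_
    rw [← Fin.insertNth_removeNth, ContinuousAlternatingMap.map_insertNth]
    rfl
  refine ⟨z, ?_, ?_⟩
  · intro u i j hij hi hj
    rw [hz, (volumeForm n).map_coord_zero i hi, mul_zero, zero_add]
    -- Each summand replaces only one slot, so one of the two vertical arguments survives with base
    -- component zero.
    refine Finset.sum_eq_zero fun k _ => ?_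
    by_cases hk : i = k
    · refine (volumeForm n).map_coord_zero j ?_
      rw [update_of_ne (by rintro rfl; exact hij hk)]; exact hj
    · refine (volumeForm n).map_coord_zero i ?_
      rw [update_of_ne hk]; exact hi
  · intro v'
    rw [hz]
    simp only [volumeForm_update, hS, volumeForm_coordVec, mul_one]
    rw [← map_sum, ← sum_proj_smulRight (v' - v)]
    rfl

/-- The momenta of a form that represents an affine function of the velocity. -/
theorem form_update_vertical {z : (BaseSpace n × B) [⋀^Fin (n + 1)]→L[ℝ] ℝ} {ℓ : ℝ}
    {D : JetSpace n B →L[ℝ] ℝ} {v : BaseSpace n →L[ℝ] B}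
    (hz : ∀ v' : BaseSpace n →L[ℝ] B,
      z (fun μ => (coordVec μ, v' (coordVec μ))) = ℓ + D (0, 0, v' - v))
    (γ : BaseSpace n →L[ℝ] B) (c : B) (μ : Fin (n + 1)) :
    z (update (fun ν => (coordVec ν, γ (coordVec ν))) μ (0, c)) = D (velocity μ c) := by
  set u' : Fin (n + 1) → BaseSpace n × B := fun ν => (coordVec ν, γ (coordVec ν)) with hu'
  -- Adding `dx^μ ⊗ c` to `γ` changes only the `μ`-th graph vector, by `(0, c)`. Subtracting the two
  -- instances of `hz` therefore isolates the wanted value.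
  have e2 : (fun ν => ((coordVec ν : BaseSpace n),
      (γ + (EuclideanSpace.proj μ : BaseSpace n →L[ℝ] ℝ).smulRight c) (coordVec ν))) =
      update u' μ (u' μ + (0, c)) := by
    ext1 i
    by_cases hi : i = μ
    · subst hi; simp [hu']
    · simp [hu', update_of_ne hi, Ne.symm hi]
  have g1 := hz γ
  have g2 := hz (γ + (EuclideanSpace.proj μ : BaseSpace n →L[ℝ] ℝ).smulRight c)
  rw [e2, ContinuousAlternatingMap.map_update_add, update_eq_self, g1] at g2
  have e3 : ((0, 0, γ + (EuclideanSpace.proj μ : BaseSpace n →L[ℝ] ℝ).smulRight c - v) :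
      JetSpace n B) = (0, 0, γ - v) + velocity μ c := by
    simp [sub_add_eq_add_sub]
  rw [e3, map_add] at g2
  linarith

/-- The derivative, in a direction vertical over the base, of an affine function of the velocity
whose derivatives are those of `L`. -/
theorem fderiv_affineApprox {L : JetSpace n B → ℝ} {w₀ : JetSpace n B}
    (hLd : DifferentiableAt ℝ L w₀) (hDL : DifferentiableAt ℝ (fderiv ℝ L) w₀)
    (c : B) (σ : BaseSpace n →L[ℝ] B) :
    fderiv ℝ (fun w : JetSpace n B => L w + fderiv ℝ L w (0, 0, w₀.2.2 - w.2.2)) w₀ (0, c, σ) =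
      fderiv ℝ L w₀ (0, c, 0) := by
  set U : JetSpace n B := (0, c, σ) with hU
  have hlin : HasFDerivAt (fun w : JetSpace n B => ((0, 0, w₀.2.2 - w.2.2) : JetSpace n B))
      (ContinuousLinearMap.prod 0 (ContinuousLinearMap.prod 0
        (-((ContinuousLinearMap.snd ℝ B (BaseSpace n →L[ℝ] B)).comp
          (ContinuousLinearMap.snd ℝ (BaseSpace n) (B × (BaseSpace n →L[ℝ] B))))))) w₀ := by
    refine (hasFDerivAt_const _ _).prodMk ((hasFDerivAt_const _ _).prodMk ?_)
    exact ((ContinuousLinearMap.snd ℝ B (BaseSpace n →L[ℝ] B)).comp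
      (ContinuousLinearMap.snd ℝ (BaseSpace n)
        (B × (BaseSpace n →L[ℝ] B)))).hasFDerivAt.const_sub _
  -- In the product rule the second-derivative term is applied to `w₀.2.2 - w₀.2.2 = 0`, and
  -- differentiating the argument gives `-∂_v L · σ`, which cancels the `σ`-part of `DL`.
  have hd := hLd.hasFDerivAt.fun_add (hDL.hasFDerivAt.clm_apply hlin)
  rw [hd.fderiv]
  have hz0 : ((0, 0, w₀.2.2 - w₀.2.2) : JetSpace n B) = 0 := by simp
  have hU2 : U = (0, c, 0) + (0, 0, σ) := by simp [hU]
  have hU4 : ContinuousLinearMap.prod (0 : JetSpace n B →L[ℝ] BaseSpace n)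
      (ContinuousLinearMap.prod (0 : JetSpace n B →L[ℝ] B)
        (-((ContinuousLinearMap.snd ℝ B (BaseSpace n →L[ℝ] B)).comp
          (ContinuousLinearMap.snd ℝ (BaseSpace n) (B × (BaseSpace n →L[ℝ] B)))))) U =
      -(0, 0, σ) := by simp [hU]
  rw [add_apply, add_apply, ContinuousLinearMap.comp_apply,
    ContinuousLinearMap.flip_apply, hz0, map_zero, add_zero, hU4, map_neg, hU2, map_add]
  abel

/-- The exterior derivative of the Cartan form along a jet, in coordinates. -/
theorem extDeriv_cartan {L : JetSpace n B → ℝ} {f : BaseSpace n → B} {a : BaseSpace n}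
    (hf : ContDiffAt ℝ 2 f a) (hL : ContDiffAt ℝ 2 L (coordJet f a))
    {Θ : JetSpace n B → JetSpace n B [⋀^Fin (n + 1)]→L[ℝ] ℝ}
    {z : JetSpace n B → (BaseSpace n × B) [⋀^Fin (n + 1)]→L[ℝ] ℝ}
    (hΘd : DifferentiableAt ℝ Θ (coordJet f a))
    (hΘ : ∀ᶠ w in 𝓝 (coordJet f a), ∀ u, Θ w u = z w fun i => ((u i).1, (u i).2.1))
    (hz : ∀ᶠ w in 𝓝 (coordJet f a), ∀ v' : BaseSpace n →L[ℝ] B,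
      z w (fun μ => (coordVec μ, v' (coordVec μ))) = L w + fderiv ℝ L w (0, 0, v' - w.2.2))
    (c : B) (σ : BaseSpace n →L[ℝ] B) :
    extDeriv Θ (coordJet f a)
      (Fin.cons (0, c, σ) fun μ => fderiv ℝ (coordJet f) a (coordVec μ)) =
      eulerLagrange L f a c := by
  set w₀ := coordJet f a with hw₀
  set U : JetSpace n B := (0, c, σ) with hU
  set u : Fin (n + 1) → JetSpace n B := fun μ => fderiv ℝ (coordJet f) a (coordVec μ) with hu
  have hDf : DifferentiableAt ℝ (fderiv ℝ f) a :=
    (hf.fderiv_right (m := 1) (by norm_num)).differentiableAt (by simp)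
  have hfd : DifferentiableAt ℝ f a := hf.differentiableAt (by simp)
  have hj : HasFDerivAt (coordJet f) ((ContinuousLinearMap.id ℝ (BaseSpace n)).prod
      ((fderiv ℝ f a).prod (fderiv ℝ (fderiv ℝ f) a))) a :=
    (hasFDerivAt_id a).prodMk (hfd.hasFDerivAt.prodMk hDf.hasFDerivAt)
  have hu1 : ∀ μ, ((u μ).1, (u μ).2.1) = (coordVec μ, fderiv ℝ f a (coordVec μ)) := by
    intro μ
    simp only [hu, hj.fderiv]; rfl
  have hDL : DifferentiableAt ℝ (fderiv ℝ L) w₀ :=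
    (hL.fderiv_right (m := 1) (by norm_num)).differentiableAt (by simp)
  have hLd : DifferentiableAt ℝ L w₀ := hL.differentiableAt (by simp)
  -- The exterior derivative on constant vectors is the alternating sum of directional derivatives
  -- of `Θ` on the remaining vectors: slot `0` gives the `∂_y L` term, slot `μ + 1` the derivative
  -- of the `μ`-th momentum.
  rw [extDeriv_apply hΘd, Fin.sum_univ_succ]
  have t0 : fderiv ℝ (fun w => Θ w u) w₀ U = fderiv ℝ L w₀ (0, c, 0) := by
    have he : (fun w => Θ w u) =ᶠ[𝓝 w₀]
        fun w => L w + fderiv ℝ L w (0, 0, fderiv ℝ f a - w.2.2) := by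
      filter_upwards [hΘ, hz] with w h1 h2
      rw [h1, ← h2 (fderiv ℝ f a)]
      simp only [hu1]
    rw [he.fderiv_eq]
    exact fderiv_affineApprox hLd hDL c σ
  have ts : ∀ μ : Fin (n + 1), (-1) ^ ((μ.succ : Fin (n + 2)) : ℕ) •
      fderiv ℝ (fun w => Θ w (Fin.removeNth μ.succ (Fin.cons U u : Fin (n + 2) → JetSpace n B)))
        w₀ (u μ) =
      - fderiv ℝ (fun a' => fderiv ℝ L (coordJet f a') (velocity μ c)) a (coordVec μ) := by
    intro μ
    have h1 : ∀ᶠ w in 𝓝 w₀,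
        Θ w (Fin.removeNth μ.succ (Fin.cons U u : Fin (n + 2) → JetSpace n B)) =
          (-1) ^ (μ : ℕ) * fderiv ℝ L w (velocity μ c) := by
      filter_upwards [hΘ, hz] with w h1 h2
      have hrem : Fin.removeNth μ.succ (Fin.cons U u : Fin (n + 2) → JetSpace n B) =
          Fin.cons U (Fin.removeNth μ u) := by
        ext1 i
        refine Fin.cases ?_ (fun k => ?_) i
        · rfl
        · simp [Fin.removeNth]
      -- Moving `U` from the front to the slot `μ` costs `(-1)^μ`; with the factor `(-1)^(μ+1)` of
      -- the alternating sum this leaves the minus sign of the Euler–Lagrange expression.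
      have hup : (-1) ^ (μ : ℕ) * Θ w (Fin.cons U (Fin.removeNth μ u)) = Θ w (update u μ U) := by
        rw [← Fin.insertNth_removeNth, ContinuousAlternatingMap.map_insertNth]
        simp
        rfl
      have hval : Θ w (update u μ U) = fderiv ℝ L w (velocity μ c) := by
        have e1 : (fun i => (((update u μ U) i).1, ((update u μ U) i).2.1)) =
            update (fun ν => (coordVec ν, fderiv ℝ f a (coordVec ν))) μ (0, c) := by
          ext1 i
          by_cases hi : i = μ
          · subst hi; simp [hU]
          · simp only [update_of_ne hi, hu1]
        rw [h1, e1]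
        exact form_update_vertical h2 _ c μ
      rw [hrem, ← hval, ← hup, ← mul_assoc, ← mul_pow]
      simp
    rw [Filter.EventuallyEq.fderiv_eq h1]
    have hd : HasFDerivAt (fun w => fderiv ℝ L w (velocity μ c)) _ w₀ :=
      hDL.hasFDerivAt.clm_apply (hasFDerivAt_const (velocity μ c) w₀)
    -- Since `u μ` is the derivative of the jet along `∂_μ`, the directional derivative on jet space
    -- is the total derivative along `f`.
    have hcomp := HasFDerivAt.comp a (f := coordJet f) hd hj
    rw [(hd.const_mul ((-1) ^ (μ : ℕ))).fderiv]
    have := hcomp.fderiv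
    simp only [Function.comp_def] at this
    rw [this]
    simp only [hu, hj.fderiv]
    simp [pow_succ, ← mul_assoc, ← mul_pow]
  rw [eulerLagrange, sub_eq_add_neg, ← Finset.sum_neg_distrib]
  refine congrArg₂ (· + ·) ?_ (Finset.sum_congr rfl fun μ _ => ts μ)
  rw [Fin.val_zero, pow_zero, one_smul]
  exact t0

end CoordinateForms

/-! ### Integration of top-degree forms: change of charts and localization -/

theorem volumeForm_map {n : ℕ} (T : BaseSpace n →L[ℝ] BaseSpace n) :
    volumeForm n (fun μ => T (coordVec μ)) = T.det := by
  have h := Module.Basis.det_comp_basis (EuclideanSpace.basisFun (Fin (n + 1)) ℝ).toBasis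
    (EuclideanSpace.basisFun (Fin (n + 1)) ℝ).toBasis T.toLinearMap
  have e : ((EuclideanSpace.basisFun (Fin (n + 1)) ℝ).toBasis : Fin (n + 1) → BaseSpace n) =
      coordVec := by
    ext1 μ; simp [coordVec]
  rw [e] at h
  refine Eq.trans h ?_
  have : LinearMap.comp ((EuclideanSpace.basisFun (Fin (n + 1)) ℝ).toBasis.equiv
      (EuclideanSpace.basisFun (Fin (n + 1)) ℝ).toBasis (Equiv.refl _)).toLinearMap
      T.toLinearMap = T.toLinearMap := by
    simp
  rw [ContinuousLinearMap.det]
  congr 1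

section ManifoldIntegral

variable {n : ℕ} {X : Type*} [TopologicalSpace X]
  [ChartedSpace (EuclideanSpace ℝ (Fin (n + 1))) X]

/-- The component `α(∂₀, …, ∂ₙ)` of a form of top degree in the preferred chart at `i`. -/
def coordDensity (α : ∀ x : X, TangentSpace (𝓡 (n + 1)) x [⋀^Fin (n + 1)]→L[ℝ] ℝ) (i : X)
    (u : BaseSpace n) : ℝ :=
  formInChart (𝓡 (n + 1)) α i u coordVec

theorem coordDensity_eq_zero {α : ∀ x : X, TangentSpace (𝓡 (n + 1)) x [⋀^Fin (n + 1)]→L[ℝ] ℝ}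
    {i : X} {u : BaseSpace n} (h : α ((extChartAt (𝓡 (n + 1)) i).symm u) = 0) :
    coordDensity α i u = 0 := by
  simp only [coordDensity, formInChart, h]
  rfl

theorem coordDensity_sub (α β : ∀ x : X, TangentSpace (𝓡 (n + 1)) x [⋀^Fin (n + 1)]→L[ℝ] ℝ)
    (i : X) (u : BaseSpace n) :
    coordDensity (fun x => α x - β x) i u = coordDensity α i u - coordDensity β i u := rfl

/-- The transition map between two preferred charts. -/
def transition (i j : X) (u : BaseSpace n) : BaseSpace n :=
  extChartAt (𝓡 (n + 1)) j ((extChartAt (𝓡 (n + 1)) i).symm u)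

theorem det_transition_pos (hX : IsOrientedAtlas n X) {i j : X} {u : BaseSpace n}
    (hu : u ∈ (extChartAt (𝓡 (n + 1)) i).target)
    (hj : (extChartAt (𝓡 (n + 1)) i).symm u ∈ (extChartAt (𝓡 (n + 1)) j).source) :
    0 < (fderiv ℝ (transition i j) u).det := by
  refine hX _ (chart_mem_atlas _ i) _ (chart_mem_atlas _ j) u ?_
  rw [OpenPartialHomeomorph.trans_source]
  rw [extChartAt_source] at hj
  simp only [mfld_simps] at hu hj ⊢
  exact ⟨hu, hj⟩

theorem measurableSet_chart_preimage {K : Set X} (hK : IsClosed K) (j : X) :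
    MeasurableSet ((extChartAt (𝓡 (n + 1)) j).target ∩ (extChartAt (𝓡 (n + 1)) j).symm ⁻¹' K) := by
  have h1 : IsOpen ((extChartAt (𝓡 (n + 1)) j).target ∩
      (extChartAt (𝓡 (n + 1)) j).symm ⁻¹' Kᶜ) :=
    (continuousOn_extChartAt_symm j).isOpen_inter_preimage (isOpen_extChartAt_target j)
      hK.isOpen_compl
  have : (extChartAt (𝓡 (n + 1)) j).target ∩ (extChartAt (𝓡 (n + 1)) j).symm ⁻¹' K =
      (extChartAt (𝓡 (n + 1)) j).target \ ((extChartAt (𝓡 (n + 1)) j).target ∩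
      (extChartAt (𝓡 (n + 1)) j).symm ⁻¹' Kᶜ) := by
    ext u
    simp only [mem_inter_iff, mem_preimage, mem_sdiff, mem_compl_iff]
    tauto
  rw [this]
  exact (isOpen_extChartAt_target j).measurableSet.diff h1.measurableSet

variable [IsManifold (𝓡 (n + 1)) ∞ X]

theorem mdifferentiableAt_extChartAt_symm {i : X} {u : BaseSpace n}
    (hu : u ∈ (extChartAt (𝓡 (n + 1)) i).target) :
    MDifferentiableAt 𝓘(ℝ, BaseSpace n) (𝓡 (n + 1)) (extChartAt (𝓡 (n + 1)) i).symm u :=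
  ((contMDiffOn_extChartAt_symm (n := ∞) i).contMDiffAt
    ((isOpen_extChartAt_target i).mem_nhds hu)).mdifferentiableAt (by simp)

theorem differentiableAt_transition {i j : X} {u : BaseSpace n}
    (hu : u ∈ (extChartAt (𝓡 (n + 1)) i).target)
    (hj : (extChartAt (𝓡 (n + 1)) i).symm u ∈ (extChartAt (𝓡 (n + 1)) j).source) :
    DifferentiableAt ℝ (transition i j : BaseSpace n → BaseSpace n) u := by
  rw [← mdifferentiableAt_iff_differentiableAt]
  rw [extChartAt_source] at hj
  exact MDifferentiableAt.comp u (mdifferentiableAt_extChartAt hj)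
    (mdifferentiableAt_extChartAt_symm hu)

/-- Near `u` the inverse chart at `i` is the inverse chart at `j` composed with the transition map;
the chain rule does the rest. -/
theorem formInChart_transition
    (α : ∀ x : X, TangentSpace (𝓡 (n + 1)) x [⋀^Fin (n + 1)]→L[ℝ] ℝ) {i j : X} {u : BaseSpace n}
    (hu : u ∈ (extChartAt (𝓡 (n + 1)) i).target)
    (hj : (extChartAt (𝓡 (n + 1)) i).symm u ∈ (extChartAt (𝓡 (n + 1)) j).source) :
    formInChart (𝓡 (n + 1)) α i u = (formInChart (𝓡 (n + 1)) α j
      (transition i j u)).compContinuousLinearMap (fderiv ℝ (transition i j) u) := by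
  have hx : (extChartAt (𝓡 (n + 1)) j).symm (transition i j u) =
      (extChartAt (𝓡 (n + 1)) i).symm u := (extChartAt (𝓡 (n + 1)) j).left_inv hj
  have ht : transition i j u ∈ (extChartAt (𝓡 (n + 1)) j).target :=
    (extChartAt (𝓡 (n + 1)) j).map_source hj
  have hev : (fun u' => (extChartAt (𝓡 (n + 1)) j).symm (transition i j u')) =ᶠ[𝓝 u]
      (extChartAt (𝓡 (n + 1)) i).symm := by
    have hc : ContinuousAt (extChartAt (𝓡 (n + 1)) i).symm u :=
      (continuousOn_extChartAt_symm i).continuousAt ((isOpen_extChartAt_target i).mem_nhds hu)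
    filter_upwards [hc.preimage_mem_nhds ((isOpen_extChartAt_source j).mem_nhds hj)] with u' hu'
    exact (extChartAt (𝓡 (n + 1)) j).left_inv hu'
  have hd := mfderiv_comp u (mdifferentiableAt_extChartAt_symm (n := n) (i := j) ht)
    (mdifferentiableAt_iff_differentiableAt.2 (differentiableAt_transition hu hj))
  have hd' : mfderiv 𝓘(ℝ, BaseSpace n) (𝓡 (n + 1)) (extChartAt (𝓡 (n + 1)) i).symm u =
      (mfderiv 𝓘(ℝ, BaseSpace n) (𝓡 (n + 1)) (extChartAt (𝓡 (n + 1)) j).symm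
        (transition i j u)).comp (fderiv ℝ (transition i j) u) := by
    refine ((hev.mfderiv_eq (I := 𝓘(ℝ, BaseSpace n)) (I' := 𝓡 (n + 1))).symm.trans hd).trans ?_
    exact congrArg _ mfderiv_eq_fderiv
  unfold formInChart
  rw [hd']
  ext v
  simp only [ContinuousAlternatingMap.compContinuousLinearMap_apply]
  rw [hx]
  rfl

theorem coordDensity_transition
    (α : ∀ x : X, TangentSpace (𝓡 (n + 1)) x [⋀^Fin (n + 1)]→L[ℝ] ℝ) {i j : X} {u : BaseSpace n}
    (hu : u ∈ (extChartAt (𝓡 (n + 1)) i).target)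
    (hj : (extChartAt (𝓡 (n + 1)) i).symm u ∈ (extChartAt (𝓡 (n + 1)) j).source) :
    coordDensity α i u = (fderiv ℝ (transition i j) u).det * coordDensity α j (transition i j u) := by
  rw [coordDensity, formInChart_transition α hu hj]
  generalize hβ : formInChart (𝓡 (n + 1)) α j (transition i j u) = β
  rw [ContinuousAlternatingMap.compContinuousLinearMap_apply]
  refine (topForm_apply β fun μ => fderiv ℝ (transition i j) u (coordVec μ)).trans ?_
  rw [volumeForm_map, coordDensity, hβ]

variable [T2Space X] [SigmaCompactSpace X]

theorem chartPartition_eq_zero {j x : X} (hx : x ∉ (extChartAt (𝓡 (n + 1)) j).source) :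
    chartPartition n X j x = 0 := by
  rw [extChartAt_source] at hx
  have h := Classical.choose_spec
    (SmoothPartitionOfUnity.exists_isSubordinate_chartAt_source (𝓡 (n + 1)) X)
  by_contra hne
  exact hx (h j (subset_tsupport _ hne))

theorem finite_chartPartition {K : Set X} (hK : IsCompact K) :
    {j : X | (support (chartPartition n X j) ∩ K).Nonempty}.Finite :=
  (chartPartition n X).locallyFinite.finite_nonempty_inter_compact hK

/-- The integral over the chart at `j` in the definition of the integral of `α` over `K`. -/
def chartIntegral (K : Set X) (α : ∀ x : X, TangentSpace (𝓡 (n + 1)) x [⋀^Fin (n + 1)]→L[ℝ] ℝ)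
    (j : X) : ℝ :=
  ∫ u in (extChartAt (𝓡 (n + 1)) j).target ∩ (extChartAt (𝓡 (n + 1)) j).symm ⁻¹' K,
    chartPartition n X j ((extChartAt (𝓡 (n + 1)) j).symm u) * coordDensity α j u

theorem formIntegral_eq_finsum (K : Set X)
    (α : ∀ x : X, TangentSpace (𝓡 (n + 1)) x [⋀^Fin (n + 1)]→L[ℝ] ℝ) :
    formIntegral K α = ∑ᶠ j, chartIntegral K α j := rfl

theorem support_chartIntegral_subset (K : Set X)
    (α : ∀ x : X, TangentSpace (𝓡 (n + 1)) x [⋀^Fin (n + 1)]→L[ℝ] ℝ) :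
    support (chartIntegral K α) ⊆ {j : X | (support (chartPartition n X j) ∩ K).Nonempty} := by
  intro j hj
  by_contra hne
  refine hj (setIntegral_eq_zero_of_forall_eq_zero fun u hu => ?_)
  have : chartPartition n X j ((extChartAt (𝓡 (n + 1)) j).symm u) = 0 := by
    by_contra h
    exact hne ⟨_, h, hu.2⟩
  rw [this, zero_mul]

/-- The domain of integration need not be compact, but the integrand lives on the image of `tsupport
ρ_j ∩ K`, which is a compact subset of the chart. -/
theorem integrableOn_chartIntegral {K : Set X} (hK : IsCompact K)
    {α : ∀ x : X, TangentSpace (𝓡 (n + 1)) x [⋀^Fin (n + 1)]→L[ℝ] ℝ} {j : X}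
    (hα : ContinuousOn (coordDensity α j) (extChartAt (𝓡 (n + 1)) j).target) :
    IntegrableOn (fun u => chartPartition n X j ((extChartAt (𝓡 (n + 1)) j).symm u) *
      coordDensity α j u)
      ((extChartAt (𝓡 (n + 1)) j).target ∩ (extChartAt (𝓡 (n + 1)) j).symm ⁻¹' K) := by
  have hsub : tsupport (chartPartition n X j) ⊆ (extChartAt (𝓡 (n + 1)) j).source := by
    rw [extChartAt_source]
    exact Classical.choose_spec
      (SmoothPartitionOfUnity.exists_isSubordinate_chartAt_source (𝓡 (n + 1)) X) j
  set T : Set X := tsupport (chartPartition n X j) ∩ K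
  have hT : IsCompact T := hK.inter_left (isClosed_tsupport _)
  have hTs : T ⊆ (extChartAt (𝓡 (n + 1)) j).source := fun x hx => hsub hx.1
  have hT' : IsCompact (extChartAt (𝓡 (n + 1)) j '' T) :=
    hT.image_of_continuousOn ((continuousOn_extChartAt j).mono hTs)
  have hT't : extChartAt (𝓡 (n + 1)) j '' T ⊆ (extChartAt (𝓡 (n + 1)) j).target := by
    rintro _ ⟨x, hx, rfl⟩
    exact (extChartAt (𝓡 (n + 1)) j).map_source (hTs hx)
  have hi : IntegrableOn (fun u => chartPartition n X j ((extChartAt (𝓡 (n + 1)) j).symm u) *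
      coordDensity α j u) (extChartAt (𝓡 (n + 1)) j '' T) := by
    refine ContinuousOn.integrableOn_compact hT' ?_
    refine ContinuousOn.mono ?_ hT't
    exact ((chartPartition n X j).contMDiff.continuous.comp_continuousOn
      (continuousOn_extChartAt_symm j)).mul hα
  refine hi.of_forall_sdiff_eq_zero (measurableSet_chart_preimage hK.isClosed j) fun u hu => ?_
  have : chartPartition n X j ((extChartAt (𝓡 (n + 1)) j).symm u) = 0 := by
    by_contra h
    exact hu.2 ⟨_, ⟨subset_tsupport _ h, hu.1.2⟩, (extChartAt (𝓡 (n + 1)) j).right_inv hu.1.1⟩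
  rw [this, zero_mul]

theorem formIntegral_sub {K : Set X} (hK : IsCompact K)
    {α β : ∀ x : X, TangentSpace (𝓡 (n + 1)) x [⋀^Fin (n + 1)]→L[ℝ] ℝ}
    (hα : ∀ j : X, ContinuousOn (coordDensity α j) (extChartAt (𝓡 (n + 1)) j).target)
    (hβ : ∀ j : X, ContinuousOn (coordDensity β j) (extChartAt (𝓡 (n + 1)) j).target) :
    formIntegral K (fun x => α x - β x) = formIntegral K α - formIntegral K β := by
  rw [formIntegral_eq_finsum, formIntegral_eq_finsum, formIntegral_eq_finsum,
    ← finsum_sub_distrib]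
  · refine finsum_congr fun j => ?_
    rw [chartIntegral, chartIntegral, chartIntegral,
      ← integral_sub (integrableOn_chartIntegral hK (hα j)) (integrableOn_chartIntegral hK (hβ j))]
    simp only [coordDensity_sub, mul_sub]
  · exact (finite_chartPartition hK).subset (support_chartIntegral_subset K α)
  · exact (finite_chartPartition hK).subset (support_chartIntegral_subset K β)

/-- A form supported in the domain of one chart may be integrated in this chart. -/
theorem formIntegral_eq_of_support (hX : IsOrientedAtlas n X)
    {α : ∀ x : X, TangentSpace (𝓡 (n + 1)) x [⋀^Fin (n + 1)]→L[ℝ] ℝ} {i : X}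
    (hα : ContinuousOn (coordDensity α i) (extChartAt (𝓡 (n + 1)) i).target)
    {K C : Set X} (hK : IsCompact K) (hC : IsCompact C) (hCK : C ⊆ K)
    (hCi : C ⊆ (extChartAt (𝓡 (n + 1)) i).source) (h0 : ∀ x ∉ C, α x = 0) :
    formIntegral K α = ∫ u in extChartAt (𝓡 (n + 1)) i '' C, coordDensity α i u := by
  set ei := extChartAt (𝓡 (n + 1)) i
  have hC' : IsCompact (ei '' C) := hC.image_of_continuousOn ((continuousOn_extChartAt i).mono hCi)
  have hCt : ei '' C ⊆ ei.target := by
    rintro _ ⟨x, hx, rfl⟩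
    exact ei.map_source (hCi hx)
  -- Every summand is moved to the chart at `i`: on the part `T` of the image of `C` that also lies
  -- in the chart at `j`, the transition map is injective and the change of variables formula
  -- applies.
  have hterm : ∀ j, chartIntegral K α j =
      ∫ u in ei '' C, chartPartition n X j (ei.symm u) * coordDensity α i u := by
    intro j
    set ej := extChartAt (𝓡 (n + 1)) j
    set T : Set (BaseSpace n) := ei '' C ∩ (ei.target ∩ ei.symm ⁻¹' ej.source) with hTdef
    have hTm : MeasurableSet T := hC'.isClosed.measurableSet.inter
      ((continuousOn_extChartAt_symm i).isOpen_inter_preimage (isOpen_extChartAt_target i)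
        (isOpen_extChartAt_source j)).measurableSet
    have hTj : ∀ u ∈ T, ei.symm u ∈ C := by
      rintro u ⟨⟨x, hx, rfl⟩, -⟩
      rw [ei.left_inv (hCi hx)]; exact hx
    have hinj : InjOn (transition i j) T := by
      intro u hu v hv huv
      have h1 : ei.symm u = ei.symm v := ej.injOn hu.2.2 hv.2.2 huv
      rw [← ei.right_inv hu.2.1, ← ei.right_inv hv.2.1, h1]
    have himage : transition i j '' T ⊆ ej.target ∩ ej.symm ⁻¹' K := by
      rintro _ ⟨u, hu, rfl⟩
      refine ⟨ej.map_source hu.2.2, ?_⟩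
      rw [mem_preimage, transition, ej.left_inv hu.2.2]
      exact hCK (hTj u hu)
    have e1 : chartIntegral K α j = ∫ u in transition i j '' T,
        chartPartition n X j (ej.symm u) * coordDensity α j u := by
      refine setIntegral_eq_of_subset_of_forall_sdiff_eq_zero
        (measurableSet_chart_preimage hK.isClosed j) himage fun u hu => ?_
      have : α (ej.symm u) = 0 := by
        refine h0 _ fun hmem => hu.2 ⟨ei (ej.symm u), ⟨⟨_, hmem, rfl⟩, ?_, ?_⟩, ?_⟩
        · exact ei.map_source (hCi hmem)
        · rw [mem_preimage, ei.left_inv (hCi hmem)]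
          exact ej.map_target hu.1.1
        · change ej (ei.symm (ei _)) = u
          rw [ei.left_inv (hCi hmem), ej.right_inv hu.1.1]
      rw [coordDensity_eq_zero this, mul_zero]
    rw [e1, integral_image_eq_integral_abs_det_fderiv_smul volume hTm
      (f' := fun u => fderiv ℝ (transition i j) u)
      (fun u hu => (differentiableAt_transition hu.2.1 hu.2.2).hasFDerivAt.hasFDerivWithinAt) hinj]
    have e2 : ∫ u in ei '' C, chartPartition n X j (ei.symm u) * coordDensity α i u =
        ∫ u in T, chartPartition n X j (ei.symm u) * coordDensity α i u := by
      refine setIntegral_eq_of_subset_of_forall_sdiff_eq_zero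
        hC'.isClosed.measurableSet inter_subset_left fun u hu => ?_
      have : ei.symm u ∉ ej.source := fun h => hu.2 ⟨hu.1, hCt hu.1, h⟩
      rw [chartPartition_eq_zero this, zero_mul]
    rw [e2]
    refine setIntegral_congr_fun hTm fun u hu => ?_
    simp only [smul_eq_mul]
    -- Orientation makes the Jacobian positive, so the absolute value in the change of variables
    -- agrees with the determinant by which the density transforms.
    rw [coordDensity_transition α hu.2.1 hu.2.2, abs_of_pos (det_transition_pos hX hu.2.1 hu.2.2),
      show ej.symm (transition i j u) = ei.symm u from ej.left_inv hu.2.2]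
    ring
  set J := (finite_chartPartition (n := n) hC).toFinset with hJ
  have hJmem : ∀ j, ∀ x ∈ C, chartPartition n X j x ≠ 0 → j ∈ J := fun j x hx h =>
    (Set.Finite.mem_toFinset _).2 ⟨x, h, hx⟩
  have hsupp : support (chartIntegral K α) ⊆ J := by
    intro j hj
    by_contra hne
    refine hj ?_
    rw [hterm]
    refine setIntegral_eq_zero_of_forall_eq_zero fun u hu => ?_
    have : chartPartition n X j (ei.symm u) = 0 := by
      by_contra h
      obtain ⟨x, hx, rfl⟩ := hu
      rw [ei.left_inv (hCi hx)] at h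
      exact hne (hJmem j x hx h)
    rw [this, zero_mul]
  rw [formIntegral_eq_finsum, finsum_eq_sum_of_support_subset _ hsupp]
  simp only [hterm]
  rw [← integral_finsetSum]
  · refine setIntegral_congr_fun hC'.isClosed.measurableSet ?_
    rintro _ ⟨x, hx, rfl⟩
    simp only
    rw [← Finset.sum_mul, ei.left_inv (hCi hx)]
    -- The finite set `J` contains every index whose function is nonzero somewhere on `C`, so the
    -- partition sums to one there.
    have h1 : ∑ j ∈ J, chartPartition n X j x = 1 := by
      rw [← finsum_eq_sum_of_support_subset _ (fun j hj => hJmem j x hx hj)]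
      exact (chartPartition n X).sum_eq_one (mem_univ x)
    rw [h1, one_mul]
  · intro j _
    refine ContinuousOn.integrableOn_compact hC' (ContinuousOn.mono ?_ hCt)
    exact ((chartPartition n X j).contMDiff.continuous.comp_continuousOn
      (continuousOn_extChartAt_symm i)).mul hα

end ManifoldIntegral

/-! ### Derivatives of charts -/

section ChartDerivatives

variable {E : Type*} [NormedAddCommGroup E] [NormedSpace ℝ E]
  {M : Type*} [TopologicalSpace M] [ChartedSpace E M]
  {E' : Type*} [NormedAddCommGroup E'] [NormedSpace ℝ E']
  {M' : Type*} [TopologicalSpace M'] [ChartedSpace E' M']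

/-- The derivative at `x` of the preferred chart at `x₀`. -/
def chartDeriv (x₀ x : M) : E →L[ℝ] E := mfderiv 𝓘(ℝ, E) 𝓘(ℝ, E) (extChartAt 𝓘(ℝ, E) x₀) x

/-- The derivative at `u` of the inverse of the preferred chart at `x₀`. -/
def chartSymmDeriv (x₀ : M) (u : E) : E →L[ℝ] E :=
  mfderiv 𝓘(ℝ, E) 𝓘(ℝ, E) (extChartAt 𝓘(ℝ, E) x₀).symm u

theorem chartDeriv_self (x₀ x : E) : chartDeriv x₀ x = ContinuousLinearMap.id ℝ E := by
  have : ⇑(extChartAt 𝓘(ℝ, E) x₀) = id := rfl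
  rw [chartDeriv, this]
  exact mfderiv_id

theorem chartSymmDeriv_self (x₀ u : E) : chartSymmDeriv x₀ u = ContinuousLinearMap.id ℝ E := by
  have : ⇑(extChartAt 𝓘(ℝ, E) x₀).symm = id := rfl
  rw [chartSymmDeriv, this]
  exact mfderiv_id

variable [IsManifold 𝓘(ℝ, E) ∞ M] [IsManifold 𝓘(ℝ, E') ∞ M']

theorem chartSymmDeriv_chartDeriv {x₀ x : M} (hx : x ∈ (extChartAt 𝓘(ℝ, E) x₀).source) (v : E) :
    chartSymmDeriv x₀ (extChartAt 𝓘(ℝ, E) x₀ x) (chartDeriv x₀ x v) = v := by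
  rw [extChartAt_source] at hx
  exact DFunLike.congr_fun ((mdifferentiable_chart (I := 𝓘(ℝ, E)) x₀).symm_comp_deriv hx) v

theorem chartDeriv_chartSymmDeriv {x₀ : M} {u : E} (hu : u ∈ (extChartAt 𝓘(ℝ, E) x₀).target)
    (v : E) :
    chartDeriv x₀ ((extChartAt 𝓘(ℝ, E) x₀).symm u) (chartSymmDeriv x₀ u v) = v := by
  have hu' : u ∈ (chartAt E x₀).target := by simpa [mfld_simps] using hu
  exact DFunLike.congr_fun ((mdifferentiable_chart (I := 𝓘(ℝ, E)) x₀).comp_symm_deriv hu') v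

theorem continuousLinearMapAt_eq_chartDeriv {x₀ x : M}
    (hx : x ∈ (extChartAt 𝓘(ℝ, E) x₀).source) (v : E) :
    (trivializationAt E (TangentSpace 𝓘(ℝ, E) : M → Type _) x₀).continuousLinearMapAt ℝ x v =
      chartDeriv x₀ x v := by
  rw [extChartAt_source] at hx
  exact DFunLike.congr_fun
    (TangentBundle.continuousLinearMapAt_trivializationAt (I := 𝓘(ℝ, E)) hx) v

theorem symmL_eq_chartSymmDeriv {x₀ x : M} (hx : x ∈ (extChartAt 𝓘(ℝ, E) x₀).source) (v : E) :
    (trivializationAt E (TangentSpace 𝓘(ℝ, E) : M → Type _) x₀).symmL ℝ x v =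
      chartSymmDeriv x₀ (extChartAt 𝓘(ℝ, E) x₀ x) v := by
  rw [extChartAt_source] at hx
  refine (DFunLike.congr_fun (TangentBundle.symmL_trivializationAt (I := 𝓘(ℝ, E)) hx) v).trans ?_
  rw [modelWithCornersSelf_coe, range_id, mfderivWithin_univ]
  rfl

/-- The derivative of a smooth map depends smoothly on the point, in coordinates. -/
theorem contMDiffAt_mfderiv_coord {f : M → M'} {x₀ : M}
    (hf : ContMDiffAt 𝓘(ℝ, E) 𝓘(ℝ, E') ∞ f x₀) :
    ContMDiffAt 𝓘(ℝ, E) 𝓘(ℝ, E →L[ℝ] E') ∞ (fun x => (chartDeriv (f x₀) (f x)).comp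
      ((mfderiv 𝓘(ℝ, E) 𝓘(ℝ, E') f x : E →L[ℝ] E').comp
        (chartSymmDeriv x₀ (extChartAt 𝓘(ℝ, E) x₀ x)))) x₀ := by
  refine (hf.mfderiv_const (m := ∞) (by simp)).congr_of_eventuallyEq ?_
  filter_upwards [extChartAt_source_mem_nhds (I := 𝓘(ℝ, E)) x₀,
    hf.continuousAt.preimage_mem_nhds (extChartAt_source_mem_nhds (I := 𝓘(ℝ, E')) (f x₀))]
    with x hx hfx
  ext v
  refine (continuousLinearMapAt_eq_chartDeriv hfx _).symm.trans ?_
  exact congrArg (fun a => (trivializationAt E' (TangentSpace 𝓘(ℝ, E') : M' → Type _)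
    (f x₀)).continuousLinearMapAt ℝ (f x) (mfderiv 𝓘(ℝ, E) 𝓘(ℝ, E') f x a))
    (symmL_eq_chartSymmDeriv hx v).symm

/-- A tangent space is identified with `E` through the preferred chart at its own point, which may
jump with the point. Composing with the derivative of one fixed chart removes the jumps; only then
is smoothness meaningful. -/
theorem contDiffAt_chartSymmDeriv {x₀ x₁ : M} (h : x₁ ∈ (extChartAt 𝓘(ℝ, E) x₀).source) :
    ContDiffAt ℝ ∞ (fun u => (chartDeriv x₁ ((extChartAt 𝓘(ℝ, E) x₀).symm u)).comp
      (chartSymmDeriv x₀ u)) (extChartAt 𝓘(ℝ, E) x₀ x₁) := by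
  have hf : ContMDiffAt 𝓘(ℝ, E) 𝓘(ℝ, E) ∞ (extChartAt 𝓘(ℝ, E) x₀).symm
      (extChartAt 𝓘(ℝ, E) x₀ x₁) :=
    (contMDiffOn_extChartAt_symm (n := ∞) x₀).contMDiffAt
      ((isOpen_extChartAt_target x₀).mem_nhds ((extChartAt 𝓘(ℝ, E) x₀).map_source h))
  have := contMDiffAt_mfderiv_coord hf
  rw [contMDiffAt_iff_contDiffAt] at this
  refine this.congr_of_eventuallyEq (Filter.Eventually.of_forall fun u => ?_)
  simp only [chartSymmDeriv_self, (extChartAt 𝓘(ℝ, E) x₀).left_inv h]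
  rfl

theorem contMDiffAt_chartDeriv {x₀ x₁ : M} (h : x₁ ∈ (extChartAt 𝓘(ℝ, E) x₀).source) :
    ContMDiffAt 𝓘(ℝ, E) 𝓘(ℝ, E →L[ℝ] E) ∞ (fun x => (chartDeriv x₀ x).comp
      (chartSymmDeriv x₁ (extChartAt 𝓘(ℝ, E) x₁ x))) x₁ := by
  have hf : ContMDiffAt 𝓘(ℝ, E) 𝓘(ℝ, E) ∞ (extChartAt 𝓘(ℝ, E) x₀) x₁ :=
    contMDiffAt_extChartAt' (by rwa [extChartAt_source] at h)
  have := contMDiffAt_mfderiv_coord hf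
  refine this.congr_of_eventuallyEq (Filter.Eventually.of_forall fun u => ?_)
  simp only [chartDeriv_self]
  rfl

end ChartDerivatives

/-! ### Charts adapted to a fiber bundle -/

section Adapted

variable {n : ℕ} {X : Type*} [TopologicalSpace X]
  [ChartedSpace (EuclideanSpace ℝ (Fin (n + 1))) X]
  {E : Type*} [NormedAddCommGroup E] [NormedSpace ℝ E]
  {Y : Type*} [TopologicalSpace Y] [ChartedSpace E Y]

/-- A chart of `Y` whose first component is a preferred chart of the base. -/
structure AdaptedChart (q : C^∞⟮𝓘(ℝ, E), Y; 𝓡 (n + 1), X⟯) (B : Type*)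
    [NormedAddCommGroup B] [NormedSpace ℝ B] where
  /-- The center of the chart of the base. -/
  center : X
  /-- The chart. -/
  chart : OpenPartialHomeomorph Y (BaseSpace n × B)
  base_mem : ∀ y ∈ chart.source, q y ∈ (extChartAt (𝓡 (n + 1)) center).source
  fst_eq : ∀ y ∈ chart.source, (chart y).1 = extChartAt (𝓡 (n + 1)) center (q y)
  smooth : ContMDiffOn 𝓘(ℝ, E) 𝓘(ℝ, BaseSpace n × B) ∞ chart chart.source
  smooth_symm : ContMDiffOn 𝓘(ℝ, BaseSpace n × B) 𝓘(ℝ, E) ∞ chart.symm chart.target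

/-- A local trivialization near `q y` is followed by the product of a chart of `X` and a chart of
the fiber. The base chart may be any preferred one containing `q y`, since densities are compared in
prescribed charts. -/
theorem exists_adaptedChart [IsManifold (𝓡 (n + 1)) ∞ X] {E' : Type*} [NormedAddCommGroup E']
    [NormedSpace ℝ E'] {F : Type*} [TopologicalSpace F] [ChartedSpace E' F]
    [IsManifold 𝓘(ℝ, E') ∞ F] {q : C^∞⟮𝓘(ℝ, E), Y; 𝓡 (n + 1), X⟯}
    (hq : IsSmoothFiberBundle E' F q) {i : X} {y : Y}
    (hy : q y ∈ (extChartAt (𝓡 (n + 1)) i).source) :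
    ∃ c : AdaptedChart q E', c.center = i ∧ y ∈ c.chart.source := by
  obtain ⟨e, hye, he, he'⟩ := hq (q y)
  set p := (e y).2
  have hcomp : ∀ y' ∈ (e.toOpenPartialHomeomorph.trans
      ((chartAt (BaseSpace n) i).prod (chartAt E' p))).source,
      y' ∈ e.source ∧ q y' ∈ (chartAt (BaseSpace n) i).source ∧ (e y').2 ∈ (chartAt E' p).source := by
    intro y' hy'
    rw [OpenPartialHomeomorph.trans_source] at hy'
    have h1 : y' ∈ e.source := hy'.1
    have h2 : (e y').1 ∈ (chartAt (BaseSpace n) i).source ∧ (e y').2 ∈ (chartAt E' p).source := hy'.2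
    rw [e.coe_fst h1] at h2
    exact ⟨h1, h2⟩
  refine ⟨⟨i, e.toOpenPartialHomeomorph.trans ((chartAt (BaseSpace n) i).prod (chartAt E' p)),
    ?_, ?_, ?_, ?_⟩, rfl, ?_⟩
  · intro y' hy'
    rw [extChartAt_source]
    exact (hcomp y' hy').2.1
  · intro y' hy'
    change chartAt (BaseSpace n) i (e y').1 = chartAt (BaseSpace n) i (q y')
    rw [e.coe_fst (hcomp y' hy').1]
  · have h1 : ContMDiffOn 𝓘(ℝ, E) ((𝓡 (n + 1)).prod 𝓘(ℝ, E')) ∞ e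
        (e.toOpenPartialHomeomorph.trans
          ((chartAt (BaseSpace n) i).prod (chartAt E' p))).source :=
      he.mono fun y' hy' => (hcomp y' hy').1
    refine ContMDiffOn.prodMk_space ?_ ?_
    · refine (contMDiffOn_chart (I := 𝓡 (n + 1)) (n := ∞) (x := i)).comp
        (contMDiff_fst.comp_contMDiffOn h1) fun y' hy' => ?_
      have := hcomp y' hy'
      change (e y').1 ∈ (chartAt (BaseSpace n) i).source
      rw [e.coe_fst this.1]; exact this.2.1
    · exact (contMDiffOn_chart (I := 𝓘(ℝ, E')) (n := ∞) (x := p)).comp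
        (contMDiff_snd.comp_contMDiffOn h1) fun y' hy' => (hcomp y' hy').2.2
  · have ht : ∀ w ∈ (e.toOpenPartialHomeomorph.trans
        ((chartAt (BaseSpace n) i).prod (chartAt E' p))).target,
        w.1 ∈ (chartAt (BaseSpace n) i).target ∧ w.2 ∈ (chartAt E' p).target ∧
        ((chartAt (BaseSpace n) i).symm w.1, (chartAt E' p).symm w.2) ∈ e.target := by
      intro w hw
      rw [OpenPartialHomeomorph.trans_target] at hw
      exact ⟨hw.1.1, hw.1.2, hw.2⟩
    refine he'.comp (ContMDiffOn.prodMk ?_ ?_) fun w hw => (ht w hw).2.2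
    · exact (contMDiffOn_chart_symm (I := 𝓡 (n + 1)) (n := ∞) (x := i)).comp
        (contDiff_fst.contMDiff.contMDiffOn) fun w hw => (ht w hw).1
    · exact (contMDiffOn_chart_symm (I := 𝓘(ℝ, E')) (n := ∞) (x := p)).comp
        (contDiff_snd.contMDiff.contMDiffOn) fun w hw => (ht w hw).2.1
  · rw [OpenPartialHomeomorph.trans_source]
    rw [extChartAt_source] at hy
    have h1 : y ∈ e.source := e.mem_source.2 hye
    refine ⟨h1, ?_⟩
    change (e y).1 ∈ (chartAt (BaseSpace n) i).source ∧ (e y).2 ∈ (chartAt E' p).source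
    rw [e.coe_fst h1]
    exact ⟨hy, mem_chart_source E' p⟩

end Adapted

/-! ### Smooth maps to the bundles of homomorphisms and of forms -/

section TotalSpaces

variable {n : ℕ} {X : Type*} [TopologicalSpace X]
  [ChartedSpace (EuclideanSpace ℝ (Fin (n + 1))) X]
  {E : Type*} [NormedAddCommGroup E] [NormedSpace ℝ E]
  {Y : Type*} [TopologicalSpace Y] [ChartedSpace E Y]
  [IsManifold (𝓡 (n + 1)) ∞ X] [IsManifold 𝓘(ℝ, E) ∞ Y]
  {q : C^∞⟮𝓘(ℝ, E), Y; 𝓡 (n + 1), X⟯}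
  {E₁ : Type*} [NormedAddCommGroup E₁] [NormedSpace ℝ E₁]
  {H₁ : Type*} [TopologicalSpace H₁] {I₁ : ModelWithCorners ℝ E₁ H₁}
  {M : Type*} [TopologicalSpace M] [ChartedSpace H₁ M]

/-- The trivialization of the pull-back bundle is that of `TX` at the image point; hence so is its
inverse on fibers. -/
theorem pullback_symmL_apply {y₀ y : Y} (h : q y ∈ (chartAt (BaseSpace n) (q y₀)).source)
    (v : BaseSpace n) :
    (trivializationAt (BaseSpace n) (q *ᵖ (TangentSpace (𝓡 (n + 1)) : X → Type _)) y₀).symmL ℝ y v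
      = (trivializationAt (BaseSpace n) (TangentSpace (𝓡 (n + 1))) (q y₀)).symmL ℝ (q y) v := by
  set e := trivializationAt (BaseSpace n) (TangentSpace (𝓡 (n + 1))) (q y₀)
  set e' := trivializationAt (BaseSpace n) (q *ᵖ (TangentSpace (𝓡 (n + 1)) : X → Type _)) y₀
  have h1 : q y ∈ e.baseSet := h
  have h2 : y ∈ e'.baseSet := h
  have h3 : e'.continuousLinearMapAt ℝ y (e.symmL ℝ (q y) v) = v := by
    rw [Trivialization.continuousLinearMapAt_apply, Trivialization.coe_linearMapAt_of_mem _ h2]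
    have := e.continuousLinearMapAt_symmL (R := ℝ) h1 v
    rw [Trivialization.continuousLinearMapAt_apply,
      Trivialization.coe_linearMapAt_of_mem _ h1] at this
    exact this
  conv_lhs => rw [← h3]
  exact e'.symmL_continuousLinearMapAt h2 _

/-- The linear map underlying a point of `Hom(q^*TX, TY)`. -/
def HomBundle.hom (w : HomBundle q) : BaseSpace n →L[ℝ] E := w.2

variable (q) in
/-- The point of `Hom(q^*TX, TY)` over `y` with a given underlying linear map. -/
def HomBundle.mk (y : Y) (γ : BaseSpace n →L[ℝ] E) : HomBundle q := ⟨y, γ⟩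

theorem HomBundle.mk_hom (w : HomBundle q) : HomBundle.mk q w.1 (HomBundle.hom w) = w := rfl

theorem homBundle_trivializationAt_apply {y₀ : Y} {w : HomBundle q}
    (hw : w.1 ∈ (extChartAt 𝓘(ℝ, E) y₀).source)
    (hqw : q w.1 ∈ (extChartAt (𝓡 (n + 1)) (q y₀)).source) :
    (trivializationAt (BaseSpace n →L[ℝ] E) (fun y : Y => HomAt q y) y₀ w).2 =
      (chartDeriv y₀ w.1).comp ((HomBundle.hom w).comp
        (chartSymmDeriv (q y₀) (extChartAt (𝓡 (n + 1)) (q y₀) (q w.1)))) := by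
  ext v
  have h : q w.1 ∈ (chartAt (BaseSpace n) (q y₀)).source := by rwa [extChartAt_source] at hqw
  have key : (trivializationAt (BaseSpace n →L[ℝ] E) (fun y : Y => HomAt q y) y₀ w).2 v =
      ((trivializationAt E (TangentSpace 𝓘(ℝ, E)) y₀).continuousLinearMapAt ℝ w.1)
        (w.2 ((trivializationAt (BaseSpace n) (TangentSpace (𝓡 (n + 1))) (q y₀)).symmL ℝ
          (q w.1) v)) := by
    rw [← pullback_symmL_apply h v, hom_trivializationAt_apply]
    rfl
  refine key.trans ((continuousLinearMapAt_eq_chartDeriv hw _).trans ?_)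
  exact congrArg (fun a : BaseSpace n => chartDeriv y₀ w.1 (HomBundle.hom w a)) (symmL_eq_chartSymmDeriv hqw v)

/-- This turns smoothness into the bundle of homomorphisms into smoothness of two vector-space or
manifold valued maps: the base point, and the linear map conjugated by the derivatives of charts
fixed at `x₀`. -/
theorem contMDiffWithinAt_homBundle_iff {f : M → HomBundle q} {s : Set M} {x₀ : M} :
    ContMDiffWithinAt I₁ (homModel n E) ∞ f s x₀ ↔
      ContMDiffWithinAt I₁ 𝓘(ℝ, E) ∞ (fun x => (f x).1) s x₀ ∧
      ContMDiffWithinAt I₁ 𝓘(ℝ, BaseSpace n →L[ℝ] E) ∞ (fun x => (chartDeriv (f x₀).1 (f x).1).comp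
        ((HomBundle.hom (f x)).comp (chartSymmDeriv (q (f x₀).1)
          (extChartAt (𝓡 (n + 1)) (q (f x₀).1) (q (f x).1))))) s x₀ := by
  rw [contMDiffWithinAt_totalSpace]
  refine and_congr_right fun hb => ?_
  have h1 := hb.continuousWithinAt.preimage_mem_nhdsWithin
    (extChartAt_source_mem_nhds (I := 𝓘(ℝ, E)) (f x₀).1)
  have h2 := ((q.contMDiff.continuous.continuousAt).comp_continuousWithinAt
    hb.continuousWithinAt).preimage_mem_nhdsWithin
    (extChartAt_source_mem_nhds (I := 𝓡 (n + 1)) (q (f x₀).1))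
  refine Filter.EventuallyEq.contMDiffWithinAt_iff ?_ ?_
  · filter_upwards [h1, h2] with x hx hx'
    exact homBundle_trivializationAt_apply hx hx'
  · exact homBundle_trivializationAt_apply (mem_extChartAt_source _) (mem_extChartAt_source _)

theorem contMDiffAt_homBundle_iff {f : M → HomBundle q} {x₀ : M} :
    ContMDiffAt I₁ (homModel n E) ∞ f x₀ ↔
      ContMDiffAt I₁ 𝓘(ℝ, E) ∞ (fun x => (f x).1) x₀ ∧
      ContMDiffAt I₁ 𝓘(ℝ, BaseSpace n →L[ℝ] E) ∞ (fun x => (chartDeriv (f x₀).1 (f x).1).comp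
        ((HomBundle.hom (f x)).comp (chartSymmDeriv (q (f x₀).1)
          (extChartAt (𝓡 (n + 1)) (q (f x₀).1) (q (f x).1))))) x₀ := by
  simp only [← contMDiffWithinAt_univ]
  exact contMDiffWithinAt_homBundle_iff

/-- The alternating map underlying a point of the bundle of forms. -/
def FormBundle.form {k : ℕ} (z : FormBundle 𝓘(ℝ, E) Y k) : E [⋀^Fin k]→L[ℝ] ℝ := z.2

theorem formBundle_trivializationAt_apply {k : ℕ} {y₀ : Y} {z : FormBundle 𝓘(ℝ, E) Y k}
    (hz : z.1 ∈ (extChartAt 𝓘(ℝ, E) y₀).source) :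
    (trivializationAt (E [⋀^Fin k]→L[ℝ] ℝ) (fun y : Y => FormAt 𝓘(ℝ, E) k y) y₀ z).2 =
      (FormBundle.form z).compContinuousLinearMap
        (chartSymmDeriv y₀ (extChartAt 𝓘(ℝ, E) y₀ z.1)) := by
  ext v
  have key : (trivializationAt (E [⋀^Fin k]→L[ℝ] ℝ)
      (fun y : Y => FormAt 𝓘(ℝ, E) k y) y₀ z).2 v =
      z.2 fun i => (trivializationAt E (TangentSpace 𝓘(ℝ, E)) y₀).symmL ℝ z.1 (v i) := by
    rw [FiberBundle.trivializationAt_continuousAlternatingMap_apply]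
    simp [ContinuousAlternatingMap.inCoordinates]
    rfl
  refine key.trans ?_
  exact congrArg z.2 (funext fun i => symmL_eq_chartSymmDeriv hz (v i))

/-- The analogue for forms: base point, and the form pulled back by the inverse of a fixed chart. -/
theorem contMDiffWithinAt_formBundle_iff {k : ℕ} {f : M → FormBundle 𝓘(ℝ, E) Y k} {s : Set M}
    {x₀ : M} :
    ContMDiffWithinAt I₁ (formModel 𝓘(ℝ, E) k) ∞ f s x₀ ↔
      ContMDiffWithinAt I₁ 𝓘(ℝ, E) ∞ (fun x => (f x).1) s x₀ ∧
      ContMDiffWithinAt I₁ 𝓘(ℝ, E [⋀^Fin k]→L[ℝ] ℝ) ∞ (fun x =>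
        (FormBundle.form (f x)).compContinuousLinearMap
          (chartSymmDeriv (f x₀).1 (extChartAt 𝓘(ℝ, E) (f x₀).1 (f x).1))) s x₀ := by
  rw [contMDiffWithinAt_totalSpace]
  refine and_congr_right fun hb => ?_
  have h1 := hb.continuousWithinAt.preimage_mem_nhdsWithin
    (extChartAt_source_mem_nhds (I := 𝓘(ℝ, E)) (f x₀).1)
  refine Filter.EventuallyEq.contMDiffWithinAt_iff ?_ ?_
  · filter_upwards [h1] with x hx
    exact formBundle_trivializationAt_apply hx
  · exact formBundle_trivializationAt_apply (mem_extChartAt_source _)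

theorem contMDiffAt_formBundle_iff {k : ℕ} {f : M → FormBundle 𝓘(ℝ, E) Y k} {x₀ : M} :
    ContMDiffAt I₁ (formModel 𝓘(ℝ, E) k) ∞ f x₀ ↔
      ContMDiffAt I₁ 𝓘(ℝ, E) ∞ (fun x => (f x).1) x₀ ∧
      ContMDiffAt I₁ 𝓘(ℝ, E [⋀^Fin k]→L[ℝ] ℝ) ∞ (fun x =>
        (FormBundle.form (f x)).compContinuousLinearMap
          (chartSymmDeriv (f x₀).1 (extChartAt 𝓘(ℝ, E) (f x₀).1 (f x).1))) x₀ := by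
  simp only [← contMDiffWithinAt_univ]
  exact contMDiffWithinAt_formBundle_iff

end TotalSpaces

/-! ### Jet coordinates -/

section JetCoordinates

variable {n : ℕ} {X : Type*} [TopologicalSpace X]
  [ChartedSpace (EuclideanSpace ℝ (Fin (n + 1))) X]
  {E : Type*} [NormedAddCommGroup E] [NormedSpace ℝ E]
  {Y : Type*} [TopologicalSpace Y] [ChartedSpace E Y]
  [IsManifold (𝓡 (n + 1)) ∞ X] [IsManifold 𝓘(ℝ, E) ∞ Y]
  {q : C^∞⟮𝓘(ℝ, E), Y; 𝓡 (n + 1), X⟯}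
  {B : Type*} [NormedAddCommGroup B] [NormedSpace ℝ B]
  {E₁ : Type*} [NormedAddCommGroup E₁] [NormedSpace ℝ E₁]
  {H₁ : Type*} [TopologicalSpace H₁] {I₁ : ModelWithCorners ℝ E₁ H₁}
  {M : Type*} [TopologicalSpace M] [ChartedSpace H₁ M]

variable (q) in
/-- The tangent map of `q`, as a map between the model spaces. -/
def projDeriv (y : Y) : E →L[ℝ] BaseSpace n := mfderiv 𝓘(ℝ, E) (𝓡 (n + 1)) q y

theorem mem_jetBundle_iff {w : HomBundle q} :
    w ∈ jetBundle q ↔ ∀ v : BaseSpace n, projDeriv q w.1 (HomBundle.hom w v) = v := Iff.rfl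

namespace AdaptedChart

variable (c : AdaptedChart q B)

/-- The derivative of an adapted chart. -/
def deriv (y : Y) : E →L[ℝ] BaseSpace n × B :=
  mfderiv 𝓘(ℝ, E) 𝓘(ℝ, BaseSpace n × B) c.chart y

/-- The derivative of the inverse of an adapted chart. -/
def symmDeriv (p : BaseSpace n × B) : BaseSpace n × B →L[ℝ] E :=
  mfderiv 𝓘(ℝ, BaseSpace n × B) 𝓘(ℝ, E) c.chart.symm p

theorem contMDiffAt {y : Y} (hy : y ∈ c.chart.source) :
    ContMDiffAt 𝓘(ℝ, E) 𝓘(ℝ, BaseSpace n × B) ∞ c.chart y :=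
  c.smooth.contMDiffAt (c.chart.open_source.mem_nhds hy)

theorem contMDiffAt_symm {p : BaseSpace n × B} (hp : p ∈ c.chart.target) :
    ContMDiffAt 𝓘(ℝ, BaseSpace n × B) 𝓘(ℝ, E) ∞ c.chart.symm p :=
  c.smooth_symm.contMDiffAt (c.chart.open_target.mem_nhds hp)

theorem deriv_symmDeriv {p : BaseSpace n × B} (hp : p ∈ c.chart.target) (v : BaseSpace n × B) :
    c.deriv (c.chart.symm p) (c.symmDeriv p v) = v := by
  have h1 := (c.contMDiffAt (c.chart.map_target hp)).mdifferentiableAt (by simp)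
  have h2 := (c.contMDiffAt_symm hp).mdifferentiableAt (by simp)
  have h : c.chart ∘ c.chart.symm =ᶠ[𝓝 p] id := by
    filter_upwards [c.chart.open_target.mem_nhds hp] with p' hp'
    exact c.chart.right_inv hp'
  have := (mfderiv_comp p h1 h2).symm.trans (h.mfderiv_eq.trans mfderiv_id)
  exact DFunLike.congr_fun this v

theorem symmDeriv_deriv {y : Y} (hy : y ∈ c.chart.source) (v : E) :
    c.symmDeriv (c.chart y) (c.deriv y v) = v := by
  have h1 := (c.contMDiffAt hy).mdifferentiableAt (by simp)
  have h2 := (c.contMDiffAt_symm (c.chart.map_source hy)).mdifferentiableAt (by simp)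
  have h : c.chart.symm ∘ c.chart =ᶠ[𝓝 y] id := by
    filter_upwards [c.chart.open_source.mem_nhds hy] with y' hy'
    exact c.chart.left_inv hy'
  have := (mfderiv_comp y h2 h1).symm.trans (h.mfderiv_eq.trans mfderiv_id)
  exact DFunLike.congr_fun this v

theorem fst_mem_target {p : BaseSpace n × B} (hp : p ∈ c.chart.target) :
    p.1 ∈ (extChartAt (𝓡 (n + 1)) c.center).target := by
  have h := c.fst_eq _ (c.chart.map_target hp)
  rw [c.chart.right_inv hp] at h
  rw [h]
  exact (extChartAt (𝓡 (n + 1)) c.center).map_source (c.base_mem _ (c.chart.map_target hp))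

theorem proj_symm {p : BaseSpace n × B} (hp : p ∈ c.chart.target) :
    q (c.chart.symm p) = (extChartAt (𝓡 (n + 1)) c.center).symm p.1 := by
  have h := c.fst_eq _ (c.chart.map_target hp)
  rw [c.chart.right_inv hp] at h
  rw [h, (extChartAt (𝓡 (n + 1)) c.center).left_inv (c.base_mem _ (c.chart.map_target hp))]

theorem extChartAt_proj_symm {p : BaseSpace n × B} (hp : p ∈ c.chart.target) :
    extChartAt (𝓡 (n + 1)) c.center (q (c.chart.symm p)) = p.1 := by
  rw [c.proj_symm hp, (extChartAt (𝓡 (n + 1)) c.center).right_inv (c.fst_mem_target hp)]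

/-- In adapted coordinates the projection is the first projection. -/
theorem chartDeriv_projDeriv {y : Y} (hy : y ∈ c.chart.source) (v : E) :
    chartDeriv c.center (q y) (projDeriv q y v) = (c.deriv y v).1 := by
  have h1 : MDifferentiableAt 𝓘(ℝ, E) (𝓡 (n + 1)) q y := q.contMDiff.mdifferentiableAt (by simp)
  have h2 : MDifferentiableAt (𝓡 (n + 1)) 𝓘(ℝ, BaseSpace n)
      (extChartAt (𝓡 (n + 1)) c.center) (q y) :=
    mdifferentiableAt_extChartAt (by have := c.base_mem y hy; rwa [extChartAt_source] at this)
  have h3 := (c.contMDiffAt hy).mdifferentiableAt (by simp)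
  have h4 : MDifferentiableAt 𝓘(ℝ, BaseSpace n × B) 𝓘(ℝ, BaseSpace n)
      (Prod.fst : BaseSpace n × B → BaseSpace n) (c.chart y) :=
    differentiableAt_fst.mdifferentiableAt
  have h : (extChartAt (𝓡 (n + 1)) c.center) ∘ q =ᶠ[𝓝 y] Prod.fst ∘ c.chart := by
    filter_upwards [c.chart.open_source.mem_nhds hy] with y' hy'
    exact (c.fst_eq y' hy').symm
  have := (mfderiv_comp y h2 h1).symm.trans (h.mfderiv_eq.trans (mfderiv_comp y h4 h3))
  rw [mfderiv_eq_fderiv, fderiv_fst] at this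
  exact DFunLike.congr_fun this v

theorem projDeriv_symmDeriv {p : BaseSpace n × B} (hp : p ∈ c.chart.target) (v : BaseSpace n × B) :
    projDeriv q (c.chart.symm p) (c.symmDeriv p v) = chartSymmDeriv c.center p.1 v.1 := by
  have hs := c.chart.map_target hp
  have h := c.chartDeriv_projDeriv hs (c.symmDeriv p v)
  rw [c.deriv_symmDeriv hp] at h
  rw [← h, ← c.extChartAt_proj_symm hp]
  exact (chartSymmDeriv_chartDeriv (c.base_mem _ hs) _).symm

theorem contMDiffAt_deriv {y₀ : Y} (hy : y₀ ∈ c.chart.source) :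
    ContMDiffAt 𝓘(ℝ, E) 𝓘(ℝ, E →L[ℝ] BaseSpace n × B) ∞
      (fun y => (c.deriv y).comp (chartSymmDeriv y₀ (extChartAt 𝓘(ℝ, E) y₀ y))) y₀ := by
  refine (contMDiffAt_mfderiv_coord (c.contMDiffAt hy)).congr_of_eventuallyEq
    (Filter.Eventually.of_forall fun y => ?_)
  simp only [chartDeriv_self]
  rfl

theorem contMDiffAt_symmDeriv {p₀ : BaseSpace n × B} (hp : p₀ ∈ c.chart.target) :
    ContMDiffAt 𝓘(ℝ, BaseSpace n × B) 𝓘(ℝ, BaseSpace n × B →L[ℝ] E) ∞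
      (fun p => (chartDeriv (c.chart.symm p₀) (c.chart.symm p)).comp (c.symmDeriv p)) p₀ := by
  refine (contMDiffAt_mfderiv_coord (c.contMDiffAt_symm hp)).congr_of_eventuallyEq
    (Filter.Eventually.of_forall fun y => ?_)
  simp only [chartSymmDeriv_self]
  rfl

/-- The domain of the jet coordinates. -/
def jetTarget : Set (JetSpace n B) := {w | (w.1, w.2.1) ∈ c.chart.target}

theorem isOpen_jetTarget : IsOpen c.jetTarget :=
  c.chart.open_target.preimage (by fun_prop)

/-- The inverse of the jet coordinates. -/
def jetParam (w : JetSpace n B) : HomBundle q :=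
  HomBundle.mk q (c.chart.symm (w.1, w.2.1)) ((c.symmDeriv (w.1, w.2.1)).comp
    (((ContinuousLinearMap.id ℝ (BaseSpace n)).prod w.2.2).comp
      (chartDeriv c.center (q (c.chart.symm (w.1, w.2.1))))))

/-- The jet coordinates. -/
def jetCoord (w : HomBundle q) : JetSpace n B :=
  (extChartAt (𝓡 (n + 1)) c.center (q w.1), (c.chart w.1).2,
    (ContinuousLinearMap.snd ℝ (BaseSpace n) B).comp ((c.deriv w.1).comp ((HomBundle.hom w).comp
      (chartSymmDeriv c.center (extChartAt (𝓡 (n + 1)) c.center (q w.1)))))) 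

/-- In adapted coordinates `q` is the first projection, and the first component of the linear map
used in `jetParam` is the identity. -/
theorem jetParam_mem {w : JetSpace n B} (hw : w ∈ c.jetTarget) : c.jetParam w ∈ jetBundle q := by
  rw [mem_jetBundle_iff]
  intro v
  change projDeriv q (c.chart.symm (w.1, w.2.1)) (c.symmDeriv (w.1, w.2.1) _) = v
  rw [c.projDeriv_symmDeriv hw]
  change chartSymmDeriv c.center w.1 (chartDeriv c.center _ v) = v
  have h : w.1 = extChartAt (𝓡 (n + 1)) c.center (q (c.chart.symm (w.1, w.2.1))) :=
    (c.extChartAt_proj_symm hw).symm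
  refine (congrArg (fun a => chartSymmDeriv c.center a _) h).trans ?_
  exact chartSymmDeriv_chartDeriv (c.base_mem _ (c.chart.map_target hw)) _

theorem jetCoord_fst {w : HomBundle q} (hw : w.1 ∈ c.chart.source) :
    ((c.jetCoord w).1, (c.jetCoord w).2.1) = c.chart w.1 :=
  Prod.ext (c.fst_eq _ hw).symm rfl

/-- The jet condition forces the base component of `γ` in coordinates, so its fiber component
determines `γ`. -/
theorem jetParam_jetCoord {w : HomBundle q} (hw : w.1 ∈ c.chart.source) (hj : w ∈ jetBundle q) :
    c.jetParam (c.jetCoord w) = w := by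
  have h1 : c.chart.symm ((c.jetCoord w).1, (c.jetCoord w).2.1) = w.1 := by
    rw [c.jetCoord_fst hw, c.chart.left_inv hw]
  rw [jetParam, h1, c.jetCoord_fst hw]
  refine (congrArg (HomBundle.mk q w.1) ?_).trans (HomBundle.mk_hom w)
  ext v
  rw [ContinuousLinearMap.comp_apply, ContinuousLinearMap.comp_apply,
    ← c.symmDeriv_deriv hw (HomBundle.hom w v)]
  congr 1
  refine Prod.ext ?_ ?_
  · rw [← c.chartDeriv_projDeriv hw, (mem_jetBundle_iff.1 hj) v]
    rfl
  · change (c.deriv w.1 (HomBundle.hom w (chartSymmDeriv c.center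
      (extChartAt (𝓡 (n + 1)) c.center (q w.1)) (chartDeriv c.center (q w.1) v)))).2 = _
    rw [chartSymmDeriv_chartDeriv (c.base_mem _ hw)]

theorem contMDiffAt_jetParam {w₀ : JetSpace n B} (hw : w₀ ∈ c.jetTarget) :
    ContMDiffAt 𝓘(ℝ, JetSpace n B) (homModel n E) ∞ c.jetParam w₀ := by
  have hπ : ContMDiffAt 𝓘(ℝ, JetSpace n B) 𝓘(ℝ, BaseSpace n × B) ∞
      (fun w : JetSpace n B => (w.1, w.2.1)) w₀ :=
    (ContDiff.contMDiff (by fun_prop)).contMDiffAt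
  have hb : ContMDiffAt 𝓘(ℝ, JetSpace n B) 𝓘(ℝ, E) ∞
      (fun w : JetSpace n B => c.chart.symm (w.1, w.2.1)) w₀ :=
    ContMDiffAt.comp w₀ (g := c.chart.symm) (c.contMDiffAt_symm hw) hπ
  refine contMDiffAt_homBundle_iff.2 ⟨hb, ?_⟩
  have h1 := ContMDiffAt.comp w₀ (f := fun w : JetSpace n B => (w.1, w.2.1))
    (c.contMDiffAt_symmDeriv hw) hπ
  have h2 := ContMDiffAt.comp w₀ (f := fun w : JetSpace n B => q (c.chart.symm (w.1, w.2.1)))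
    (contMDiffAt_chartDeriv (c.base_mem _ (c.chart.map_target hw)))
    (q.contMDiff.contMDiffAt.comp w₀ hb)
  have h3 : ContMDiffAt 𝓘(ℝ, JetSpace n B) 𝓘(ℝ, BaseSpace n →L[ℝ] BaseSpace n × B) ∞
      (fun w : JetSpace n B => (ContinuousLinearMap.id ℝ (BaseSpace n)).prod w.2.2) w₀ := by
    refine (ContDiff.contMDiff ?_).contMDiffAt
    exact (ContinuousLinearMap.prodₗᵢ (𝕜 := ℝ) (E := BaseSpace n) (F := BaseSpace n)
      (G := B) ℝ).contDiff.comp (f := fun w : JetSpace n B =>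
        (ContinuousLinearMap.id ℝ (BaseSpace n), w.2.2)) (by fun_prop)
  refine (h1.clm_comp (h3.clm_comp h2)).congr_of_eventuallyEq (Filter.Eventually.of_forall ?_)
  intro w
  rfl

theorem contMDiffAt_jetCoord {f : M → HomBundle q} {x₀ : M}
    (hf : ContMDiffAt I₁ (homModel n E) ∞ f x₀) (h₀ : (f x₀).1 ∈ c.chart.source) :
    ContMDiffAt I₁ 𝓘(ℝ, JetSpace n B) ∞ (fun x => c.jetCoord (f x)) x₀ := by
  obtain ⟨hb, hh⟩ := contMDiffAt_homBundle_iff.1 hf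
  have hqb : ContMDiffAt I₁ (𝓡 (n + 1)) ∞ (fun x => q (f x).1) x₀ :=
    q.contMDiff.contMDiffAt.comp x₀ hb
  have hs : (f x₀).1 ∈ c.chart.source := h₀
  have hqs := c.base_mem _ hs
  have ha : ContMDiffAt I₁ 𝓘(ℝ, BaseSpace n) ∞
      (fun x => extChartAt (𝓡 (n + 1)) c.center (q (f x).1)) x₀ :=
    ContMDiffAt.comp x₀ (g := extChartAt (𝓡 (n + 1)) c.center)
      (contMDiffAt_extChartAt' (by rwa [extChartAt_source] at hqs)) hqb
  have hc : ContMDiffAt I₁ 𝓘(ℝ, BaseSpace n × B) ∞ (fun x => c.chart (f x).1) x₀ :=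
    ContMDiffAt.comp x₀ (g := c.chart) (c.contMDiffAt hs) hb
  refine ha.prodMk_space (ContMDiffAt.prodMk_space ?_ ?_)
  · exact ContMDiffAt.comp x₀ (g := (Prod.snd : BaseSpace n × B → B))
      contDiff_snd.contMDiff.contMDiffAt hc
  · have h1 := ContMDiffAt.comp x₀ (f := fun x => (f x).1)
      (c.contMDiffAt_deriv hs) hb
    have h2 := ContMDiffAt.comp x₀ (f := fun x => extChartAt (𝓡 (n + 1)) c.center (q (f x).1))
      (contDiffAt_chartSymmDeriv hqs).contMDiffAt ha
    have h3 : ContMDiffAt I₁ 𝓘(ℝ, BaseSpace n × B →L[ℝ] B) ∞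
        (fun _ => ContinuousLinearMap.snd ℝ (BaseSpace n) B) x₀ := contMDiffAt_const
    -- Between consecutive factors the derivatives of a chart and of its inverse cancel, so the raw
    -- expression is a composition of factors that are each smooth.
    refine (h3.clm_comp (h1.clm_comp (hh.clm_comp h2))).congr_of_eventuallyEq ?_
    filter_upwards [hb.continuousAt.preimage_mem_nhds (extChartAt_source_mem_nhds (I := 𝓘(ℝ, E)) _),
      hqb.continuousAt.preimage_mem_nhds (extChartAt_source_mem_nhds (I := 𝓡 (n + 1)) _),
      hb.continuousAt.preimage_mem_nhds (c.chart.open_source.mem_nhds hs)] with x hx hx' hxs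
    ext v
    simp only [Function.comp_def, ContinuousLinearMap.comp_apply]
    rw [(extChartAt (𝓡 (n + 1)) c.center).left_inv (c.base_mem _ hxs),
      chartSymmDeriv_chartDeriv hx', chartSymmDeriv_chartDeriv hx]

end AdaptedChart
end JetCoordinates

/-! ### The Lagrangian and the Legendre transformation in jet coordinates -/

section CoordinateLagrangian

variable {n : ℕ} {X : Type*} [TopologicalSpace X]
  [ChartedSpace (EuclideanSpace ℝ (Fin (n + 1))) X]
  {E : Type*} [NormedAddCommGroup E] [NormedSpace ℝ E]
  {Y : Type*} [TopologicalSpace Y] [ChartedSpace E Y]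
  [IsManifold (𝓡 (n + 1)) ∞ X] [IsManifold 𝓘(ℝ, E) ∞ Y]
  {q : C^∞⟮𝓘(ℝ, E), Y; 𝓡 (n + 1), X⟯}
  {B : Type*} [NormedAddCommGroup B] [NormedSpace ℝ B]

theorem firstJet_mem_jetBundle {s : X → Y} {x : X}
    (hs : MDifferentiableAt (𝓡 (n + 1)) 𝓘(ℝ, E) s x) (hsec : ∀ x, q (s x) = x) :
    firstJet q s x ∈ jetBundle q := by
  rw [mem_jetBundle_iff]
  intro v
  have h1 : MDifferentiableAt 𝓘(ℝ, E) (𝓡 (n + 1)) q (s x) :=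
    q.contMDiff.mdifferentiableAt (by simp)
  have h2 : q ∘ s = id := funext hsec
  have h3 := mfderiv_comp x h1 hs
  rw [h2, mfderiv_id] at h3
  exact (DFunLike.congr_fun h3 v).symm

/-- The form `ℒ(w)` on the model space. -/
def Density.form (ℒ : Density q) (w : HomBundle q) : BaseSpace n [⋀^Fin (n + 1)]→L[ℝ] ℝ := ℒ w

namespace AdaptedChart

variable (c : AdaptedChart q B)

/-- The coordinate expression of a section. -/
def localRep (s : X → Y) (a : BaseSpace n) : B :=
  (c.chart (s ((extChartAt (𝓡 (n + 1)) c.center).symm a))).2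

theorem contDiffAt_localRep {s : X → Y} (hs : ContMDiff (𝓡 (n + 1)) 𝓘(ℝ, E) ∞ s)
    {a : BaseSpace n} (ha : a ∈ (extChartAt (𝓡 (n + 1)) c.center).target)
    (hsa : s ((extChartAt (𝓡 (n + 1)) c.center).symm a) ∈ c.chart.source) :
    ContDiffAt ℝ ∞ (c.localRep s) a := by
  rw [← contMDiffAt_iff_contDiffAt]
  have h1 : ContMDiffAt 𝓘(ℝ, BaseSpace n) (𝓡 (n + 1)) ∞
      (extChartAt (𝓡 (n + 1)) c.center).symm a :=
    (contMDiffOn_extChartAt_symm c.center).contMDiffAt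
      ((isOpen_extChartAt_target c.center).mem_nhds ha)
  have h2 := (c.contMDiffAt hsa).comp a (hs.contMDiffAt.comp a h1)
  exact ContMDiffAt.comp a (g := (Prod.snd : BaseSpace n × B → B))
    contDiff_snd.contMDiff.contMDiffAt h2

/-- Chain rule for the composite of the inverse base chart, the section, the adapted chart and the
second projection: coordinates of the jet are the jet of the coordinates. -/
theorem jetCoord_firstJet {s : X → Y} {x : X}
    (hs : ContMDiffAt (𝓡 (n + 1)) 𝓘(ℝ, E) ∞ s x) (hsec : ∀ x, q (s x) = x)
    (hx : s x ∈ c.chart.source) :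
    c.jetCoord (firstJet q s x) =
      coordJet (c.localRep s) (extChartAt (𝓡 (n + 1)) c.center x) := by
  have hxs : x ∈ (extChartAt (𝓡 (n + 1)) c.center).source := by
    have := c.base_mem _ hx; rwa [hsec] at this
  have h0 : (extChartAt (𝓡 (n + 1)) c.center).symm (extChartAt (𝓡 (n + 1)) c.center x) = x :=
    (extChartAt (𝓡 (n + 1)) c.center).left_inv hxs
  refine Prod.ext ?_ (Prod.ext ?_ ?_)
  · exact congrArg (extChartAt (𝓡 (n + 1)) c.center) (hsec x)
  · change (c.chart (s x)).2 = (c.chart (s _)).2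
    rw [h0]
  · set a := extChartAt (𝓡 (n + 1)) c.center x with ha
    have h1 : MDifferentiableAt 𝓘(ℝ, BaseSpace n) (𝓡 (n + 1))
        (extChartAt (𝓡 (n + 1)) c.center).symm a :=
      ((contMDiffOn_extChartAt_symm (n := ∞) c.center).contMDiffAt
        ((isOpen_extChartAt_target c.center).mem_nhds
          ((extChartAt (𝓡 (n + 1)) c.center).map_source hxs))).mdifferentiableAt (by simp)
    have h2 : MDifferentiableAt (𝓡 (n + 1)) 𝓘(ℝ, E) s
        ((extChartAt (𝓡 (n + 1)) c.center).symm a) := by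
      rw [h0]; exact hs.mdifferentiableAt (by simp)
    have h3 : MDifferentiableAt 𝓘(ℝ, E) 𝓘(ℝ, BaseSpace n × B) c.chart
        (s ((extChartAt (𝓡 (n + 1)) c.center).symm a)) := by
      rw [h0]; exact (c.contMDiffAt hx).mdifferentiableAt (by simp)
    have h4 : MDifferentiableAt 𝓘(ℝ, BaseSpace n × B) 𝓘(ℝ, B)
        (Prod.snd : BaseSpace n × B → B) (c.chart (s ((extChartAt (𝓡 (n + 1)) c.center).symm a))) :=
      differentiableAt_snd.mdifferentiableAt
    have e1 := mfderiv_comp a h2 h1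
    have e2 := mfderiv_comp a h3 (h2.comp a h1)
    have e3 := mfderiv_comp a h4 (h3.comp a (h2.comp a h1))
    rw [mfderiv_eq_fderiv, mfderiv_eq_fderiv, fderiv_snd] at e3
    ext v
    have e4 := DFunLike.congr_fun e3 v
    have e5 := DFunLike.congr_fun e2 v
    have e6 := DFunLike.congr_fun e1 v
    change (c.deriv (s x) (mfderiv (𝓡 (n + 1)) 𝓘(ℝ, E) s x
      (chartSymmDeriv c.center (extChartAt (𝓡 (n + 1)) c.center (q (s x))) v))).2 = _
    refine Eq.trans ?_ e4.symm
    refine congrArg Prod.snd (Eq.trans ?_ e5.symm)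
    refine Eq.trans ?_ (congrArg (mfderiv 𝓘(ℝ, E) 𝓘(ℝ, BaseSpace n × B) c.chart
        (s ((extChartAt (𝓡 (n + 1)) c.center).symm a))) e6.symm)
    rw [hsec x, ← ha]
    change _ = c.deriv (s ((extChartAt (𝓡 (n + 1)) c.center).symm a))
      (mfderiv (𝓡 (n + 1)) 𝓘(ℝ, E) s ((extChartAt (𝓡 (n + 1)) c.center).symm a)
        (chartSymmDeriv c.center a v))
    rw [h0]

theorem firstJet_eq_jetParam {s : X → Y} {x : X}
    (hs : ContMDiffAt (𝓡 (n + 1)) 𝓘(ℝ, E) ∞ s x) (hsec : ∀ x, q (s x) = x)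
    (hx : s x ∈ c.chart.source) :
    firstJet q s x =
      c.jetParam (coordJet (c.localRep s) (extChartAt (𝓡 (n + 1)) c.center x)) := by
  rw [← c.jetCoord_firstJet hs hsec hx]
  exact (c.jetParam_jetCoord hx (firstJet_mem_jetBundle (hs.mdifferentiableAt (by simp)) hsec)).symm

theorem coordJet_mem {s : X → Y} {x : X} (hsec : ∀ x, q (s x) = x) (hx : s x ∈ c.chart.source) :
    coordJet (c.localRep s) (extChartAt (𝓡 (n + 1)) c.center x) ∈ c.jetTarget := by
  have hxs : x ∈ (extChartAt (𝓡 (n + 1)) c.center).source := by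
    have := c.base_mem _ hx; rwa [hsec] at this
  have h : (extChartAt (𝓡 (n + 1)) c.center x,
      c.localRep s (extChartAt (𝓡 (n + 1)) c.center x)) = c.chart (s x) := by
    refine Prod.ext ?_ ?_
    · rw [c.fst_eq _ hx, hsec]
    · rw [localRep, (extChartAt (𝓡 (n + 1)) c.center).left_inv hxs]
  have := c.chart.map_source hx
  rw [← h] at this
  exact this

/-- The coordinate expression of a Lagrangian density. -/
def lagrangian (ℒ : Density q) (w : JetSpace n B) : ℝ :=
  ℒ.form (c.jetParam w) fun μ => chartSymmDeriv c.center w.1 (coordVec μ)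

/-- `jetParam` maps an open set into `J¹(Y)`, so smoothness of `ℒ` on that subset becomes ordinary
smoothness. It concerns the density in the preferred chart at one base point; passing to the chart
at `c.center` multiplies by a smooth Jacobian determinant (`h8`). -/
theorem contDiffOn_lagrangian {ℒ : Density q} (hℒ : IsSmoothDensity ℒ) :
    ContDiffOn ℝ ∞ (c.lagrangian ℒ) c.jetTarget := by
  intro w₀ hw₀
  refine ContDiffAt.contDiffWithinAt ?_
  have h1 : ContMDiffOn 𝓘(ℝ, JetSpace n B) (homModel n E) ∞ c.jetParam c.jetTarget :=
    fun w hw => (c.contMDiffAt_jetParam hw).contMDiffWithinAt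
  have h2 := (hℒ.comp h1 fun w hw => c.jetParam_mem hw).contMDiffAt
    (c.isOpen_jetTarget.mem_nhds hw₀)
  obtain ⟨h3, h4⟩ := contMDiffAt_formBundle_iff.1 h2
  rw [contMDiffAt_iff_contDiffAt] at h4
  have hs := c.base_mem _ (c.chart.map_target hw₀)
  have h5 := contDiffAt_chartSymmDeriv hs
  rw [c.extChartAt_proj_symm hw₀] at h5
  have h6 : ContDiffAt ℝ ∞ (fun w : JetSpace n B => w.1) w₀ := contDiffAt_fst
  have h7 := ContDiffAt.comp w₀ (f := fun w : JetSpace n B => w.1) h5 h6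
  have h8 : ContDiffAt ℝ ∞ (fun w : JetSpace n B => volumeForm n fun μ =>
      chartDeriv (q (c.chart.symm (w₀.1, w₀.2.1)))
        ((extChartAt (𝓡 (n + 1)) c.center).symm w.1)
        (chartSymmDeriv c.center w.1 (coordVec μ))) w₀ := by
    refine ContDiffAt.comp w₀ (g := fun v => (volumeForm n).toContinuousMultilinearMap v)
      ((volumeForm n).toContinuousMultilinearMap.contDiff.contDiffAt)
      (contDiffAt_pi.2 fun μ => ?_)
    exact h7.clm_apply contDiffAt_const
  have h9 := h4.continuousLinearMap_comp
    (ContinuousAlternatingMap.apply ℝ (BaseSpace n) ℝ (coordVec : Fin (n + 1) → BaseSpace n))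
  refine (h8.mul h9).congr_of_eventuallyEq ?_
  filter_upwards [c.isOpen_jetTarget.mem_nhds hw₀, h3.continuousAt.preimage_mem_nhds
    (extChartAt_source_mem_nhds (I := 𝓡 (n + 1)) _)] with w hw hqw
  refine Eq.trans ?_ (topForm_apply ((ℒ.form (c.jetParam w)).compContinuousLinearMap
    (chartSymmDeriv (q (c.chart.symm (w₀.1, w₀.2.1)))
      (extChartAt (𝓡 (n + 1)) (q (c.chart.symm (w₀.1, w₀.2.1)))
        (q (c.chart.symm (w.1, w.2.1)))))) _)
  refine congrArg (ℒ.form (c.jetParam w)) (funext fun μ => ?_)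
  have h := chartSymmDeriv_chartDeriv hqw (chartSymmDeriv c.center w.1 (coordVec μ))
  refine h.symm.trans ?_
  have h' : q (c.chart.symm (w.1, w.2.1)) = (extChartAt (𝓡 (n + 1)) c.center).symm w.1 :=
    c.proj_symm hw
  rw [← h']
  rfl

theorem coordDensity_firstJet (ℒ : Density q) {s : X → Y} {a : BaseSpace n}
    (hs : ContMDiffAt (𝓡 (n + 1)) 𝓘(ℝ, E) ∞ s ((extChartAt (𝓡 (n + 1)) c.center).symm a))
    (hsec : ∀ x, q (s x) = x)
    (ha : a ∈ (extChartAt (𝓡 (n + 1)) c.center).target)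
    (hsa : s ((extChartAt (𝓡 (n + 1)) c.center).symm a) ∈ c.chart.source) :
    coordDensity (fun x => ℒ (firstJet q s x)) c.center a =
      c.lagrangian ℒ (coordJet (c.localRep s) a) := by
  have h := c.firstJet_eq_jetParam hs hsec hsa
  rw [(extChartAt (𝓡 (n + 1)) c.center).right_inv ha] at h
  change ℒ.form (firstJet q s _) _ = ℒ.form _ _
  rw [h]
  rfl

/-- The linear map with given adapted coordinates. -/
def jetHom (p : BaseSpace n × B) (v : BaseSpace n →L[ℝ] B) : BaseSpace n →L[ℝ] E :=
  (c.symmDeriv p).comp (((ContinuousLinearMap.id ℝ (BaseSpace n)).prod v).comp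
    (chartDeriv c.center (q (c.chart.symm p))))

theorem jetHom_chartSymmDeriv {p : BaseSpace n × B} (hp : p ∈ c.chart.target)
    (v : BaseSpace n →L[ℝ] B) (e : BaseSpace n) :
    c.jetHom p v (chartSymmDeriv c.center p.1 e) = c.symmDeriv p (e, v e) := by
  have : chartDeriv c.center (q (c.chart.symm p)) (chartSymmDeriv c.center p.1 e) = e := by
    rw [c.proj_symm hp]; exact chartDeriv_chartSymmDeriv (c.fst_mem_target hp) e
  simp [jetHom, this]

/-- `jetHom` is affine, not linear, in the velocity: its base component is fixed. Thus the lines in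
the definition of `𝔽ℒ` are lines of velocities. -/
theorem jetHom_add_smul (p : BaseSpace n × B) (v v' : BaseSpace n →L[ℝ] B) (ε : ℝ) :
    c.jetHom p (v + ε • (v' - v)) = c.jetHom p v + ε • (c.jetHom p v' - c.jetHom p v) := by
  ext e
  simp only [jetHom, ContinuousLinearMap.comp_apply, ContinuousLinearMap.prod_apply,
    add_apply, smul_apply, sub_apply, ← map_sub, ← map_smul, ← map_add]
  congr 1
  ext <;> simp

theorem exists_eq_jetHom {p : BaseSpace n × B} (hp : p ∈ c.chart.target)
    {γ : BaseSpace n →L[ℝ] E} (hγ : HomBundle.mk q (c.chart.symm p) γ ∈ jetBundle q) :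
    ∃ v, γ = c.jetHom p v := by
  set w := HomBundle.mk q (c.chart.symm p) γ
  have hs : w.1 ∈ c.chart.source := c.chart.map_target hp
  have h1 := c.jetParam_jetCoord hs hγ
  have h2 : ((c.jetCoord w).1, (c.jetCoord w).2.1) = p :=
    (c.jetCoord_fst hs).trans (c.chart.right_inv hp)
  refine ⟨(c.jetCoord w).2.2, ?_⟩
  have h3 := congrArg HomBundle.hom h1
  rw [← h2]
  exact h3.symm

end AdaptedChart
end CoordinateLagrangian

/-! ### The Legendre transformation in jet coordinates -/

section LegendreCoordinates

variable {n : ℕ} {X : Type*} [TopologicalSpace X]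
  [ChartedSpace (EuclideanSpace ℝ (Fin (n + 1))) X]
  {E : Type*} [NormedAddCommGroup E] [NormedSpace ℝ E]
  {Y : Type*} [TopologicalSpace Y] [ChartedSpace E Y]
  [IsManifold (𝓡 (n + 1)) ∞ X] [IsManifold 𝓘(ℝ, E) ∞ Y]
  {q : C^∞⟮𝓘(ℝ, E), Y; 𝓡 (n + 1), X⟯}
  {B : Type*} [NormedAddCommGroup B] [NormedSpace ℝ B]

namespace AdaptedChart

variable (c : AdaptedChart q B)

theorem hasDerivAt_lagrangian_line {ℒ : Density q} (hℒ : IsSmoothDensity ℒ)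
    {p : BaseSpace n × B} (hp : p ∈ c.chart.target) (v v' : BaseSpace n →L[ℝ] B) :
    HasDerivAt (fun ε : ℝ => c.lagrangian ℒ (p.1, p.2, v + ε • (v' - v)))
      (fderiv ℝ (c.lagrangian ℒ) (p.1, p.2, v) (0, 0, v' - v)) 0 := by
  have hw : (p.1, p.2, v) ∈ c.jetTarget := hp
  have h1 : HasFDerivAt (c.lagrangian ℒ) (fderiv ℝ (c.lagrangian ℒ) (p.1, p.2, v)) (p.1, p.2, v) :=
    (((c.contDiffOn_lagrangian hℒ).contDiffAt (c.isOpen_jetTarget.mem_nhds hw)).differentiableAt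
      (by simp)).hasFDerivAt
  have h2 : HasDerivAt (fun ε : ℝ => ((p.1, p.2, v + ε • (v' - v)) : JetSpace n B))
      (0, 0, v' - v) 0 := by
    have h3 : HasDerivAt (fun ε : ℝ => v + ε • (v' - v)) (v' - v) 0 := by
      simpa using ((hasDerivAt_id (0 : ℝ)).smul_const (v' - v)).const_add v
    exact (hasDerivAt_const _ _).prodMk ((hasDerivAt_const _ _).prodMk h3)
  have h4 : HasFDerivAt (c.lagrangian ℒ) (fderiv ℝ (c.lagrangian ℒ) (p.1, p.2, v))
      ((fun ε : ℝ => ((p.1, p.2, v + ε • (v' - v)) : JetSpace n B)) 0) := by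
    simpa using h1
  exact h4.comp_hasDerivAt (0 : ℝ) h2

theorem density_form_apply (ℒ : Density q) {p : BaseSpace n × B} (hp : p ∈ c.chart.target)
    (v : BaseSpace n →L[ℝ] B) (u : Fin (n + 1) → BaseSpace n) :
    ℒ.form (HomBundle.mk q (c.chart.symm p) (c.jetHom p v)) u =
      volumeForm n (fun i => chartDeriv c.center (q (c.chart.symm p)) (u i)) *
        c.lagrangian ℒ (p.1, p.2, v) := by
  have h := topForm_apply ((ℒ.form (c.jetParam (p.1, p.2, v))).compContinuousLinearMap
    (chartSymmDeriv c.center p.1)) (fun i => chartDeriv c.center (q (c.chart.symm p)) (u i))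
  refine Eq.trans ?_ h
  refine congrArg (ℒ.form (c.jetParam (p.1, p.2, v))) (funext fun i => ?_)
  have h' : p.1 = extChartAt (𝓡 (n + 1)) c.center (q (c.chart.symm p)) :=
    (c.extChartAt_proj_symm hp).symm
  simp only
  rw [h']
  exact (chartSymmDeriv_chartDeriv (c.base_mem _ (c.chart.map_target hp)) _).symm

theorem legendreAffine_jetHom {ℒ : Density q} (hℒ : IsSmoothDensity ℒ)
    {p : BaseSpace n × B} (hp : p ∈ c.chart.target) (v v' : BaseSpace n →L[ℝ] B)
    (u : Fin (n + 1) → BaseSpace n) :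
    legendreAffine ℒ (c.chart.symm p) (c.jetHom p v) (c.jetHom p v') u =
      volumeForm n (fun i => chartDeriv c.center (q (c.chart.symm p)) (u i)) *
        (c.lagrangian ℒ (p.1, p.2, v) +
          fderiv ℝ (c.lagrangian ℒ) (p.1, p.2, v) (0, 0, v' - v)) := by
  have h1 : (fun ε : ℝ => ℒ.form (HomBundle.mk q (c.chart.symm p)
      (c.jetHom p v + ε • (c.jetHom p v' - c.jetHom p v))) u) = fun ε =>
      volumeForm n (fun i => chartDeriv c.center (q (c.chart.symm p)) (u i)) *
        c.lagrangian ℒ (p.1, p.2, v + ε • (v' - v)) := by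
    ext ε
    rw [← c.jetHom_add_smul, c.density_form_apply ℒ hp]
  have h2 := ((c.hasDerivAt_lagrangian_line hℒ hp v v').const_mul
    (volumeForm n (fun i => chartDeriv c.center (q (c.chart.symm p)) (u i)))).deriv
  rw [← h1] at h2
  rw [mul_add, ← h2, ← c.density_form_apply ℒ hp]
  rfl

/-- The form built in coordinates is pulled back by the derivative of the adapted chart. Existence
gives content to `legendre`, which is chosen by `Classical.epsilon`; from here on only the defining
property of the chosen form is used. -/
theorem exists_representsLegendre {ℒ : Density q} (hℒ : IsSmoothDensity ℒ)
    {p : BaseSpace n × B} (hp : p ∈ c.chart.target) (v : BaseSpace n →L[ℝ] B) :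
    ∃ z, RepresentsLegendre ℒ (c.chart.symm p) (c.jetHom p v) z := by
  obtain ⟨z, hz, hz'⟩ := exists_form_of_affine (c.lagrangian ℒ (p.1, p.2, v))
    ((fderiv ℝ (c.lagrangian ℒ) (p.1, p.2, v)).comp
      ((ContinuousLinearMap.inr ℝ (BaseSpace n) (B × (BaseSpace n →L[ℝ] B))).comp
        (ContinuousLinearMap.inr ℝ B (BaseSpace n →L[ℝ] B)))) v
  have hs := c.chart.map_target hp
  refine ⟨z.compContinuousLinearMap (c.deriv (c.chart.symm p)), ?_, ?_⟩
  · intro u i j hij hi hj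
    refine hz _ i j hij ?_ ?_
    · have h : projDeriv q (c.chart.symm p) (u i) = 0 := hi
      refine (c.chartDeriv_projDeriv hs (u i)).symm.trans ?_
      rw [h, map_zero]
    · have h : projDeriv q (c.chart.symm p) (u j) = 0 := hj
      refine (c.chartDeriv_projDeriv hs (u j)).symm.trans ?_
      rw [h, map_zero]
  · intro γ' hγ' u
    obtain ⟨v', hv'⟩ := c.exists_eq_jetHom hp (γ := γ') hγ'
    subst hv'
    refine Eq.trans ?_ (c.legendreAffine_jetHom hℒ hp v v' u).symm
    have h := topForm_apply (z.compContinuousLinearMap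
      ((ContinuousLinearMap.id ℝ (BaseSpace n)).prod v'))
      (fun i => chartDeriv c.center (q (c.chart.symm p)) (u i))
    refine Eq.trans ?_ (h.trans (congrArg _ (hz' v')))
    refine congrArg z (funext fun i => ?_)
    exact c.deriv_symmDeriv hp _

theorem representsLegendre_legendre {ℒ : Density q} (hℒ : IsSmoothDensity ℒ)
    {p : BaseSpace n × B} (hp : p ∈ c.chart.target) (v : BaseSpace n →L[ℝ] B) :
    RepresentsLegendre ℒ (c.chart.symm p) (c.jetHom p v)
      (legendre ℒ (HomBundle.mk q (c.chart.symm p) (c.jetHom p v))).2 :=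
  Classical.epsilon_spec (c.exists_representsLegendre hℒ hp v)

/-- Evaluation on coordinate vectors, where the volume factor is `1`. This is the hypothesis on `z`
in `extDeriv_cartan`. -/
theorem legendre_form_apply {ℒ : Density q} (hℒ : IsSmoothDensity ℒ) {w : JetSpace n B}
    (hw : w ∈ c.jetTarget) (v' : BaseSpace n →L[ℝ] B) :
    FormBundle.form (legendre ℒ (c.jetParam w))
      (fun μ => c.symmDeriv (w.1, w.2.1) (coordVec μ, v' (coordVec μ))) =
      c.lagrangian ℒ w + fderiv ℝ (c.lagrangian ℒ) w (0, 0, v' - w.2.2) := by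
  have hp : (w.1, w.2.1) ∈ c.chart.target := hw
  have h := (c.representsLegendre_legendre hℒ hp w.2.2).2 (c.jetHom (w.1, w.2.1) v')
    (c.jetParam_mem (w := (w.1, w.2.1, v')) hp)
    (fun μ => chartSymmDeriv c.center w.1 (coordVec μ))
  rw [c.legendreAffine_jetHom hℒ hp] at h
  have h1 : (fun μ => chartDeriv c.center (q (c.chart.symm (w.1, w.2.1)))
      (chartSymmDeriv c.center w.1 (coordVec μ))) = coordVec := by
    ext1 μ
    have := c.proj_symm hp
    dsimp only at this
    rw [this]
    exact chartDeriv_chartSymmDeriv (c.fst_mem_target hp) _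
  rw [h1, volumeForm_coordVec, one_mul] at h
  refine Eq.trans ?_ h
  exact congrArg (FormBundle.form (legendre ℒ (c.jetParam w)))
    (funext fun μ => (c.jetHom_chartSymmDeriv hp v' (coordVec μ)).symm)

end AdaptedChart
end LegendreCoordinates

/-! ### The canonical form in a chart -/

section CanonicalForm

variable {E : Type*} [NormedAddCommGroup E] [NormedSpace ℝ E]
  {Y : Type*} [TopologicalSpace Y] [ChartedSpace E Y] [IsManifold 𝓘(ℝ, E) ∞ Y]
  {k : ℕ}

theorem formBundle_extChartAt_apply (z₀ z : FormBundle 𝓘(ℝ, E) Y k)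
    (hz : z.1 ∈ (extChartAt 𝓘(ℝ, E) z₀.1).source) :
    extChartAt (formModel 𝓘(ℝ, E) k) z₀ z = (extChartAt 𝓘(ℝ, E) z₀.1 z.1,
      (FormBundle.form z).compContinuousLinearMap
        (chartSymmDeriv z₀.1 (extChartAt 𝓘(ℝ, E) z₀.1 z.1))) := by
  rw [FiberBundle.extChartAt, ← formBundle_trivializationAt_apply hz]
  have hz' : z.1 ∈ (trivializationAt (E [⋀^Fin k]→L[ℝ] ℝ)
      (fun y : Y => FormAt 𝓘(ℝ, E) k y) z₀.1).baseSet := by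
    rw [extChartAt_source] at hz
    exact ⟨hz, mem_univ _⟩
  have := Trivialization.coe_fst' (trivializationAt (E [⋀^Fin k]→L[ℝ] ℝ)
    (fun y : Y => FormAt 𝓘(ℝ, E) k y) z₀.1) hz'
  refine Prod.ext ?_ rfl
  exact congrArg (extChartAt 𝓘(ℝ, E) z₀.1) this

theorem formBundle_proj_mem_source {z₀ z : FormBundle 𝓘(ℝ, E) Y k}
    (hz : z ∈ (extChartAt (formModel 𝓘(ℝ, E) k) z₀).source) :
    z.1 ∈ (extChartAt 𝓘(ℝ, E) z₀.1).source := by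
  rw [FiberBundle.extChartAt] at hz
  have h1 : (trivializationAt (E [⋀^Fin k]→L[ℝ] ℝ)
    (fun y : Y => FormAt 𝓘(ℝ, E) k y) z₀.1 z).1 ∈ (extChartAt 𝓘(ℝ, E) z₀.1).source := hz.2.1
  rwa [Trivialization.coe_fst _ hz.1] at h1

/-- The inverse of a chart of the bundle of forms. -/
theorem formBundle_extChartAt_symm {z₀ : FormBundle 𝓘(ℝ, E) Y k}
    {u : E × (E [⋀^Fin k]→L[ℝ] ℝ)} (hu : u ∈ (extChartAt (formModel 𝓘(ℝ, E) k) z₀).target) :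
    u.1 ∈ (extChartAt 𝓘(ℝ, E) z₀.1).target ∧
    ((extChartAt (formModel 𝓘(ℝ, E) k) z₀).symm u).1 = (extChartAt 𝓘(ℝ, E) z₀.1).symm u.1 ∧
    (FormBundle.form ((extChartAt (formModel 𝓘(ℝ, E) k) z₀).symm u)).compContinuousLinearMap
        (chartSymmDeriv z₀.1 u.1) = u.2 := by
  have h1 := formBundle_proj_mem_source ((extChartAt (formModel 𝓘(ℝ, E) k) z₀).map_target hu)
  have h2 := formBundle_extChartAt_apply z₀ _ h1
  rw [(extChartAt (formModel 𝓘(ℝ, E) k) z₀).right_inv hu] at h2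
  have h3 : u.1 = _ := congrArg Prod.fst h2
  have h4 : u.2 = _ := congrArg Prod.snd h2
  dsimp only at h3 h4
  rw [← h3] at h4
  refine ⟨?_, ?_, h4.symm⟩
  · rw [h3]; exact (extChartAt 𝓘(ℝ, E) z₀.1).map_source h1
  · rw [h3, (extChartAt 𝓘(ℝ, E) z₀.1).left_inv h1]

/-- Read in the trivialization at the image point, the inverse chart is the form component composed
with the derivative of a transition map of `Y`, hence differentiable in both arguments. -/
theorem mdifferentiableAt_formBundle_extChartAt_symm {z₀ : FormBundle 𝓘(ℝ, E) Y k}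
    {u₁ : E × (E [⋀^Fin k]→L[ℝ] ℝ)} (hu₁ : u₁ ∈ (extChartAt (formModel 𝓘(ℝ, E) k) z₀).target) :
    MDifferentiableAt 𝓘(ℝ, E × (E [⋀^Fin k]→L[ℝ] ℝ)) (formModel 𝓘(ℝ, E) k)
      (extChartAt (formModel 𝓘(ℝ, E) k) z₀).symm u₁ := by
  have hnhds : (extChartAt (formModel 𝓘(ℝ, E) k) z₀).target ∈ 𝓝 u₁ :=
    (isOpen_extChartAt_target z₀).mem_nhds hu₁
  obtain ⟨ht, hy₁, -⟩ := formBundle_extChartAt_symm hu₁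
  have hb0 : ContMDiffAt 𝓘(ℝ, E × (E [⋀^Fin k]→L[ℝ] ℝ)) 𝓘(ℝ, E) ∞
      (fun u : E × (E [⋀^Fin k]→L[ℝ] ℝ) => (extChartAt 𝓘(ℝ, E) z₀.1).symm u.1) u₁ :=
    ContMDiffAt.comp u₁ (g := (extChartAt 𝓘(ℝ, E) z₀.1).symm)
      ((contMDiffOn_extChartAt_symm z₀.1).contMDiffAt
        ((isOpen_extChartAt_target z₀.1).mem_nhds ht))
      contDiff_fst.contMDiff.contMDiffAt
  have hb : (fun u => ((extChartAt (formModel 𝓘(ℝ, E) k) z₀).symm u).1) =ᶠ[𝓝 u₁]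
      fun u => (extChartAt 𝓘(ℝ, E) z₀.1).symm u.1 := by
    filter_upwards [hnhds] with u hu
    exact (formBundle_extChartAt_symm hu).2.1
  rw [mdifferentiableAt_totalSpace]
  refine ⟨(hb0.mdifferentiableAt (by simp)).congr_of_eventuallyEq hb, ?_⟩
  rw [hy₁]
  set y₁ := (extChartAt 𝓘(ℝ, E) z₀.1).symm u₁.1
  have hs₁ : y₁ ∈ (extChartAt 𝓘(ℝ, E) z₀.1).source :=
    (extChartAt 𝓘(ℝ, E) z₀.1).map_target ht
  have h1 := ContMDiffAt.comp u₁ (f := fun u : E × (E [⋀^Fin k]→L[ℝ] ℝ) =>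
    (extChartAt 𝓘(ℝ, E) z₀.1).symm u.1) (contMDiffAt_chartDeriv hs₁) hb0
  rw [contMDiffAt_iff_contDiffAt] at h1
  have h2 : DifferentiableAt ℝ (fun u : E × (E [⋀^Fin k]→L[ℝ] ℝ) => u.2) u₁ := differentiableAt_snd
  have h3 := h2.continuousAlternatingMapCompContinuousLinearMap (h1.differentiableAt (by simp))
  refine (mdifferentiableAt_iff_differentiableAt.2 h3).congr_of_eventuallyEq ?_
  filter_upwards [hnhds, hb0.continuousAt.preimage_mem_nhds
    (extChartAt_source_mem_nhds (I := 𝓘(ℝ, E)) y₁)] with u hu huy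
  obtain ⟨hut, huy', huf⟩ := formBundle_extChartAt_symm hu
  rw [formBundle_trivializationAt_apply (by rw [huy']; exact huy), huy']
  ext v
  have h4 := DFunLike.congr_fun huf fun i => chartDeriv z₀.1
    ((extChartAt 𝓘(ℝ, E) z₀.1).symm u.1) (chartSymmDeriv y₁ (extChartAt 𝓘(ℝ, E) y₁
      ((extChartAt 𝓘(ℝ, E) z₀.1).symm u.1)) (v i))
  refine Eq.trans ?_ h4
  refine congrArg (FormBundle.form ((extChartAt (formModel 𝓘(ℝ, E) k) z₀).symm u)) (funext fun i => ?_)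
  have h5 := chartSymmDeriv_chartDeriv ((extChartAt 𝓘(ℝ, E) z₀.1).map_target hut)
    (chartSymmDeriv y₁ (extChartAt 𝓘(ℝ, E) y₁ ((extChartAt 𝓘(ℝ, E) z₀.1).symm u.1)) (v i))
  rw [(extChartAt 𝓘(ℝ, E) z₀.1).right_inv hut] at h5
  exact h5.symm

/-- In a chart, the canonical form is `(y, ζ) ↦ ζ ∘ pr₁`. -/
theorem formInChart_canonicalForm {z₀ : FormBundle 𝓘(ℝ, E) Y k}
    {u : E × (E [⋀^Fin k]→L[ℝ] ℝ)} (hu : u ∈ (extChartAt (formModel 𝓘(ℝ, E) k) z₀).target) :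
    formInChart (formModel 𝓘(ℝ, E) k) (canonicalForm 𝓘(ℝ, E) k) z₀ u =
      u.2.compContinuousLinearMap (ContinuousLinearMap.fst ℝ E (E [⋀^Fin k]→L[ℝ] ℝ)) := by
  obtain ⟨hut, huy, huf⟩ := formBundle_extChartAt_symm hu
  have h1 := mdifferentiableAt_formBundle_extChartAt_symm hu
  have h2 : MDifferentiableAt (formModel 𝓘(ℝ, E) k) 𝓘(ℝ, E)
      (fun w : FormBundle 𝓘(ℝ, E) Y k => w.1) ((extChartAt (formModel 𝓘(ℝ, E) k) z₀).symm u) :=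
    mdifferentiableAt_proj _
  have h3 := mfderiv_comp u h2 h1
  -- In charts the bundle projection is `Prod.fst`; the remaining derivative of the inverse chart of
  -- `Y` is absorbed by the coordinate form `u.2`.
  have hb : (fun w : FormBundle 𝓘(ℝ, E) Y k => w.1) ∘ (extChartAt (formModel 𝓘(ℝ, E) k) z₀).symm
      =ᶠ[𝓝 u] (extChartAt 𝓘(ℝ, E) z₀.1).symm ∘ Prod.fst := by
    filter_upwards [(isOpen_extChartAt_target (I := formModel 𝓘(ℝ, E) k) z₀).mem_nhds hu] with u hu
    exact (formBundle_extChartAt_symm hu).2.1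
  have h4 : MDifferentiableAt 𝓘(ℝ, E) 𝓘(ℝ, E) (extChartAt 𝓘(ℝ, E) z₀.1).symm u.1 :=
    ((contMDiffOn_extChartAt_symm (n := ∞) z₀.1).contMDiffAt
      ((isOpen_extChartAt_target z₀.1).mem_nhds hut)).mdifferentiableAt (by simp)
  have h5 : MDifferentiableAt 𝓘(ℝ, E × (E [⋀^Fin k]→L[ℝ] ℝ)) 𝓘(ℝ, E)
      (Prod.fst : E × (E [⋀^Fin k]→L[ℝ] ℝ) → E) u := differentiableAt_fst.mdifferentiableAt
  have h6 := h3.symm.trans (hb.mfderiv_eq.trans (mfderiv_comp u h4 h5))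
  rw [mfderiv_eq_fderiv, fderiv_fst] at h6
  rw [← huf]
  ext v
  refine congrArg (FormBundle.form ((extChartAt (formModel 𝓘(ℝ, E) k) z₀).symm u))
    (funext fun i => ?_)
  exact DFunLike.congr_fun h6 (v i)

end CanonicalForm

/-! ### The canonical form along the Legendre transformation -/

section Omega

variable {E : Type*} [NormedAddCommGroup E] [NormedSpace ℝ E]
  {Y : Type*} [TopologicalSpace Y] [ChartedSpace E Y] [IsManifold 𝓘(ℝ, E) ∞ Y]
  {k : ℕ} {W : Type*} [NormedAddCommGroup W] [NormedSpace ℝ W]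

/-- Read in itself, the preferred chart is the identity. So at the center the chart derivative
occurring in `extDerivForm` drops out. -/
theorem mfderiv_extChartAt_center {E₀ : Type*} [NormedAddCommGroup E₀] [NormedSpace ℝ E₀]
    {H : Type*} [TopologicalSpace H] {I : ModelWithCorners ℝ E₀ H} [I.Boundaryless]
    {M : Type*} [TopologicalSpace M] [ChartedSpace H M] (z : M) (v : E₀) :
    mfderiv I 𝓘(ℝ, E₀) (extChartAt I z) z v = v := by
  have h : writtenInExtChartAt I 𝓘(ℝ, E₀) z (extChartAt I z) =ᶠ[𝓝 (extChartAt I z z)] id := by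
    filter_upwards [(isOpen_extChartAt_target (I := I) z).mem_nhds (mem_extChartAt_target z)]
      with u hu
    exact (extChartAt I z).right_inv hu
  have hd : MDifferentiableAt I 𝓘(ℝ, E₀) (extChartAt I z) z := by
    rw [mdifferentiableAt_iff]
    refine ⟨continuousAt_extChartAt z, ?_⟩
    exact (differentiableAt_id.congr_of_eventuallyEq h).differentiableWithinAt
  have h1 := h.fderiv_eq (𝕜 := ℝ)
  rw [fderiv_id, ← fderivWithin_univ, ← I.range_eq_univ] at h1
  exact DFunLike.congr_fun (hd.mfderiv.trans h1) v

theorem mfderiv_eq_fderiv_extChartAt {E₀ : Type*} [NormedAddCommGroup E₀] [NormedSpace ℝ E₀]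
    {H : Type*} [TopologicalSpace H] {I : ModelWithCorners ℝ E₀ H}
    {M : Type*} [TopologicalSpace M] [ChartedSpace H M] {G : W → M} {w : W}
    (hG : MDifferentiableAt 𝓘(ℝ, W) I G w) (v : W) :
    mfderiv 𝓘(ℝ, W) I G w v = fderiv ℝ (extChartAt I (G w) ∘ G) w v := by
  have h1 := hG.mfderiv
  rw [modelWithCornersSelf_coe, range_id, fderivWithin_univ] at h1
  exact DFunLike.congr_fun h1 v

/-- The pull-back of the canonical form by a map from a vector space. -/
def pulledBackForm (G : W → FormBundle 𝓘(ℝ, E) Y k) (w₀ w : W) : W [⋀^Fin k]→L[ℝ] ℝ :=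
  (formInChart (formModel 𝓘(ℝ, E) k) (canonicalForm 𝓘(ℝ, E) k) (G w₀)
    (extChartAt (formModel 𝓘(ℝ, E) k) (G w₀) (G w))).compContinuousLinearMap
    (fderiv ℝ (extChartAt (formModel 𝓘(ℝ, E) k) (G w₀) ∘ G) w)

variable {G : W → FormBundle 𝓘(ℝ, E) Y k} {w₀ : W}

theorem contDiffAt_extChartAt_comp
    (hG : ContMDiffAt 𝓘(ℝ, W) (formModel 𝓘(ℝ, E) k) ∞ G w₀) :
    ContDiffAt ℝ ∞ (extChartAt (formModel 𝓘(ℝ, E) k) (G w₀) ∘ G) w₀ :=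
  (contMDiffAt_iff_target.1 hG).2.contDiffAt

theorem differentiableAt_formInChart_canonicalForm (z₀ : FormBundle 𝓘(ℝ, E) Y k) :
    DifferentiableAt ℝ (formInChart (formModel 𝓘(ℝ, E) k) (canonicalForm 𝓘(ℝ, E) k) z₀)
      (extChartAt (formModel 𝓘(ℝ, E) k) z₀ z₀) := by
  have h2 : DifferentiableAt ℝ (fun u : E × (E [⋀^Fin k]→L[ℝ] ℝ) => u.2)
    (extChartAt (formModel 𝓘(ℝ, E) k) z₀ z₀) := differentiableAt_snd
  refine (h2.continuousAlternatingMapCompContinuousLinearMap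
    (differentiableAt_const
      (ContinuousLinearMap.fst ℝ E (E [⋀^Fin k]→L[ℝ] ℝ)))).congr_of_eventuallyEq ?_
  filter_upwards [extChartAt_target_mem_nhds (I := formModel 𝓘(ℝ, E) k) z₀] with u hu
  exact formInChart_canonicalForm hu

theorem differentiableAt_pulledBackForm
    (hG : ContMDiffAt 𝓘(ℝ, W) (formModel 𝓘(ℝ, E) k) ∞ G w₀) :
    DifferentiableAt ℝ (pulledBackForm G w₀) w₀ := by
  have h := contDiffAt_extChartAt_comp hG
  have h1 : DifferentiableAt ℝ (fun w => formInChart (formModel 𝓘(ℝ, E) k)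
      (canonicalForm 𝓘(ℝ, E) k) (G w₀) (extChartAt (formModel 𝓘(ℝ, E) k) (G w₀) (G w))) w₀ :=
    DifferentiableAt.comp w₀ (f := extChartAt (formModel 𝓘(ℝ, E) k) (G w₀) ∘ G)
      (g := formInChart (formModel 𝓘(ℝ, E) k) (canonicalForm 𝓘(ℝ, E) k) (G w₀))
      (differentiableAt_formInChart_canonicalForm (G w₀))
      (h.differentiableAt (by simp))
  exact h1.continuousAlternatingMapCompContinuousLinearMap
    ((h.fderiv_right (m := ∞) (by simp)).differentiableAt (by simp))

/-- The exterior derivative commutes with pull-back, here by `G` read in the chart at `G w₀`, which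
is the chart in which `extDerivForm` is computed. -/
theorem canonicalOmega_map (hG : ContMDiffAt 𝓘(ℝ, W) (formModel 𝓘(ℝ, E) k) ∞ G w₀)
    (ξ : Fin (k + 1) → W) :
    canonicalOmega 𝓘(ℝ, E) k (G w₀)
      (fun i => mfderiv 𝓘(ℝ, W) (formModel 𝓘(ℝ, E) k) G w₀ (ξ i)) =
      -extDeriv (pulledBackForm G w₀) w₀ ξ := by
  have h := contDiffAt_extChartAt_comp hG
  have h1 := extDeriv_pullback (x := w₀) (r := ∞) (f := extChartAt (formModel 𝓘(ℝ, E) k) (G w₀) ∘ G)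
    (differentiableAt_formInChart_canonicalForm (G w₀)) h (by simpa using ENat.LEInfty.out)
  have h2 : extDeriv (pulledBackForm G w₀) w₀ = _ := h1
  rw [h2]
  refine congrArg Neg.neg ?_
  refine congrArg (extDeriv (formInChart (formModel 𝓘(ℝ, E) k) (canonicalForm 𝓘(ℝ, E) k) (G w₀))
    (extChartAt (formModel 𝓘(ℝ, E) k) (G w₀) (G w₀))) (funext fun i => ?_)
  refine (mfderiv_extChartAt_center (I := formModel 𝓘(ℝ, E) k) (G w₀) _).trans ?_
  exact mfderiv_eq_fderiv_extChartAt (hG.mdifferentiableAt (by simp)) (ξ i)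

/-- The tautological property of the canonical form: pulled back by `G` it is `G` itself, evaluated
on the images of vectors under the derivative of the base map. A neighborhood is needed because the
identity is differentiated afterwards. -/
theorem pulledBackForm_apply (hG : ContMDiffAt 𝓘(ℝ, W) (formModel 𝓘(ℝ, E) k) ∞ G w₀) :
    ∀ᶠ w in 𝓝 w₀, ∀ u, pulledBackForm G w₀ w u = FormBundle.form (G w)
      fun i => mfderiv 𝓘(ℝ, W) 𝓘(ℝ, E) (fun w => (G w).1) w (u i) := by
  have h := contDiffAt_extChartAt_comp hG
  have hb : ContMDiffAt 𝓘(ℝ, W) 𝓘(ℝ, E) ∞ (fun w => (G w).1) w₀ :=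
    (contMDiffAt_formBundle_iff.1 hG).1
  have hbe : ∀ᶠ w in 𝓝 w₀, ContMDiffAt 𝓘(ℝ, W) 𝓘(ℝ, E) 1 (fun w => (G w).1) w :=
    (contMDiffAt_iff_contMDiffAt_nhds (by simp)).1 (hb.of_le (by simp))
  have hde : ∀ᶠ w in 𝓝 w₀, ContDiffAt ℝ 1
      (extChartAt (formModel 𝓘(ℝ, E) k) (G w₀) ∘ G) w :=
    (h.of_le (by simp)).eventually (by simp)
  have hs : ∀ᶠ w in 𝓝 w₀, ∀ᶠ w' in 𝓝 w,
      G w' ∈ (extChartAt (formModel 𝓘(ℝ, E) k) (G w₀)).source :=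
    eventually_eventually_nhds.2 (hG.continuousAt.preimage_mem_nhds
      (extChartAt_source_mem_nhds (I := formModel 𝓘(ℝ, E) k) (G w₀)))
  filter_upwards [hbe, hde, hs] with w hw hdw hsw u
  have hsw' := hsw.self_of_nhds
  have hys := formBundle_proj_mem_source hsw'
  have h1 : pulledBackForm G w₀ w u = _ := DFunLike.congr_fun (congrArg
    (fun α => ContinuousAlternatingMap.compContinuousLinearMap α
      (fderiv ℝ (extChartAt (formModel 𝓘(ℝ, E) k) (G w₀) ∘ G) w))
    (formInChart_canonicalForm ((extChartAt (formModel 𝓘(ℝ, E) k) (G w₀)).map_source hsw'))) u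
  rw [h1, formBundle_extChartAt_apply _ _ hys]
  refine congrArg (FormBundle.form (G w)) (funext fun i => ?_)
  have h2 : fderiv ℝ (fun w => extChartAt 𝓘(ℝ, E) (G w₀).1 (G w).1) w (u i) =
      (fderiv ℝ (extChartAt (formModel 𝓘(ℝ, E) k) (G w₀) ∘ G) w (u i)).1 := by
    have h3 := ((ContinuousLinearMap.fst ℝ E (E [⋀^Fin k]→L[ℝ] ℝ)).hasFDerivAt.comp w
      (hdw.differentiableAt (by simp)).hasFDerivAt).fderiv
    have h4 : (ContinuousLinearMap.fst ℝ E (E [⋀^Fin k]→L[ℝ] ℝ)) ∘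
        (extChartAt (formModel 𝓘(ℝ, E) k) (G w₀) ∘ G) =ᶠ[𝓝 w]
        (fun w => extChartAt 𝓘(ℝ, E) (G w₀).1 (G w).1) := by
      filter_upwards [hsw] with w' hw'
      exact congrArg Prod.fst (formBundle_extChartAt_apply (G w₀) (G w')
        (formBundle_proj_mem_source hw'))
    rw [← h4.fderiv_eq, h3]
    rfl
  have h5 : MDifferentiableAt 𝓘(ℝ, E) 𝓘(ℝ, E) (extChartAt 𝓘(ℝ, E) (G w₀).1) (G w).1 :=
    mdifferentiableAt_extChartAt (by rwa [extChartAt_source] at hys)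
  have h6 := mfderiv_comp w h5 (hw.mdifferentiableAt (by simp))
  rw [mfderiv_eq_fderiv] at h6
  have h7 := DFunLike.congr_fun h6 (u i)
  have h8 : fderiv ℝ (fun w => extChartAt 𝓘(ℝ, E) (G w₀).1 (G w).1) w (u i) =
      chartDeriv (E := E) (G w₀).1 (G w).1 (mfderiv 𝓘(ℝ, W) 𝓘(ℝ, E) (fun w => (G w).1) w (u i)) := h7
  have h9 := chartSymmDeriv_chartDeriv (E := E) hys
    (mfderiv 𝓘(ℝ, W) 𝓘(ℝ, E) (fun w => (G w).1) w (u i) : E)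
  rw [← h8, h2] at h9
  exact h9

end Omega

/-! ### The pull-back of the canonical form to jet space is the Cartan form -/

section CartanForm

variable {n : ℕ} {X : Type*} [TopologicalSpace X]
  [ChartedSpace (EuclideanSpace ℝ (Fin (n + 1))) X]
  {E : Type*} [NormedAddCommGroup E] [NormedSpace ℝ E]
  {Y : Type*} [TopologicalSpace Y] [ChartedSpace E Y]
  [IsManifold (𝓡 (n + 1)) ∞ X] [IsManifold 𝓘(ℝ, E) ∞ Y]
  {q : C^∞⟮𝓘(ℝ, E), Y; 𝓡 (n + 1), X⟯}
  {B : Type*} [NormedAddCommGroup B] [NormedSpace ℝ B]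

namespace AdaptedChart

variable (c : AdaptedChart q B)

/-- The Legendre transformation in jet coordinates. -/
def legendreParam (ℒ : Density q) (w : JetSpace n B) : FormBundle 𝓘(ℝ, E) Y (n + 1) :=
  legendre ℒ (c.jetParam w)

theorem contMDiffAt_legendreParam {ℒ : Density q} (hreg : IsRegular ℒ) {w : JetSpace n B}
    (hw : w ∈ c.jetTarget) :
    ContMDiffAt 𝓘(ℝ, JetSpace n B) (formModel 𝓘(ℝ, E) (n + 1)) ∞ (c.legendreParam ℒ) w := by
  have h1 : ContMDiffOn 𝓘(ℝ, JetSpace n B) (homModel n E) ∞ c.jetParam c.jetTarget :=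
    fun w hw => (c.contMDiffAt_jetParam hw).contMDiffWithinAt
  exact (hreg.1.comp h1 fun w hw => c.jetParam_mem hw).contMDiffAt
    (c.isOpen_jetTarget.mem_nhds hw)

theorem mfderiv_legendreParam_proj (ℒ : Density q) {w : JetSpace n B} (hw : w ∈ c.jetTarget)
    (u : JetSpace n B) :
    mfderiv 𝓘(ℝ, JetSpace n B) 𝓘(ℝ, E) (fun w => (c.legendreParam ℒ w).1) w u =
      c.symmDeriv (w.1, w.2.1) (u.1, u.2.1) := by
  let pr : JetSpace n B →L[ℝ] BaseSpace n × B :=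
    (ContinuousLinearMap.fst ℝ _ _).prod ((ContinuousLinearMap.fst ℝ _ _).comp
      (ContinuousLinearMap.snd ℝ _ _))
  have h1 : MDifferentiableAt 𝓘(ℝ, JetSpace n B) 𝓘(ℝ, BaseSpace n × B) pr w :=
    pr.differentiableAt.mdifferentiableAt
  have h2 := mfderiv_comp w ((c.contMDiffAt_symm hw).mdifferentiableAt (by simp)) h1
  rw [mfderiv_eq_fderiv, pr.fderiv] at h2
  exact DFunLike.congr_fun h2 u

/-- The value of the canonical form along the Legendre transformation is given by the
Euler–Lagrange expression. -/
theorem canonicalOmega_legendreParam {ℒ : Density q} (hℒ : IsSmoothDensity ℒ)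
    (hreg : IsRegular ℒ) {f : BaseSpace n → B} {a : BaseSpace n} (hf : ContDiffAt ℝ 2 f a)
    (ha : coordJet f a ∈ c.jetTarget) (b : B) (σ : BaseSpace n →L[ℝ] B) :
    canonicalOmega 𝓘(ℝ, E) (n + 1) (c.legendreParam ℒ (coordJet f a)) (fun i =>
      mfderiv 𝓘(ℝ, JetSpace n B) (formModel 𝓘(ℝ, E) (n + 1)) (c.legendreParam ℒ) (coordJet f a)
        ((Fin.cons (0, b, σ) fun μ => fderiv ℝ (coordJet f) a (coordVec μ) :
          Fin (n + 1 + 1) → JetSpace n B) i)) =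
      -eulerLagrange (c.lagrangian ℒ) f a b := by
  have hG := c.contMDiffAt_legendreParam hreg ha
  have hnhds := c.isOpen_jetTarget.mem_nhds ha
  rw [canonicalOmega_map hG]
  refine congrArg Neg.neg ?_
  refine extDeriv_cartan hf (((c.contDiffOn_lagrangian hℒ).contDiffAt hnhds).of_le
    ENat.LEInfty.out) (z := fun w => (FormBundle.form (c.legendreParam ℒ w)).compContinuousLinearMap
      (c.symmDeriv (w.1, w.2.1))) (differentiableAt_pulledBackForm hG) ?_ ?_ b σ
  · filter_upwards [pulledBackForm_apply hG, hnhds] with w hw hwt u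
    rw [hw u]
    exact congrArg (FormBundle.form (c.legendreParam ℒ w))
      (funext fun i => c.mfderiv_legendreParam_proj ℒ hwt (u i))
  · filter_upwards [hnhds] with w hw v'
    exact c.legendre_form_apply hℒ hw v'

end AdaptedChart
end CartanForm

/-! ### Hamiltonian sections and the Euler–Lagrange equations -/

section HamiltonianSections

/-- The vectors `D α, D v₀, …, D vₙ` are images of `n + 2` vectors of an `(n + 1)`-dimensional
space, so `Ω` vanishes on them and only `η` counts; the rest is a top-degree form in `v`. -/
theorem alternating_cons_map {n : ℕ} {W : Type*} [NormedAddCommGroup W] [NormedSpace ℝ W]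
    (Ω : W [⋀^Fin (n + 1 + 1)]→L[ℝ] ℝ) (D : BaseSpace n →L[ℝ] W) (α : BaseSpace n) (η : W)
    (v : Fin (n + 1) → BaseSpace n) :
    Ω (Fin.cons (D α + η) fun i => D (v i)) =
      volumeForm n v * Ω (Fin.cons η fun μ => D (coordVec μ)) := by
  have h1 : Ω (Fin.cons (D α) fun i => D (v i)) = 0 := by
    have h2 : (Fin.cons (D α) fun i => D (v i) : Fin (n + 1 + 1) → W) =
        fun i => D ((Fin.cons α v : Fin (n + 1 + 1) → BaseSpace n) i) := by
      ext i
      refine Fin.cases ?_ (fun j => ?_) i <;> simp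
    rw [h2]
    have h3 := (Ω.compContinuousLinearMap D).toAlternatingMap.map_linearDependent
      (Fin.cons α v : Fin (n + 1 + 1) → BaseSpace n) fun h => by
        have := h.fintype_card_le_finrank
        simp at this
    exact h3
  have h4 := congrArg (fun l => l fun i => D (v i)) (map_add Ω.curryLeft (D α) η)
  have h5 : Ω (Fin.cons (D α + η) fun i => D (v i)) = Ω (Fin.cons (D α) fun i => D (v i)) +
      Ω (Fin.cons η fun i => D (v i)) := h4
  rw [h5, h1, zero_add]
  exact topForm_apply ((Ω.curryLeft η).compContinuousLinearMap D) v

theorem contDiffAt_coordJet {n : ℕ} {B : Type*} [NormedAddCommGroup B] [NormedSpace ℝ B]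
    {f : BaseSpace n → B} {a : BaseSpace n} (hf : ContDiffAt ℝ ∞ f a) :
    ContDiffAt ℝ ∞ (coordJet f) a :=
  contDiffAt_id.prodMk (hf.prodMk (hf.fderiv_right (by simp)))

variable {n : ℕ} {X : Type*} [TopologicalSpace X]
  [ChartedSpace (EuclideanSpace ℝ (Fin (n + 1))) X]
  {E : Type*} [NormedAddCommGroup E] [NormedSpace ℝ E]
  {Y : Type*} [TopologicalSpace Y] [ChartedSpace E Y]
  [IsManifold (𝓡 (n + 1)) ∞ X] [IsManifold 𝓘(ℝ, E) ∞ Y]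
  {q : C^∞⟮𝓘(ℝ, E), Y; 𝓡 (n + 1), X⟯}
  {B : Type*} [NormedAddCommGroup B] [NormedSpace ℝ B]

namespace AdaptedChart

variable (c : AdaptedChart q B) {ℒ : Density q} {φ : X → Y} {x : X}

theorem conjugateJet_eventuallyEq (hφ : ContMDiff (𝓡 (n + 1)) 𝓘(ℝ, E) ∞ φ)
    (hsec : ∀ x, q (φ x) = x) (hx : φ x ∈ c.chart.source) :
    conjugateJet ℒ φ =ᶠ[𝓝 x] fun x' => c.legendreParam ℒ
      (coordJet (c.localRep φ) (extChartAt (𝓡 (n + 1)) c.center x')) := by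
  filter_upwards [hφ.continuous.continuousAt.preimage_mem_nhds (c.chart.open_source.mem_nhds hx)]
    with x' hx'
  rw [conjugateJet, c.firstJet_eq_jetParam hφ.contMDiffAt hsec hx']
  rfl

theorem mem_source_of_section (hsec : ∀ x, q (φ x) = x) (hx : φ x ∈ c.chart.source) :
    x ∈ (extChartAt (𝓡 (n + 1)) c.center).source := by
  have := c.base_mem _ hx
  rwa [hsec] at this

theorem contDiffAt_localRep_extChartAt (hφ : ContMDiff (𝓡 (n + 1)) 𝓘(ℝ, E) ∞ φ)
    (hsec : ∀ x, q (φ x) = x) (hx : φ x ∈ c.chart.source) :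
    ContDiffAt ℝ ∞ (c.localRep φ) (extChartAt (𝓡 (n + 1)) c.center x) := by
  have hxs := c.mem_source_of_section hsec hx
  refine c.contDiffAt_localRep hφ ((extChartAt (𝓡 (n + 1)) c.center).map_source hxs) ?_
  rwa [(extChartAt (𝓡 (n + 1)) c.center).left_inv hxs]

theorem mfderiv_conjugateJet (hreg : IsRegular ℒ) (hφ : ContMDiff (𝓡 (n + 1)) 𝓘(ℝ, E) ∞ φ)
    (hsec : ∀ x, q (φ x) = x) (hx : φ x ∈ c.chart.source) (v : BaseSpace n) :
    mfderiv (𝓡 (n + 1)) (formModel 𝓘(ℝ, E) (n + 1)) (conjugateJet ℒ φ) x v =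
      mfderiv 𝓘(ℝ, JetSpace n B) (formModel 𝓘(ℝ, E) (n + 1)) (c.legendreParam ℒ)
        (coordJet (c.localRep φ) (extChartAt (𝓡 (n + 1)) c.center x))
        (fderiv ℝ (coordJet (c.localRep φ)) (extChartAt (𝓡 (n + 1)) c.center x)
          (chartDeriv c.center x v)) := by
  have hxs := c.mem_source_of_section hsec hx
  have h1 : MDifferentiableAt (𝓡 (n + 1)) 𝓘(ℝ, BaseSpace n)
      (extChartAt (𝓡 (n + 1)) c.center) x :=
    mdifferentiableAt_extChartAt (by rwa [extChartAt_source] at hxs)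
  have h2 : MDifferentiableAt 𝓘(ℝ, BaseSpace n) 𝓘(ℝ, JetSpace n B) (coordJet (c.localRep φ))
      (extChartAt (𝓡 (n + 1)) c.center x) :=
    ((contDiffAt_coordJet (c.contDiffAt_localRep_extChartAt hφ hsec hx)).differentiableAt
      (by simp)).mdifferentiableAt
  have h3 := (c.contMDiffAt_legendreParam hreg (c.coordJet_mem hsec hx)).mdifferentiableAt
    (by simp)
  have h4 := mfderiv_comp x h2 h1
  have h5 := mfderiv_comp x h3 (h2.comp x h1)
  rw [mfderiv_eq_fderiv] at h4
  have h6 := (c.conjugateJet_eventuallyEq (ℒ := ℒ) hφ hsec hx).mfderiv_eq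
    (I := 𝓡 (n + 1)) (I' := formModel 𝓘(ℝ, E) (n + 1))
  refine (DFunLike.congr_fun (h6.trans h5) v).trans ?_
  exact congrArg (mfderiv 𝓘(ℝ, JetSpace n B) (formModel 𝓘(ℝ, E) (n + 1)) (c.legendreParam ℒ)
        (coordJet (c.localRep φ) (extChartAt (𝓡 (n + 1)) c.center x))) (DFunLike.congr_fun h4 v)

theorem canonicalOmega_conjugateJet (hℒ : IsSmoothDensity ℒ) (hreg : IsRegular ℒ)
    (hφ : ContMDiff (𝓡 (n + 1)) 𝓘(ℝ, E) ∞ φ) (hsec : ∀ x, q (φ x) = x)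
    (hx : φ x ∈ c.chart.source) (ξ : JetSpace n B) (v : Fin (n + 1) → BaseSpace n) :
    canonicalOmega 𝓘(ℝ, E) (n + 1) (conjugateJet ℒ φ x)
      (Fin.cons (mfderiv 𝓘(ℝ, JetSpace n B) (formModel 𝓘(ℝ, E) (n + 1)) (c.legendreParam ℒ)
        (coordJet (c.localRep φ) (extChartAt (𝓡 (n + 1)) c.center x)) ξ) fun i =>
          mfderiv (𝓡 (n + 1)) (formModel 𝓘(ℝ, E) (n + 1)) (conjugateJet ℒ φ) x (v i)) =
      volumeForm n (fun i => chartDeriv c.center x (v i)) *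
        -eulerLagrange (c.lagrangian ℒ) (c.localRep φ) (extChartAt (𝓡 (n + 1)) c.center x)
          (ξ.2.1 - fderiv ℝ (c.localRep φ) (extChartAt (𝓡 (n + 1)) c.center x) ξ.1) := by
  set a := extChartAt (𝓡 (n + 1)) c.center x
  set f := c.localRep φ
  have hf : ContDiffAt ℝ ∞ f a := c.contDiffAt_localRep_extChartAt hφ hsec hx
  let T : JetSpace n B →L[ℝ] E × (E [⋀^Fin (n + 1)]→L[ℝ] ℝ) :=
    mfderiv 𝓘(ℝ, JetSpace n B) (formModel 𝓘(ℝ, E) (n + 1)) (c.legendreParam ℒ) (coordJet f a)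
  let Ω : (E × (E [⋀^Fin (n + 1)]→L[ℝ] ℝ)) [⋀^Fin (n + 1 + 1)]→L[ℝ] ℝ :=
    canonicalOmega 𝓘(ℝ, E) (n + 1) (conjugateJet ℒ φ x)
  have h0 : conjugateJet ℒ φ x = c.legendreParam ℒ (coordJet f a) :=
    (c.conjugateJet_eventuallyEq hφ hsec hx).self_of_nhds
  have hΩ : Ω = canonicalOmega 𝓘(ℝ, E) (n + 1) (c.legendreParam ℒ (coordJet f a)) := by
    simp only [Ω]; rw [h0]
  let D : BaseSpace n →L[ℝ] JetSpace n B := fderiv ℝ (coordJet f) a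
  have hD1 : ∀ α, (D α).1 = α ∧ (D α).2.1 = fderiv ℝ f a α := by
    intro α
    have hd : HasFDerivAt (coordJet f) ((ContinuousLinearMap.id ℝ (BaseSpace n)).prod
        ((fderiv ℝ f a).prod (fderiv ℝ (fderiv ℝ f) a))) a :=
      (hasFDerivAt_id a).prodMk ((hf.differentiableAt (by simp)).hasFDerivAt.prodMk
        ((hf.fderiv_right (m := ∞) (by simp)).differentiableAt (by simp)).hasFDerivAt)
    simp only [D, hd.fderiv]
    exact ⟨rfl, rfl⟩
  -- Splitting into a vector tangent to the jet of the section and one vertical over the base, to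
  -- which `canonicalOmega_legendreParam` applies.
  have hξ : ξ = D ξ.1 + (0, ξ.2.1 - fderiv ℝ f a ξ.1, ξ.2.2 - (D ξ.1).2.2) := by
    refine Prod.ext ?_ (Prod.ext ?_ ?_)
    · simp [(hD1 ξ.1).1]
    · simp [(hD1 ξ.1).2]
    · simp
  have key := alternating_cons_map (Ω.compContinuousLinearMap T) D ξ.1
    (0, ξ.2.1 - fderiv ℝ f a ξ.1, ξ.2.2 - (D ξ.1).2.2) (fun i => chartDeriv c.center x (v i))
  rw [← hξ] at key
  have h1 := c.canonicalOmega_legendreParam hℒ hreg (hf.of_le ENat.LEInfty.out)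
    (c.coordJet_mem hsec hx) (ξ.2.1 - fderiv ℝ f a ξ.1) (ξ.2.2 - (D ξ.1).2.2)
  have h2 : (Ω.compContinuousLinearMap T) (Fin.cons
      (0, ξ.2.1 - fderiv ℝ f a ξ.1, ξ.2.2 - (D ξ.1).2.2) fun μ => D (coordVec μ)) =
      -eulerLagrange (c.lagrangian ℒ) f a (ξ.2.1 - fderiv ℝ f a ξ.1) := by
    rw [hΩ]; exact h1
  rw [h2] at key
  refine Eq.trans ?_ key
  refine congrArg Ω (funext fun i => ?_)
  refine Fin.cases ?_ (fun j => ?_) i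
  · rfl
  · exact c.mfderiv_conjugateJet hreg hφ hsec hx (v j)

end AdaptedChart
end HamiltonianSections

/-! ### Hamiltonian sections are the solutions of the Euler–Lagrange equations -/

section HamiltonianEquations

variable {n : ℕ} {X : Type*} [TopologicalSpace X]
  [ChartedSpace (EuclideanSpace ℝ (Fin (n + 1))) X]
  {E : Type*} [NormedAddCommGroup E] [NormedSpace ℝ E]
  {Y : Type*} [TopologicalSpace Y] [ChartedSpace E Y]
  [IsManifold (𝓡 (n + 1)) ∞ X] [IsManifold 𝓘(ℝ, E) ∞ Y]
  {q : C^∞⟮𝓘(ℝ, E), Y; 𝓡 (n + 1), X⟯}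
  {B : Type*} [NormedAddCommGroup B] [NormedSpace ℝ B]

/-- A smooth curve through `w₀` with velocity `ξ` that stays in a given neighborhood. -/
theorem exists_smooth_curve {W : Type*} [NormedAddCommGroup W] [NormedSpace ℝ W] {S : Set W}
    {w₀ : W} (hS : S ∈ 𝓝 w₀) (ξ : W) :
    ∃ κ : ℝ → W, ContDiff ℝ ∞ κ ∧ (∀ t, κ t ∈ S) ∧ κ 0 = w₀ ∧ HasDerivAt κ ξ 0 := by
  obtain ⟨r, hr, hrS⟩ := Metric.mem_nhds_iff.1 hS
  -- The curve `w₀ + δ sin(t/δ) ξ` has velocity `ξ` at `0` and stays within `δ‖ξ‖ ≤ r/2` of `w₀`; it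
  -- is defined for all times, as `tangentVectors` demands.
  set δ : ℝ := r / (2 * (‖ξ‖ + 1)) with hδ
  have hξ : 0 < ‖ξ‖ + 1 := by positivity
  have hδ0 : 0 < δ := by positivity
  refine ⟨fun t => w₀ + (δ * Real.sin (t / δ)) • ξ, ?_, ?_, by simp, ?_⟩
  · have : ContDiff ℝ ∞ fun t : ℝ => δ * Real.sin (t / δ) :=
      contDiff_const.mul (Real.contDiff_sin.comp (contDiff_id.div_const δ))
    exact contDiff_const.add (this.smul contDiff_const)
  · intro t
    refine hrS ?_
    rw [Metric.mem_ball, dist_eq_norm, add_sub_cancel_left, norm_smul, norm_mul,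
      Real.norm_eq_abs, abs_of_pos hδ0]
    have h1 : ‖Real.sin (t / δ)‖ ≤ 1 := Real.abs_sin_le_one _
    calc δ * ‖Real.sin (t / δ)‖ * ‖ξ‖ ≤ δ * 1 * (‖ξ‖ + 1) := by gcongr; linarith
      _ = r / 2 := by rw [hδ]; field_simp
      _ < r := by linarith
  · have h1 : HasDerivAt (fun t : ℝ => t / δ) (1 / δ) 0 := (hasDerivAt_id 0).div_const δ
    have h2 := (h1.sin.const_mul δ).smul_const ξ
    have h3 := h2.const_add w₀
    convert h3 using 1
    simp [mul_inv_cancel₀ hδ0.ne']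

namespace AdaptedChart

variable (c : AdaptedChart q B) {ℒ : Density q} {φ : X → Y} {x : X}

theorem hasDerivAt_mfderiv {W : Type*} [NormedAddCommGroup W] [NormedSpace ℝ W]
    {E₀ : Type*} [NormedAddCommGroup E₀] [NormedSpace ℝ E₀] {H : Type*} [TopologicalSpace H]
    {I : ModelWithCorners ℝ E₀ H} {M : Type*} [TopologicalSpace M] [ChartedSpace H M] {G : W → M}
    {κ : ℝ → W} {ξ : W} {t : ℝ} (hG : MDifferentiableAt 𝓘(ℝ, W) I G (κ t))
    (hκ : HasDerivAt κ ξ t) :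
    mfderiv 𝓘(ℝ, ℝ) I (G ∘ κ) t (1 : ℝ) = mfderiv 𝓘(ℝ, W) I G (κ t) ξ := by
  have h1 := mfderiv_comp t hG hκ.differentiableAt.mdifferentiableAt
  rw [mfderiv_eq_fderiv] at h1
  refine (DFunLike.congr_fun h1 (1 : ℝ)).trans ?_
  exact congrArg (mfderiv 𝓘(ℝ, W) I G (κ t)) (hκ.deriv)

theorem eulerLagrange_eq_zero_of_isHamiltonian (hℒ : IsSmoothDensity ℒ) (hreg : IsRegular ℒ)
    (hφ : ContMDiff (𝓡 (n + 1)) 𝓘(ℝ, E) ∞ φ) (hsec : ∀ x, q (φ x) = x)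
    (hham : IsHamiltonian ℒ (conjugateJet ℒ φ)) (hx : φ x ∈ c.chart.source) (b : B) :
    eulerLagrange (c.lagrangian ℒ) (c.localRep φ) (extChartAt (𝓡 (n + 1)) c.center x) b = 0 := by
  set a := extChartAt (𝓡 (n + 1)) c.center x with ha
  set w₀ := coordJet (c.localRep φ) a
  have hw₀ : w₀ ∈ c.jetTarget := c.coordJet_mem hsec hx
  obtain ⟨κ, hκ, hκS, hκ0, hκ'⟩ := exists_smooth_curve (c.isOpen_jetTarget.mem_nhds hw₀)
    ((0, b, 0) : JetSpace n B)
  have h0 : conjugateJet ℒ φ x = c.legendreParam ℒ w₀ :=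
    (c.conjugateJet_eventuallyEq hφ hsec hx).self_of_nhds
  have hU : (mfderiv 𝓘(ℝ, JetSpace n B) (formModel 𝓘(ℝ, E) (n + 1)) (c.legendreParam ℒ) w₀
      ((0, b, 0) : JetSpace n B) : E × (E [⋀^Fin (n + 1)]→L[ℝ] ℝ)) ∈
      -- The test vector is the image of the jet vector `(0, b, 0)`: the Legendre transformation
      -- carries a curve of jets to a curve in `P_ℒ`.
      tangentVectors (formModel 𝓘(ℝ, E) (n + 1)) (primaryConstraint ℒ) (conjugateJet ℒ φ x) := by
    refine ⟨c.legendreParam ℒ ∘ κ, fun t => ?_, fun t => ?_, ?_, ?_⟩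
    · exact (c.contMDiffAt_legendreParam hreg (hκS t)).comp t hκ.contMDiff.contMDiffAt
    · exact ⟨_, c.jetParam_mem (hκS t), rfl⟩
    · rw [h0, Function.comp_apply, hκ0]
    · have h1 := hasDerivAt_mfderiv (I := formModel 𝓘(ℝ, E) (n + 1)) (G := c.legendreParam ℒ)
        ((c.contMDiffAt_legendreParam hreg (hκS 0)).mdifferentiableAt (by simp)) hκ'
      refine h1.trans ?_
      rw [hκ0]
  have h2 := hham x _ hU fun μ => chartSymmDeriv c.center a (coordVec μ)
  have h3 := c.canonicalOmega_conjugateJet hℒ hreg hφ hsec hx ((0, b, 0) : JetSpace n B)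
    fun μ => chartSymmDeriv c.center a (coordVec μ)
  have h4 := h3.symm.trans h2
  have hxs := c.mem_source_of_section hsec hx
  have h5 : (fun μ => chartDeriv c.center x (chartSymmDeriv c.center a (coordVec μ))) =
      (coordVec : Fin (n + 1) → BaseSpace n) := by
    ext1 μ
    have := chartDeriv_chartSymmDeriv ((extChartAt (𝓡 (n + 1)) c.center).map_source hxs)
      (coordVec μ)
    rwa [(extChartAt (𝓡 (n + 1)) c.center).left_inv hxs] at this
  rw [h5, volumeForm_coordVec] at h4
  simp only [one_mul, neg_eq_zero, map_zero, sub_zero] at h4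
  exact h4

theorem canonicalOmega_eq_zero_of_eulerLagrange (hℒ : IsSmoothDensity ℒ) (hreg : IsRegular ℒ)
    (hφ : ContMDiff (𝓡 (n + 1)) 𝓘(ℝ, E) ∞ φ) (hsec : ∀ x, q (φ x) = x)
    (hx : φ x ∈ c.chart.source)
    (hEL : ∀ b, eulerLagrange (c.lagrangian ℒ) (c.localRep φ)
      (extChartAt (𝓡 (n + 1)) c.center x) b = 0)
    {U : TangentSpace (formModel 𝓘(ℝ, E) (n + 1)) (conjugateJet ℒ φ x)}
    (hU : U ∈ tangentVectors (formModel 𝓘(ℝ, E) (n + 1)) (primaryConstraint ℒ)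
      (conjugateJet ℒ φ x)) (v : Fin (n + 1) → BaseSpace n) :
    canonicalOmega 𝓘(ℝ, E) (n + 1) (conjugateJet ℒ φ x) (Fin.cons U fun i =>
      mfderiv (𝓡 (n + 1)) (formModel 𝓘(ℝ, E) (n + 1)) (conjugateJet ℒ φ) x (v i)) = 0 := by
  obtain ⟨cv, hcv, hcvP, hcv0, hcvU⟩ := hU
  obtain ⟨g, hg, hgl⟩ := hreg.2
  have hgP : ∀ t, g (cv t) ∈ jetBundle q ∧ legendre ℒ (g (cv t)) = cv t := by
    intro t
    obtain ⟨w, hw, hwt⟩ := hcvP t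
    rw [← hwt, hgl w hw]
    exact ⟨hw, rfl⟩
  -- The inverse `g` is smooth only on the subset `P_ℒ`, but the curve never leaves it, so its lift
  -- to `J¹(Y)` is smooth. Hence the tangent vector is the image of the velocity of a curve of jets.
  have hgc : ContMDiff 𝓘(ℝ, ℝ) (homModel n E) ∞ (g ∘ cv) := by
    rw [← contMDiffOn_univ]
    exact hg.comp hcv.contMDiffOn fun t _ => hcvP t
  have hjet : firstJet q φ x ∈ jetBundle q :=
    firstJet_mem_jetBundle (hφ.mdifferentiable (by simp) x) hsec
  have hg0 : g (cv 0) = firstJet q φ x := by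
    rw [hcv0]; exact hgl _ hjet
  have hs0 : ((g ∘ cv) 0).1 ∈ c.chart.source := by
    rw [Function.comp_apply, hg0]; exact hx
  set κ : ℝ → JetSpace n B := fun t => c.jetCoord (g (cv t)) with hκ
  have hκd : ContDiffAt ℝ ∞ κ 0 :=
    (c.contMDiffAt_jetCoord hgc.contMDiffAt hs0).contDiffAt
  have hκ0 : κ 0 = coordJet (c.localRep φ) (extChartAt (𝓡 (n + 1)) c.center x) := by
    simp only [hκ, hg0]
    exact c.jetCoord_firstJet hφ.contMDiffAt hsec hx
  have hev : cv =ᶠ[𝓝 0] c.legendreParam ℒ ∘ κ := by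
    have hb : Continuous fun t => (g (cv t)).1 :=
      (FiberBundle.continuous_proj _ _).comp hgc.continuous
    filter_upwards [hb.continuousAt.preimage_mem_nhds (c.chart.open_source.mem_nhds hs0)]
      with t ht
    rw [Function.comp_apply, legendreParam, hκ]
    simp only
    rw [c.jetParam_jetCoord ht (hgP t).1, (hgP t).2]
  have hmem := c.coordJet_mem hsec hx
  have h1 := hasDerivAt_mfderiv (I := formModel 𝓘(ℝ, E) (n + 1)) (G := c.legendreParam ℒ)
    (κ := κ) (t := 0)
    (by rw [hκ0]; exact (c.contMDiffAt_legendreParam hreg hmem).mdifferentiableAt (by simp))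
    (hκd.differentiableAt (by simp)).hasDerivAt
  rw [hκ0] at h1
  have h2 := c.canonicalOmega_conjugateJet hℒ hreg hφ hsec hx (_root_.deriv κ 0) v
  rw [hEL, neg_zero, mul_zero] at h2
  refine Eq.trans ?_ h2
  have h3 : (U : E × (E [⋀^Fin (n + 1)]→L[ℝ] ℝ)) =
      mfderiv 𝓘(ℝ, JetSpace n B) (formModel 𝓘(ℝ, E) (n + 1)) (c.legendreParam ℒ)
        (coordJet (c.localRep φ) (extChartAt (𝓡 (n + 1)) c.center x)) (_root_.deriv κ 0) := by
    refine hcvU.symm.trans (Eq.trans ?_ h1)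
    exact DFunLike.congr_fun (hev.mfderiv_eq (I := 𝓘(ℝ, ℝ))
      (I' := formModel 𝓘(ℝ, E) (n + 1))) (1 : ℝ)
  exact congrArg (fun U' : E × (E [⋀^Fin (n + 1)]→L[ℝ] ℝ) =>
    canonicalOmega 𝓘(ℝ, E) (n + 1) (conjugateJet ℒ φ x) (Fin.cons U' fun i =>
      mfderiv (𝓡 (n + 1)) (formModel 𝓘(ℝ, E) (n + 1)) (conjugateJet ℒ φ) x (v i))) h3

end AdaptedChart
end HamiltonianEquations

/-! ### The first variation of the action -/

section FirstVariation

variable {n : ℕ} {X : Type*} [TopologicalSpace X]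
  [ChartedSpace (EuclideanSpace ℝ (Fin (n + 1))) X]
  {E : Type*} [NormedAddCommGroup E] [NormedSpace ℝ E]
  {Y : Type*} [TopologicalSpace Y] [ChartedSpace E Y]
  [IsManifold (𝓡 (n + 1)) ∞ X] [IsManifold 𝓘(ℝ, E) ∞ Y]
  {q : C^∞⟮𝓘(ℝ, E), Y; 𝓡 (n + 1), X⟯}
  {B : Type*} [NormedAddCommGroup B] [NormedSpace ℝ B]
  {F : Type*} [TopologicalSpace F] [ChartedSpace B F] [IsManifold 𝓘(ℝ, B) ∞ F]
  {ℒ : Density q}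

/-- Around each point an adapted chart over the given base chart identifies the density with `L`
along the jet of the section. -/
theorem continuousOn_coordDensity (hq : IsSmoothFiberBundle B F q) (hℒ : IsSmoothDensity ℒ)
    {s : X → Y} (hs : ContMDiff (𝓡 (n + 1)) 𝓘(ℝ, E) ∞ s) (hsec : ∀ x, q (s x) = x) (j : X) :
    ContinuousOn (coordDensity (fun x => ℒ (firstJet q s x)) j)
      (extChartAt (𝓡 (n + 1)) j).target := by
  intro a ha
  have hxs := (extChartAt (𝓡 (n + 1)) j).map_target ha
  obtain ⟨c, rfl, hc⟩ := exists_adaptedChart hq (i := j)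
    (y := s ((extChartAt (𝓡 (n + 1)) j).symm a)) (by rw [hsec]; exact hxs)
  refine ContinuousAt.continuousWithinAt ?_
  have hmem : coordJet (c.localRep s) a ∈ c.jetTarget := by
    have := c.coordJet_mem hsec hc
    rwa [(extChartAt (𝓡 (n + 1)) c.center).right_inv ha] at this
  have h1 : ContinuousAt (fun a => c.lagrangian ℒ (coordJet (c.localRep s) a)) a :=
    ContinuousAt.comp (g := c.lagrangian ℒ)
      ((c.contDiffOn_lagrangian hℒ).contDiffAt (c.isOpen_jetTarget.mem_nhds hmem)).continuousAt
      (contDiffAt_coordJet (c.contDiffAt_localRep hs ha hc)).continuousAt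
  refine h1.congr ?_
  have h2 : ContinuousAt (fun a => s ((extChartAt (𝓡 (n + 1)) c.center).symm a)) a :=
    hs.continuous.continuousAt.comp (continuousAt_extChartAt_symm'' ha)
  filter_upwards [(isOpen_extChartAt_target c.center).mem_nhds ha,
    h2.preimage_mem_nhds (c.chart.open_source.mem_nhds hc)] with a' ha' hsa'
  exact (c.coordDensity_firstJet ℒ hs.contMDiffAt hsec ha' hsa').symm

theorem contMDiff_of_family {ε : ℝ} {Φ : ℝ → X → Y}
    (hΦ : ContMDiffOn (𝓘(ℝ, ℝ).prod (𝓡 (n + 1))) 𝓘(ℝ, E) ∞ (uncurry Φ) (Ioo (-ε) ε ×ˢ univ))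
    {t : ℝ} (ht : t ∈ Ioo (-ε) ε) : ContMDiff (𝓡 (n + 1)) 𝓘(ℝ, E) ∞ (Φ t) := by
  intro x
  have h1 := hΦ.contMDiffAt (x := (t, x))
    ((isOpen_Ioo.prod isOpen_univ).mem_nhds ⟨ht, mem_univ _⟩)
  exact ContMDiffAt.comp (I' := 𝓘(ℝ, ℝ).prod (𝓡 (n + 1))) x (f := fun x => (t, x)) h1
    (contMDiffAt_const.prodMk contMDiffAt_id)

variable [T2Space X] [SigmaCompactSpace X]

namespace AdaptedChart

variable (c : AdaptedChart q B)

/-- The open set of the points `(t, a)` with `Φ t` at `a` in the domain of the chart. -/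
def familyDomain (ε : ℝ) (Φ : ℝ → X → Y) : Set (ℝ × BaseSpace n) :=
  (Ioo (-ε) ε ×ˢ (extChartAt (𝓡 (n + 1)) c.center).target) ∩
    (fun p => Φ p.1 ((extChartAt (𝓡 (n + 1)) c.center).symm p.2)) ⁻¹' c.chart.source

variable {ε : ℝ} {Φ : ℝ → X → Y}

theorem contMDiffOn_family_symm
    (hΦ : ContMDiffOn (𝓘(ℝ, ℝ).prod (𝓡 (n + 1))) 𝓘(ℝ, E) ∞ (uncurry Φ) (Ioo (-ε) ε ×ˢ univ)) :
    ContMDiffOn 𝓘(ℝ, ℝ × BaseSpace n) 𝓘(ℝ, E) ∞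
      (fun p : ℝ × BaseSpace n => Φ p.1 ((extChartAt (𝓡 (n + 1)) c.center).symm p.2))
      (Ioo (-ε) ε ×ˢ (extChartAt (𝓡 (n + 1)) c.center).target) := by
  have h1 : ContMDiffOn 𝓘(ℝ, ℝ × BaseSpace n) (𝓘(ℝ, ℝ).prod (𝓡 (n + 1))) ∞
      (fun p : ℝ × BaseSpace n => (p.1, (extChartAt (𝓡 (n + 1)) c.center).symm p.2))
      (Ioo (-ε) ε ×ˢ (extChartAt (𝓡 (n + 1)) c.center).target) := by
    refine ContMDiffOn.prodMk contDiff_fst.contMDiff.contMDiffOn ?_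
    exact (contMDiffOn_extChartAt_symm c.center).comp contDiff_snd.contMDiff.contMDiffOn
      fun p hp => hp.2
  exact hΦ.comp h1 fun p hp => ⟨hp.1, mem_univ _⟩

theorem isOpen_familyDomain
    (hΦ : ContMDiffOn (𝓘(ℝ, ℝ).prod (𝓡 (n + 1))) 𝓘(ℝ, E) ∞ (uncurry Φ) (Ioo (-ε) ε ×ˢ univ)) :
    IsOpen (c.familyDomain ε Φ) :=
  (c.contMDiffOn_family_symm hΦ).continuousOn.isOpen_inter_preimage
    (isOpen_Ioo.prod (isOpen_extChartAt_target c.center)) c.chart.open_source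

theorem contDiffOn_localRep_family
    (hΦ : ContMDiffOn (𝓘(ℝ, ℝ).prod (𝓡 (n + 1))) 𝓘(ℝ, E) ∞ (uncurry Φ) (Ioo (-ε) ε ×ˢ univ)) :
    ContDiffOn ℝ ∞ (fun p : ℝ × BaseSpace n => c.localRep (Φ p.1) p.2) (c.familyDomain ε Φ) := by
  rw [← contMDiffOn_iff_contDiffOn]
  have h1 := c.smooth.comp ((c.contMDiffOn_family_symm hΦ).mono inter_subset_left)
    (fun p (hp : p ∈ c.familyDomain ε Φ) => hp.2)
  exact (contDiff_snd.contMDiff (n := ∞)).comp_contMDiffOn h1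

theorem coordJet_family_mem (hsec : ∀ t ∈ Ioo (-ε) ε, ∀ x, q (Φ t x) = x)
    {p : ℝ × BaseSpace n} (hp : p ∈ c.familyDomain ε Φ) :
    coordJet (fun a' => c.localRep (Φ p.1) a') p.2 ∈ c.jetTarget := by
  have := c.coordJet_mem (hsec p.1 hp.1.1) hp.2
  rwa [(extChartAt (𝓡 (n + 1)) c.center).right_inv hp.1.2] at this

/-- The derivative of the difference of the actions of two families of sections that agree off a
compact set contained in the domain of an adapted chart. -/
theorem hasDerivAt_formIntegral_sub (hX : IsOrientedAtlas n X) (hq : IsSmoothFiberBundle B F q)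
    (hℒ : IsSmoothDensity ℒ) {K C : Set X} (hK : IsCompact K) (hC : IsCompact C) (hCK : C ⊆ K)
    (hε : 0 < ε) {Φ₁ Φ₂ : ℝ → X → Y}
    (hΦ₁ : ContMDiffOn (𝓘(ℝ, ℝ).prod (𝓡 (n + 1))) 𝓘(ℝ, E) ∞ (uncurry Φ₁) (Ioo (-ε) ε ×ˢ univ))
    (hΦ₂ : ContMDiffOn (𝓘(ℝ, ℝ).prod (𝓡 (n + 1))) 𝓘(ℝ, E) ∞ (uncurry Φ₂) (Ioo (-ε) ε ×ˢ univ))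
    (hsec₁ : ∀ t ∈ Ioo (-ε) ε, ∀ x, q (Φ₁ t x) = x)
    (hsec₂ : ∀ t ∈ Ioo (-ε) ε, ∀ x, q (Φ₂ t x) = x)
    (h0 : Φ₁ 0 = Φ₂ 0) (heq : ∀ t ∈ Ioo (-ε) ε, ∀ x ∉ C, Φ₁ t x = Φ₂ t x)
    (hCc : ∀ x ∈ C, Φ₁ 0 x ∈ c.chart.source) :
    HasDerivAt (fun t => formIntegral K (fun x => ℒ (firstJet q (Φ₁ t) x)) -
        formIntegral K (fun x => ℒ (firstJet q (Φ₂ t) x)))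
      (∫ a in extChartAt (𝓡 (n + 1)) c.center '' C,
        eulerLagrange (c.lagrangian ℒ) (c.localRep (Φ₁ 0)) a
          (_root_.deriv (fun t => c.localRep (Φ₁ t) a) 0 -
            _root_.deriv (fun t => c.localRep (Φ₂ t) a) 0)) 0 := by
  have hε0 : (0 : ℝ) ∈ Ioo (-ε) ε := ⟨by linarith, hε⟩
  have hCs : C ⊆ (extChartAt (𝓡 (n + 1)) c.center).source := fun x hx =>
    c.mem_source_of_section (hsec₁ 0 hε0) (hCc x hx)
  set ext := extChartAt (𝓡 (n + 1)) c.center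
  have hĈ : IsCompact (ext '' C) :=
    hC.image_of_continuousOn ((continuousOn_extChartAt c.center).mono hCs)
  set D := c.familyDomain ε Φ₁ ∩ c.familyDomain ε Φ₂
  have hD : IsOpen D := (c.isOpen_familyDomain hΦ₁).inter (c.isOpen_familyDomain hΦ₂)
  have hCD : ∀ a ∈ ext '' C, ((0 : ℝ), a) ∈ D := by
    rintro _ ⟨x, hx, rfl⟩
    have hl : ext.symm (ext x) = x := ext.left_inv (hCs hx)
    refine ⟨⟨⟨hε0, ext.map_source (hCs hx)⟩, ?_⟩, ⟨⟨hε0, ext.map_source (hCs hx)⟩, ?_⟩⟩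
    · change Φ₁ 0 (ext.symm (ext x)) ∈ c.chart.source
      rw [hl]; exact hCc x hx
    · change Φ₂ 0 (ext.symm (ext x)) ∈ c.chart.source
      rw [hl, ← h0]; exact hCc x hx
  have main := hasDerivAt_integral_lagrangian c.isOpen_jetTarget (c.contDiffOn_lagrangian hℒ) hD hĈ
    hCD ((c.contDiffOn_localRep_family hΦ₁).mono inter_subset_left)
    ((c.contDiffOn_localRep_family hΦ₂).mono inter_subset_right)
    (fun p hp => c.coordJet_family_mem hsec₁ hp.1) (fun p hp => c.coordJet_family_mem hsec₂ hp.2)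
    (fun a _ => by simp only [h0])
    (fun p hp hpC => by
      have hp1 := hp.1.1
      have : ext.symm p.2 ∉ C := fun h => hpC ⟨_, h, ext.right_inv hp1.2⟩
      exact congrArg (fun y => (c.chart y).2) (heq p.1 hp1.1 _ this))
  refine main.congr_of_eventuallyEq ?_
  -- By compactness, for small `t` both sections stay in the adapted chart over all of `C`, so the
  -- difference of densities is the difference of Lagrangians there.
  have htube : ∀ᶠ t in 𝓝 (0 : ℝ), ∀ a ∈ ext '' C, (t, a) ∈ D :=
    hĈ.eventually_forall_of_forall_eventually fun a ha => hD.mem_nhds (hCD a ha)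
  filter_upwards [htube, isOpen_Ioo.mem_nhds hε0] with t ht htε
  have hs₁ := contMDiff_of_family hΦ₁ htε
  have hs₂ := contMDiff_of_family hΦ₂ htε
  have hc₁ := continuousOn_coordDensity hq hℒ hs₁ (hsec₁ t htε)
  have hc₂ := continuousOn_coordDensity hq hℒ hs₂ (hsec₂ t htε)
  rw [← formIntegral_sub hK hc₁ hc₂, formIntegral_eq_of_support hX (i := c.center) (C := C) ?_ hK hC hCK
    hCs ?_]
  · refine setIntegral_congr_fun hĈ.measurableSet fun a ha => ?_
    have hta := ht a ha
    refine (coordDensity_sub _ _ _ _).trans ?_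
    rw [c.coordDensity_firstJet ℒ hs₁.contMDiffAt (hsec₁ t htε) hta.1.1.2 hta.1.2,
      c.coordDensity_firstJet ℒ hs₂.contMDiffAt (hsec₂ t htε) hta.2.1.2 hta.2.2]
  · exact ((hc₁ c.center).sub (hc₂ c.center)).congr fun a _ => coordDensity_sub _ _ _ _
  · intro x hx
    -- The complement of `C` is open, so the sections agree near `x` and not only at `x`; their
    -- first jets agree too.
    have hev : Φ₁ t =ᶠ[𝓝 x] Φ₂ t := by
      filter_upwards [hC.isClosed.isOpen_compl.mem_nhds hx] with x' hx'
      exact heq t htε x' hx'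
    have : firstJet q (Φ₁ t) x = firstJet q (Φ₂ t) x := by
      have h1 := hev.self_of_nhds
      have h2 := hev.mfderiv_eq (I := 𝓡 (n + 1)) (I' := 𝓘(ℝ, E))
      change HomBundle.mk q (Φ₁ t x) (mfderiv (𝓡 (n + 1)) 𝓘(ℝ, E) (Φ₁ t) x) =
        HomBundle.mk q (Φ₂ t x) (mfderiv (𝓡 (n + 1)) 𝓘(ℝ, E) (Φ₂ t) x)
      exact congr (congrArg (HomBundle.mk q) h1) h2
    change ℒ.form (firstJet q (Φ₁ t) x) - ℒ.form (firstJet q (Φ₂ t) x) = 0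
    rw [this, sub_self]

end AdaptedChart
end FirstVariation

/-! ### Solutions of the Euler–Lagrange equations are stationary -/

section Stationary

variable {n : ℕ} {X : Type*} [TopologicalSpace X] [T2Space X]
  [ChartedSpace (EuclideanSpace ℝ (Fin (n + 1))) X]
  {E : Type*} [NormedAddCommGroup E] [NormedSpace ℝ E]
  {Y : Type*} [TopologicalSpace Y] [ChartedSpace E Y]
  [IsManifold (𝓡 (n + 1)) ∞ X] [IsManifold 𝓘(ℝ, E) ∞ Y]
  {q : C^∞⟮𝓘(ℝ, E), Y; 𝓡 (n + 1), X⟯}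

/-- Since `V` is vertical, the projected curve is an integral curve of the zero field, and
uniqueness of integral curves makes it constant. -/
theorem IsVariation.proj_eq {K : Set X} {V : ∀ y : Y, TangentSpace 𝓘(ℝ, E) y}
    (hV : IsVerticalField q K V) {φ : X → Y} (hsec : ∀ x, q (φ x) = x) {ε : ℝ} {Φ : ℝ → X → Y}
    (h : IsVariation (n := n) V φ ε Φ) {t : ℝ} (ht : t ∈ Ioo (-ε) ε) (x : X) :
    q (Φ t x) = x := by
  have : IsManifold (𝓡 (n + 1)) 1 X := IsManifold.of_le (n := ∞) (by simp)
  have h1 : IsMIntegralCurveOn (I := 𝓡 (n + 1)) (fun t => q (Φ t x))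
      (fun x : X => (0 : TangentSpace (𝓡 (n + 1)) x)) (Ioo (-ε) ε) := by
    intro s hs
    have hq : HasMFDerivAt 𝓘(ℝ, E) (𝓡 (n + 1)) q (Φ s x)
        (mfderiv 𝓘(ℝ, E) (𝓡 (n + 1)) q (Φ s x)) :=
      (q.contMDiff.mdifferentiableAt (by simp)).hasMFDerivAt
    have h2 := hq.comp_hasMFDerivWithinAt s (h.integralCurve x s hs)
    refine h2.congr_mfderiv ?_
    have hv : ∀ v : E, projDeriv q (Φ s x) v = 0 →
        projDeriv q (Φ s x) ((1 : ℝ) • v) = (1 : ℝ) • (0 : BaseSpace n) := fun v hv => by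
      rw [map_smul, hv]
    ext
    exact hv _ (hV.vertical (Φ s x))
  have h2 : IsMIntegralCurveOn (I := 𝓡 (n + 1)) (fun _ => x)
      (fun x : X => (0 : TangentSpace (𝓡 (n + 1)) x)) (Ioo (-ε) ε) := by
    intro s hs
    refine (hasMFDerivWithinAt_const _ _ _).congr_mfderiv ?_
    ext
    exact (smul_zero (1 : ℝ) (A := BaseSpace n)).symm
  have hz : ContMDiff (𝓡 (n + 1)) (𝓡 (n + 1)).tangent 1
      (fun x : X => (⟨x, 0⟩ : TangentBundle (𝓡 (n + 1)) X)) :=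
    contMDiff_zeroSection ℝ (TangentSpace (𝓡 (n + 1)) : X → Type _)
  have h0 : (0 : ℝ) ∈ Ioo (-ε) ε := ⟨by linarith [h.pos], h.pos⟩
  exact isMIntegralCurveOn_Ioo_eqOn_of_contMDiff_boundaryless h0 hz h1 h2
    (by simp only [h.start]; exact hsec x) ht

/-- `V` vanishes at `φ x`, so the constant curve is also an integral curve with the same start. -/
theorem IsVariation.eq_of_notMem [T2Space Y] [CompleteSpace E] {K : Set X}
    {V : ∀ y : Y, TangentSpace 𝓘(ℝ, E) y}
    (hV : IsVerticalField q K V) {φ : X → Y} (hsec : ∀ x, q (φ x) = x) {ε : ℝ} {Φ : ℝ → X → Y}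
    (h : IsVariation (n := n) V φ ε Φ) {t : ℝ} (ht : t ∈ Ioo (-ε) ε) {x : X} (hx : x ∉ K) :
    Φ t x = φ x := by
  have : IsManifold 𝓘(ℝ, E) 1 Y := IsManifold.of_le (n := ∞) (by simp)
  have h2 : IsMIntegralCurveOn (I := 𝓘(ℝ, E)) (fun _ => φ x) V (Ioo (-ε) ε) := by
    intro s hs
    refine (hasMFDerivWithinAt_const _ _ _).congr_mfderiv ?_
    rw [hV.eq_zero (φ x) (by rwa [hsec])]
    ext
    exact (smul_zero (1 : ℝ) (A := E)).symm
  have h0 : (0 : ℝ) ∈ Ioo (-ε) ε := ⟨by linarith [h.pos], h.pos⟩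
  exact isMIntegralCurveOn_Ioo_eqOn_of_contMDiff_boundaryless h0 (hV.smooth.of_le (by simp))
    (h.integralCurve x) h2 (by simp only [h.start]) ht

variable [SigmaCompactSpace X] {B : Type*} [NormedAddCommGroup B] [NormedSpace ℝ B]
  {F : Type*} [TopologicalSpace F] [ChartedSpace B F] [IsManifold 𝓘(ℝ, B) ∞ F]
  {ℒ : Density q} {φ : X → Y}

theorem contMDiffOn_reparametrized {ε : ℝ} {Φ : ℝ → X → Y}
    (hΦ : ContMDiffOn (𝓘(ℝ, ℝ).prod (𝓡 (n + 1))) 𝓘(ℝ, E) ∞ (uncurry Φ) (Ioo (-ε) ε ×ˢ univ))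
    {σ : X → ℝ} (hσ : ContMDiff (𝓡 (n + 1)) 𝓘(ℝ, ℝ) ∞ σ)
    (hσε : ∀ t ∈ Ioo (-ε) ε, ∀ x, t * σ x ∈ Ioo (-ε) ε) :
    ContMDiffOn (𝓘(ℝ, ℝ).prod (𝓡 (n + 1))) 𝓘(ℝ, E) ∞ (uncurry fun t x => Φ (t * σ x) x)
      (Ioo (-ε) ε ×ˢ univ) := by
  have h1 : ContMDiff (𝓘(ℝ, ℝ).prod (𝓡 (n + 1))) (𝓘(ℝ, ℝ).prod (𝓡 (n + 1))) ∞
      (fun p : ℝ × X => (p.1 * σ p.2, p.2)) :=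
    (contMDiff_fst.mul (hσ.comp contMDiff_snd)).prodMk contMDiff_snd
  exact hΦ.comp h1.contMDiffOn fun p hp => ⟨hσε p.1 hp.1 p.2, mem_univ _⟩

/-- The intermediate families of the telescoping argument are not flows of vector fields; this is
harmless, as `hasDerivAt_formIntegral_sub` accepts arbitrary smooth families of sections. -/
theorem isStationary_of_eulerLagrange [T2Space Y] [CompleteSpace E] (hX : IsOrientedAtlas n X)
    (hq : IsSmoothFiberBundle B F q) (hℒ : IsSmoothDensity ℒ)
    (hφ : ContMDiff (𝓡 (n + 1)) 𝓘(ℝ, E) ∞ φ) (hsec : ∀ x, q (φ x) = x)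
    (hEL : ∀ (c : AdaptedChart q B) (x : X), φ x ∈ c.chart.source → ∀ b,
      eulerLagrange (c.lagrangian ℒ) (c.localRep φ) (extChartAt (𝓡 (n + 1)) c.center x) b = 0) :
    IsStationary ℒ φ := by
  classical
  intro K hK V hV ε Φ hΦ
  have hε := hΦ.pos
  have hproj := fun t (ht : t ∈ Ioo (-ε) ε) x => hΦ.proj_eq hV hsec ht x
  have hoff := fun t (ht : t ∈ Ioo (-ε) ε) x (hx : x ∉ K) => hΦ.eq_of_notMem hV hsec ht hx
  have hch : ∀ x : X, ∃ c : AdaptedChart q B, φ x ∈ c.chart.source := fun x => by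
    obtain ⟨c, -, hc⟩ := exists_adaptedChart hq (i := q (φ x)) (y := φ x) (mem_extChartAt_source _)
    exact ⟨c, hc⟩
  choose c hc using hch
  obtain ⟨ρ, hρ⟩ := SmoothPartitionOfUnity.exists_isSubordinate (𝓡 (n + 1)) (s := univ)
    isClosed_univ (fun x : X => φ ⁻¹' (c x).chart.source)
    (fun x => (c x).chart.open_source.preimage hφ.continuous)
    (fun x _ => mem_iUnion.2 ⟨x, hc x⟩)
  have hfin := ρ.locallyFinite.finite_nonempty_inter_compact hK
  set S₀ : Finset X := hfin.toFinset
  have hS₀ : ∀ x ∈ K, ∑ i ∈ S₀, ρ i x = 1 := by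
    intro x hx
    rw [← ρ.sum_eq_one (mem_univ x), finsum_eq_sum_of_support_subset]
    intro i hi
    simp only [S₀, Finite.coe_toFinset]
    exact ⟨x, hi, hx⟩
  have hσ01 : ∀ (S : Finset X) (x : X), ∑ i ∈ S, ρ i x ∈ Icc (0 : ℝ) 1 := by
    intro S x
    refine ⟨Finset.sum_nonneg fun i _ => ρ.nonneg i x, ?_⟩
    refine le_trans ?_ (ρ.sum_le_one x)
    have hf : (support fun i => ρ i x).Finite := ρ.locallyFinite.point_finite x
    rw [finsum_eq_sum_of_support_subset (s := hf.toFinset ∪ S) _ (by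
      intro i hi; simp only [Finset.coe_union, Finite.coe_toFinset]; exact Or.inl hi)]
    exact Finset.sum_le_sum_of_subset_of_nonneg Finset.subset_union_right
      fun i _ _ => ρ.nonneg i x
  have hσsm : ∀ S : Finset X, ContMDiff (𝓡 (n + 1)) 𝓘(ℝ, ℝ) ∞ fun x => ∑ i ∈ S, ρ i x :=
    fun S => ContMDiff.sum fun i _ => (ρ i).contMDiff
  -- Partial sums of the partition lie in `[0, 1]`, so the slowed-down time stays in the interval
  -- where `Φ` is defined.
  have hσε : ∀ (S : Finset X), ∀ t ∈ Ioo (-ε) ε, ∀ x, t * ∑ i ∈ S, ρ i x ∈ Ioo (-ε) ε := by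
    intro S t ht x
    have h := hσ01 S x
    rw [mem_Ioo, ← abs_lt] at ht ⊢
    rw [abs_mul, abs_of_nonneg h.1]
    calc |t| * ∑ i ∈ S, ρ i x ≤ |t| * 1 := by gcongr; exact h.2
      _ < ε := by rwa [mul_one]
  have hε0 : (0 : ℝ) ∈ Ioo (-ε) ε := ⟨by linarith, hε⟩
  have key : ∀ S : Finset X, HasDerivAt (fun t => formIntegral K
      (fun x => ℒ (firstJet q (fun x => Φ (t * ∑ i ∈ S, ρ i x) x) x))) 0 0 := by
    intro S
    induction S using Finset.induction_on with
    | empty =>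
      refine (hasDerivAt_const (0 : ℝ) (formIntegral K fun x => ℒ (firstJet q (Φ 0) x)))
        |>.congr_of_eventuallyEq (Filter.Eventually.of_forall fun t => ?_)
      have : (fun x => Φ (t * ∑ i ∈ ∅, ρ i x) x) = Φ 0 := by
        ext x
        simp
      exact congrArg (fun s : X → Y => formIntegral K fun x => ℒ (firstJet q s x)) this
    | insert j S hj ih =>
      -- Adding `j` changes the family only here: off `tsupport (ρ j)` the times agree, and off `K`
      -- every `Φ t` equals `φ`. At time `0` all families equal `φ`, so `hEL` applies.
      have hC : IsCompact (K ∩ tsupport (ρ j)) := hK.inter_right (isClosed_tsupport _)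
      have hD := (c j).hasDerivAt_formIntegral_sub hX hq hℒ hK hC inter_subset_left hε
        (Φ₁ := fun t x => Φ (t * ∑ i ∈ insert j S, ρ i x) x)
        (Φ₂ := fun t x => Φ (t * ∑ i ∈ S, ρ i x) x)
        (contMDiffOn_reparametrized hΦ.smooth (hσsm _) (hσε _))
        (contMDiffOn_reparametrized hΦ.smooth (hσsm _) (hσε _))
        (fun t ht x => hproj _ (hσε _ t ht x) x) (fun t ht x => hproj _ (hσε _ t ht x) x)
        (by simp only [zero_mul]) (fun t ht x hx => by
          by_cases hxK : x ∈ K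
          · have h0 : ρ j x = 0 := image_eq_zero_of_notMem_tsupport fun h => hx ⟨hxK, h⟩
            simp only [Finset.sum_insert hj, h0, zero_add]
          · rw [hoff _ (hσε _ t ht x) x hxK, hoff _ (hσε _ t ht x) x hxK])
        (fun x hx => by
          simp only [zero_mul, hΦ.start]
          exact hρ j hx.2)
      have hintg : (∫ a in extChartAt (𝓡 (n + 1)) (c j).center '' (K ∩ tsupport (ρ j)),
          eulerLagrange ((c j).lagrangian ℒ)
            ((c j).localRep fun x => Φ (0 * ∑ i ∈ insert j S, ρ i x) x) a
          (deriv (fun t => (c j).localRep (fun x => Φ (t * ∑ i ∈ insert j S, ρ i x) x) a) 0 -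
            deriv (fun t => (c j).localRep (fun x => Φ (t * ∑ i ∈ S, ρ i x) x) a) 0)) = 0 := by
        refine setIntegral_eq_zero_of_forall_eq_zero ?_
        rintro _ ⟨x, hx, rfl⟩
        simp only [zero_mul, hΦ.start]
        exact hEL (c j) x (hρ j hx.2) _
      rw [hintg] at hD
      have := hD.add ih
      simp only [add_zero] at this
      refine this.congr_of_eventuallyEq (Filter.Eventually.of_forall fun t => ?_)
      simp
  refine (key S₀).congr_of_eventuallyEq ?_
  filter_upwards [isOpen_Ioo.mem_nhds hε0] with t ht
  have : Φ t = fun x => Φ (t * ∑ i ∈ S₀, ρ i x) x := by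
    ext x
    by_cases hxK : x ∈ K
    · rw [hS₀ x hxK, mul_one]
    · rw [hoff t ht x hxK, hoff _ (hσε _ t ht x) x hxK]
  exact congrArg (fun s : X → Y => formIntegral K fun x => ℒ (firstJet q s x)) this

end Stationary

/-! ### Stationary sections solve the Euler–Lagrange equations -/

section EulerLagrange

variable {n : ℕ} {X : Type*} [TopologicalSpace X] [T2Space X]
  [ChartedSpace (EuclideanSpace ℝ (Fin (n + 1))) X]
  {E : Type*} [NormedAddCommGroup E] [NormedSpace ℝ E]
  {Y : Type*} [TopologicalSpace Y] [T2Space Y] [ChartedSpace E Y]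
  [IsManifold (𝓡 (n + 1)) ∞ X] [IsManifold 𝓘(ℝ, E) ∞ Y]
  {q : C^∞⟮𝓘(ℝ, E), Y; 𝓡 (n + 1), X⟯}
  {B : Type*} [NormedAddCommGroup B] [NormedSpace ℝ B]

theorem contMDiffAt_vectorField_iff {V : Y → E} {y₀ : Y} :
    ContMDiffAt 𝓘(ℝ, E) 𝓘(ℝ, E).tangent ∞
      (fun y => (⟨y, V y⟩ : TangentBundle 𝓘(ℝ, E) Y)) y₀ ↔
    ContMDiffAt 𝓘(ℝ, E) 𝓘(ℝ, E) ∞ (fun y => chartDeriv y₀ y (V y)) y₀ := by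
  refine (contMDiffAt_section (E := (TangentSpace 𝓘(ℝ, E) : Y → Type _)) (s := V) y₀).trans
    (Filter.EventuallyEq.contMDiffAt_iff ?_)
  filter_upwards [extChartAt_source_mem_nhds (I := 𝓘(ℝ, E)) y₀] with y hy
  refine Eq.trans ?_ (continuousLinearMapAt_eq_chartDeriv hy (V y))
  have hbase : y ∈ (trivializationAt E (TangentSpace 𝓘(ℝ, E) : Y → Type _) y₀).baseSet := by
    rwa [extChartAt_source] at hy
  rw [Trivialization.continuousLinearMapAt_apply, Trivialization.coe_linearMapAt_of_mem _ hbase]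

namespace AdaptedChart

variable (c : AdaptedChart q B)

open Classical in
/-- The vertical vector field with coordinate expression `ψ b`. -/
def verticalField (ψ : BaseSpace n × B → ℝ) (b : B) (y : Y) : E :=
  if y ∈ c.chart.source then ψ (c.chart y) • c.symmDeriv (c.chart y) (0, b) else 0

variable {c} {ψ : BaseSpace n × B → ℝ} {b : B}

theorem verticalField_of_mem {y : Y} (hy : y ∈ c.chart.source) :
    c.verticalField ψ b y = ψ (c.chart y) • c.symmDeriv (c.chart y) (0, b) := if_pos hy

theorem verticalField_eq_zero {y : Y} (hy : y ∈ c.chart.source → ψ (c.chart y) = 0) :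
    c.verticalField ψ b y = 0 := by
  by_cases h : y ∈ c.chart.source
  · rw [verticalField_of_mem h, hy h, zero_smul]
  · exact if_neg h

/-- The support of `ψ` lies in a compact subset of the chart's target, whose preimage is compact and
hence closed in the Hausdorff space `Y`; extension by zero is therefore smooth. -/
theorem isVerticalField_verticalField (hψ : ContDiff ℝ ∞ ψ) {L : Set (BaseSpace n × B)}
    (hL : IsCompact L) (hLt : L ⊆ c.chart.target) (hψL : ∀ p ∉ L, ψ p = 0) {K : Set X}
    (hK : ∀ y ∈ c.chart.source, q y ∉ K → ψ (c.chart y) = 0) :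
    IsVerticalField q K (c.verticalField ψ b) where
  smooth := by
    intro y₀
    refine contMDiffAt_vectorField_iff.2 ?_
    by_cases hy₀ : y₀ ∈ c.chart.source
    · have hp₀ := c.chart.map_source hy₀
      have h1 := ContMDiffAt.comp y₀ (f := c.chart) (c.contMDiffAt_symmDeriv hp₀)
        (c.contMDiffAt hy₀)
      rw [c.chart.left_inv hy₀] at h1
      have h2 : ContMDiffAt 𝓘(ℝ, E) 𝓘(ℝ, ℝ) ∞ (fun y => ψ (c.chart y)) y₀ :=
        ContMDiffAt.comp y₀ (g := ψ) hψ.contMDiff.contMDiffAt (c.contMDiffAt hy₀)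
      have h3 := h2.smul (h1.clm_apply (contMDiffAt_const (c := ((0, b) : BaseSpace n × B))))
      refine h3.congr_of_eventuallyEq ?_
      filter_upwards [c.chart.open_source.mem_nhds hy₀] with y hys
      rw [verticalField_of_mem hys, map_smul]
      change _ = ψ (c.chart y) • chartDeriv y₀ (c.chart.symm (c.chart y))
        (c.symmDeriv (c.chart y) (0, b))
      rw [c.chart.left_inv hys]
    · have hcl : IsClosed (c.chart.symm '' L) :=
        (hL.image_of_continuousOn (c.chart.continuousOn_symm.mono hLt)).isClosed
      have hy₀' : y₀ ∉ c.chart.symm '' L := by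
        rintro ⟨p, hp, rfl⟩
        exact hy₀ (c.chart.map_target (hLt hp))
      refine (contMDiffAt_const (c := (0 : E))).congr_of_eventuallyEq ?_
      filter_upwards [hcl.isOpen_compl.mem_nhds hy₀'] with y hy
      rw [verticalField_eq_zero fun hys => hψL _ fun hL' => hy ⟨_, hL', c.chart.left_inv hys⟩,
        map_zero]
  vertical := by
    intro y
    change projDeriv q y (c.verticalField ψ b y) = 0
    by_cases hy : y ∈ c.chart.source
    · rw [verticalField_of_mem hy, map_smul]
      have := c.projDeriv_symmDeriv (c.chart.map_source hy) (0, b)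
      rw [c.chart.left_inv hy] at this
      rw [this]
      simp
    · rw [verticalField_eq_zero fun h => absurd h hy, map_zero]
  eq_zero := by
    intro y hy
    exact verticalField_eq_zero (E := E) fun hys => hK y hys hy

variable (c) in
/-- The section `φ + t χ b` in the coordinates of an adapted chart, over the support of `χ`. -/
def shift (φ : X → Y) (χ : BaseSpace n → ℝ) (b : B) (t : ℝ) (x : X) : Y :=
  open Classical in
  if x ∈ (extChartAt (𝓡 (n + 1)) c.center).symm '' tsupport χ then
    c.chart.symm (extChartAt (𝓡 (n + 1)) c.center x,
      c.localRep φ (extChartAt (𝓡 (n + 1)) c.center x) +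
        (t * χ (extChartAt (𝓡 (n + 1)) c.center x)) • b)
  else φ x

variable {φ : X → Y} {χ : BaseSpace n → ℝ}

theorem chart_section_eq (hsec : ∀ x, q (φ x) = x) {x : X} (hx : φ x ∈ c.chart.source) :
    (extChartAt (𝓡 (n + 1)) c.center x, c.localRep φ (extChartAt (𝓡 (n + 1)) c.center x)) =
      c.chart (φ x) := by
  have hxs := c.mem_source_of_section hsec hx
  refine Prod.ext ?_ ?_
  · rw [c.fst_eq _ hx, hsec]
  · rw [localRep, (extChartAt (𝓡 (n + 1)) c.center).left_inv hxs]

theorem shift_of_notMem {t : ℝ} {x : X}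
    (hx : x ∉ (extChartAt (𝓡 (n + 1)) c.center).symm '' tsupport χ) :
    c.shift φ χ b t x = φ x := if_neg hx

/-- The coordinate formula holds wherever `φ` lies in the chart, since `χ` vanishes off its support.
On this open set smoothness can be checked. -/
theorem shift_of_mem_source (hsec : ∀ x, q (φ x) = x) (t : ℝ) {x : X}
    (hx : φ x ∈ c.chart.source) :
    c.shift φ χ b t x = c.chart.symm (extChartAt (𝓡 (n + 1)) c.center x,
      c.localRep φ (extChartAt (𝓡 (n + 1)) c.center x) +
        (t * χ (extChartAt (𝓡 (n + 1)) c.center x)) • b) := by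
  by_cases h : x ∈ (extChartAt (𝓡 (n + 1)) c.center).symm '' tsupport χ
  · exact if_pos h
  · have hxs := c.mem_source_of_section hsec hx
    have h0 : χ (extChartAt (𝓡 (n + 1)) c.center x) = 0 :=
      image_eq_zero_of_notMem_tsupport fun h' =>
        h ⟨_, h', (extChartAt (𝓡 (n + 1)) c.center).left_inv hxs⟩
    rw [shift_of_notMem h, h0, mul_zero, zero_smul, add_zero, chart_section_eq hsec hx,
      c.chart.left_inv hx]

end AdaptedChart
end EulerLagrange

/-! ### Variations of a section in a coordinate direction -/

section StationarySections

variable {n : ℕ} {X : Type*} [TopologicalSpace X] [T2Space X]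
  [ChartedSpace (EuclideanSpace ℝ (Fin (n + 1))) X]
  {E : Type*} [NormedAddCommGroup E] [NormedSpace ℝ E]
  {Y : Type*} [TopologicalSpace Y] [T2Space Y] [ChartedSpace E Y]
  [IsManifold (𝓡 (n + 1)) ∞ X] [IsManifold 𝓘(ℝ, E) ∞ Y]
  {q : C^∞⟮𝓘(ℝ, E), Y; 𝓡 (n + 1), X⟯}
  {B : Type*} [NormedAddCommGroup B] [NormedSpace ℝ B]

theorem contDiffOn_fderiv_coordJet {L : JetSpace n B → ℝ} {S : Set (JetSpace n B)} (hS : IsOpen S)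
    (hL : ContDiffOn ℝ ∞ L S) {f : BaseSpace n → B} {D : Set (BaseSpace n)}
    (hf : ∀ a ∈ D, ContDiffAt ℝ ∞ f a) (hfS : ∀ a ∈ D, coordJet f a ∈ S) :
    ContDiffOn ℝ ∞ (fun a => fderiv ℝ L (coordJet f a)) D := fun a ha =>
  (ContDiffAt.comp a (((hL.contDiffAt (hS.mem_nhds (hfS a ha))).fderiv_right (by simp)))
    (contDiffAt_coordJet (hf a ha))).contDiffWithinAt

theorem continuousOn_eulerLagrange {L : JetSpace n B → ℝ} {S : Set (JetSpace n B)} (hS : IsOpen S)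
    (hL : ContDiffOn ℝ ∞ L S) {f : BaseSpace n → B} {D : Set (BaseSpace n)} (hD : IsOpen D)
    (hf : ∀ a ∈ D, ContDiffAt ℝ ∞ f a) (hfS : ∀ a ∈ D, coordJet f a ∈ S) (b : B) :
    ContinuousOn (fun a => eulerLagrange L f a b) D := by
  have h1 := contDiffOn_fderiv_coordJet hS hL hf hfS
  refine (h1.clm_apply contDiffOn_const).continuousOn.sub
    (continuousOn_finsetSum _ fun μ _ => ?_)
  have h2 : ContDiffOn ℝ ∞ (fun a' => fderiv ℝ L (coordJet f a') (velocity μ b)) D :=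
    h1.clm_apply contDiffOn_const
  exact ((h2.fderiv_of_isOpen hD (m := ∞) (by simp)).clm_apply contDiffOn_const).continuousOn

namespace AdaptedChart

variable {c : AdaptedChart q B} {φ : X → Y} {χ : BaseSpace n → ℝ} {b : B}

variable (c) in
/-- The domain of the coordinate expression of a section. -/
def sectionDomain (φ : X → Y) : Set (BaseSpace n) :=
  (extChartAt (𝓡 (n + 1)) c.center).target ∩
    (fun a => φ ((extChartAt (𝓡 (n + 1)) c.center).symm a)) ⁻¹' c.chart.source

theorem isOpen_sectionDomain (hφ : Continuous φ) : IsOpen (c.sectionDomain φ) :=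
  (hφ.comp_continuousOn (continuousOn_extChartAt_symm c.center)).isOpen_inter_preimage
    (isOpen_extChartAt_target c.center) c.chart.open_source

theorem coordJet_mem_of_mem_sectionDomain (hsec : ∀ x, q (φ x) = x) {a : BaseSpace n}
    (ha : a ∈ c.sectionDomain φ) : coordJet (c.localRep φ) a ∈ c.jetTarget := by
  have := c.coordJet_mem hsec ha.2
  rwa [(extChartAt (𝓡 (n + 1)) c.center).right_inv ha.1] at this

theorem shift_zero (hsec : ∀ x, q (φ x) = x)
    (hχφ : tsupport χ ⊆ c.sectionDomain φ) : c.shift φ χ b 0 = φ := by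
  ext x
  by_cases h : x ∈ (extChartAt (𝓡 (n + 1)) c.center).symm '' tsupport χ
  · obtain ⟨a, ha, rfl⟩ := h
    rw [shift_of_mem_source hsec 0 (hχφ ha).2, zero_mul, zero_smul, add_zero,
      chart_section_eq hsec (hχφ ha).2, c.chart.left_inv (hχφ ha).2]
  · exact shift_of_notMem h

theorem shift_apply_symm (hsec : ∀ x, q (φ x) = x) (t : ℝ) {a : BaseSpace n}
    (ha : a ∈ c.sectionDomain φ) :
    c.shift φ χ b t ((extChartAt (𝓡 (n + 1)) c.center).symm a) =
      c.chart.symm (a, c.localRep φ a + (t * χ a) • b) := by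
  rw [shift_of_mem_source hsec t ha.2, (extChartAt (𝓡 (n + 1)) c.center).right_inv ha.1]

theorem contMDiffOn_shift (hφ : ContMDiff (𝓡 (n + 1)) 𝓘(ℝ, E) ∞ φ) (hsec : ∀ x, q (φ x) = x)
    (hχ : ContDiff ℝ ∞ χ) (hχc : HasCompactSupport χ) (hχφ : tsupport χ ⊆ c.sectionDomain φ)
    {ε : ℝ} (hε : ∀ t ∈ Ioo (-ε) ε, ∀ a ∈ tsupport χ,
      (a, c.localRep φ a + (t * χ a) • b) ∈ c.chart.target) :
    ContMDiffOn (𝓘(ℝ, ℝ).prod (𝓡 (n + 1))) 𝓘(ℝ, E) ∞ (uncurry (c.shift φ χ b))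
      (Ioo (-ε) ε ×ˢ univ) := by
  rintro ⟨t, x⟩ ⟨ht, -⟩
  refine ContMDiffAt.contMDiffWithinAt ?_
  by_cases h : x ∈ (extChartAt (𝓡 (n + 1)) c.center).symm '' tsupport χ
  · obtain ⟨a, ha, rfl⟩ := h
    set x := (extChartAt (𝓡 (n + 1)) c.center).symm a
    have hxa : extChartAt (𝓡 (n + 1)) c.center x = a :=
      (extChartAt (𝓡 (n + 1)) c.center).right_inv (hχφ ha).1
    have hxs : x ∈ (chartAt (BaseSpace n) c.center).source := by
      have := (extChartAt (𝓡 (n + 1)) c.center).map_target (hχφ ha).1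
      rwa [extChartAt_source] at this
    have h1 : ContMDiffAt (𝓘(ℝ, ℝ).prod (𝓡 (n + 1))) 𝓘(ℝ, BaseSpace n) ∞
        (fun p : ℝ × X => extChartAt (𝓡 (n + 1)) c.center p.2) (t, x) :=
      ContMDiffAt.comp (t, x) (g := extChartAt (𝓡 (n + 1)) c.center)
        (contMDiffAt_extChartAt' hxs) contMDiffAt_snd
    have hf : ContDiffAt ℝ ∞ (c.localRep φ) (extChartAt (𝓡 (n + 1)) c.center x) := by
      rw [hxa]; exact c.contDiffAt_localRep hφ (hχφ ha).1 (hχφ ha).2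
    have h2 : ContMDiffAt (𝓘(ℝ, ℝ).prod (𝓡 (n + 1))) 𝓘(ℝ, B) ∞
        (fun p : ℝ × X => c.localRep φ (extChartAt (𝓡 (n + 1)) c.center p.2)) (t, x) :=
      ContMDiffAt.comp (t, x) (g := c.localRep φ) hf.contMDiffAt h1
    have h3 : ContMDiffAt (𝓘(ℝ, ℝ).prod (𝓡 (n + 1))) 𝓘(ℝ, ℝ) ∞
        (fun p : ℝ × X => χ (extChartAt (𝓡 (n + 1)) c.center p.2)) (t, x) :=
      ContMDiffAt.comp (t, x) (g := χ) hχ.contMDiff.contMDiffAt h1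
    have h4 : ContMDiffAt (𝓘(ℝ, ℝ).prod (𝓡 (n + 1))) 𝓘(ℝ, BaseSpace n × B) ∞
        (fun p : ℝ × X => (extChartAt (𝓡 (n + 1)) c.center p.2,
          c.localRep φ (extChartAt (𝓡 (n + 1)) c.center p.2) +
            (p.1 * χ (extChartAt (𝓡 (n + 1)) c.center p.2)) • b)) (t, x) :=
      h1.prodMk_space (h2.add ((contMDiffAt_fst.mul h3).smul contMDiffAt_const))
    have h5 : ContMDiffAt (𝓘(ℝ, ℝ).prod (𝓡 (n + 1))) 𝓘(ℝ, E) ∞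
        (fun p : ℝ × X => c.chart.symm (extChartAt (𝓡 (n + 1)) c.center p.2,
          c.localRep φ (extChartAt (𝓡 (n + 1)) c.center p.2) +
            (p.1 * χ (extChartAt (𝓡 (n + 1)) c.center p.2)) • b)) (t, x) := by
      refine ContMDiffAt.comp (t, x) (g := c.chart.symm) (c.contMDiffAt_symm ?_) h4
      simp only [hxa]
      exact hε t ht a ha
    refine h5.congr_of_eventuallyEq ?_
    have hcont : ContinuousAt (fun p : ℝ × X => φ p.2) (t, x) :=
      (hφ.continuous.comp continuous_snd).continuousAt
    filter_upwards [hcont.preimage_mem_nhds (c.chart.open_source.mem_nhds (hχφ ha).2)] with p hp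
    exact shift_of_mem_source hsec p.1 hp
  · have hK : IsClosed ((extChartAt (𝓡 (n + 1)) c.center).symm '' tsupport χ) :=
      (hχc.isCompact.image_of_continuousOn ((continuousOn_extChartAt_symm c.center).mono
        fun a ha => (hχφ ha).1)).isClosed
    have h1 : ContMDiffAt (𝓘(ℝ, ℝ).prod (𝓡 (n + 1))) 𝓘(ℝ, E) ∞
        (fun p : ℝ × X => φ p.2) (t, x) := (hφ.comp contMDiff_snd).contMDiffAt
    refine h1.congr_of_eventuallyEq ?_
    filter_upwards [continuous_snd.continuousAt.preimage_mem_nhds (hK.isOpen_compl.mem_nhds h)]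
      with p hp
    exact shift_of_notMem hp

/-- In coordinates the curve is the straight line with velocity `χ a • b`. The field has the same
value along it because `χ` depends only on the base point and the fiber cut-off `θ` equals `1` on
the line. -/
theorem isVariation_shift (hφ : ContMDiff (𝓡 (n + 1)) 𝓘(ℝ, E) ∞ φ) (hsec : ∀ x, q (φ x) = x)
    (hχ : ContDiff ℝ ∞ χ) (hχc : HasCompactSupport χ) (hχφ : tsupport χ ⊆ c.sectionDomain φ)
    {θ : BaseSpace n × B → ℝ} {ε : ℝ} (hε0 : 0 < ε)
    (hε : ∀ t ∈ Ioo (-ε) ε, ∀ a ∈ tsupport χ,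
      (a, c.localRep φ a + (t * χ a) • b) ∈ c.chart.target ∧
        θ (a, c.localRep φ a + (t * χ a) • b) = 1) :
    IsVariation (n := n) (c.verticalField (fun p => χ p.1 * θ p) b) φ ε (c.shift φ χ b) where
  pos := hε0
  smooth := contMDiffOn_shift hφ hsec hχ hχc hχφ fun t ht a ha => (hε t ht a ha).1
  start := shift_zero hsec hχφ
  integralCurve := by
    intro x t ht
    by_cases h : x ∈ (extChartAt (𝓡 (n + 1)) c.center).symm '' tsupport χ
    · obtain ⟨a, ha, rfl⟩ := h
      obtain ⟨hp, hθ⟩ := hε t ht a ha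
      have h1 : HasDerivAt (fun t : ℝ => (a, c.localRep φ a + (t * χ a) • b)) (0, χ a • b) t := by
        refine (hasDerivAt_const _ _).prodMk ?_
        simpa using (((hasDerivAt_id t).mul_const (χ a)).smul_const b).const_add (c.localRep φ a)
      have h2 := ((c.contMDiffAt_symm hp).mdifferentiableAt (by simp)).hasMFDerivAt.comp t
        h1.hasFDerivAt.hasMFDerivAt
      have h3 : (fun t => c.shift φ χ b t ((extChartAt (𝓡 (n + 1)) c.center).symm a)) =
          c.chart.symm ∘ fun t : ℝ => (a, c.localRep φ a + (t * χ a) • b) :=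
        funext fun t => shift_apply_symm hsec t (hχφ ha)
      rw [h3]
      refine h2.hasMFDerivWithinAt.congr_mfderiv ?_
      have h4 : c.symmDeriv (a, c.localRep φ a + (t * χ a) • b) ((1 : ℝ) • (0, χ a • b)) =
          (1 : ℝ) • c.verticalField (fun p => χ p.1 * θ p) b
            (c.chart.symm (a, c.localRep φ a + (t * χ a) • b)) := by
        rw [verticalField_of_mem (c.chart.map_target hp), c.chart.right_inv hp, hθ, mul_one,
          one_smul, one_smul, ← map_smul]
        simp
      ext
      exact h4
    · have h3 : (fun t => c.shift φ χ b t x) = fun _ => φ x :=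
        funext fun t => shift_of_notMem h
      rw [h3]
      refine (hasMFDerivWithinAt_const _ _ _).congr_mfderiv ?_
      have h4 : c.verticalField (fun p => χ p.1 * θ p) b (φ x) = 0 := by
        refine verticalField_eq_zero fun hx => ?_
        have h0 : χ (c.chart (φ x)).1 = 0 := by
          refine image_eq_zero_of_notMem_tsupport fun h' => h ⟨_, h', ?_⟩
          rw [c.fst_eq _ hx, hsec]
          exact (extChartAt (𝓡 (n + 1)) c.center).left_inv (c.mem_source_of_section hsec hx)
        simp [h0]
      have h5 : (0 : E) = (1 : ℝ) • c.verticalField (fun p => χ p.1 * θ p) b (φ x) := by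
        rw [h4, smul_zero]
      ext
      exact h5

end AdaptedChart
end StationarySections

/-! ### Stationary sections and the fundamental lemma of the calculus of variations -/

section StationaryEquations

variable {n : ℕ} {X : Type*} [TopologicalSpace X] [T2Space X]
  [ChartedSpace (EuclideanSpace ℝ (Fin (n + 1))) X]
  {E : Type*} [NormedAddCommGroup E] [NormedSpace ℝ E]
  {Y : Type*} [TopologicalSpace Y] [T2Space Y] [ChartedSpace E Y]
  [IsManifold (𝓡 (n + 1)) ∞ X] [IsManifold 𝓘(ℝ, E) ∞ Y]
  {q : C^∞⟮𝓘(ℝ, E), Y; 𝓡 (n + 1), X⟯}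
  {B : Type*} [NormedAddCommGroup B] [NormedSpace ℝ B] [FiniteDimensional ℝ B]

namespace AdaptedChart

variable {c : AdaptedChart q B} {φ : X → Y} {χ : BaseSpace n → ℝ}

/-- The variation of a section in the direction `χ b` comes from a vertical vector field. -/
theorem exists_isVariation_shift (hφ : ContMDiff (𝓡 (n + 1)) 𝓘(ℝ, E) ∞ φ)
    (hsec : ∀ x, q (φ x) = x) (hχ : ContDiff ℝ ∞ χ) (hχc : HasCompactSupport χ)
    (hχφ : tsupport χ ⊆ c.sectionDomain φ) (b : B) :
    ∃ (V : Y → E) (ε : ℝ),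
      IsVerticalField q ((extChartAt (𝓡 (n + 1)) c.center).symm '' tsupport χ) V ∧
      IsVariation (n := n) V φ ε (c.shift φ χ b) ∧
      ∀ t ∈ Ioo (-ε) ε, ∀ a ∈ tsupport χ,
        (a, c.localRep φ a + (t * χ a) • b) ∈ c.chart.target := by
  have hf : ∀ a ∈ tsupport χ, ContinuousAt (c.localRep φ) a := fun a ha =>
    (c.contDiffAt_localRep hφ (hχφ ha).1 (hχφ ha).2).continuousAt
  -- The graph of the section over the support of `χ` is compact in the chart. The cut-off `θ` is
  -- `1` near it and supported in a compact part of the target; for small `t` the shifted graph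
  -- stays where `θ = 1`.
  set G : Set (BaseSpace n × B) := (fun a => (a, c.localRep φ a)) '' tsupport χ
  have hG : IsCompact G := hχc.isCompact.image_of_continuousOn fun a ha =>
    (continuousAt_id.prodMk (hf a ha)).continuousWithinAt
  have hGt : G ⊆ c.chart.target := by
    rintro _ ⟨a, ha, rfl⟩
    exact coordJet_mem_of_mem_sectionDomain hsec (hχφ ha)
  obtain ⟨L, hL, hGL, hLt⟩ := exists_compact_between hG c.chart.open_target hGt
  obtain ⟨θ, hθ1, hθ0, -⟩ := exists_contMDiffMap_one_nhds_of_subset_interior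
    𝓘(ℝ, BaseSpace n × B) (n := ⊤) hG.isClosed hGL
  set W : Set (BaseSpace n × B) := interior {p | θ p = 1} ∩ c.chart.target
  have hW : IsOpen W := isOpen_interior.inter c.chart.open_target
  have hGW : G ⊆ W := fun p hp =>
    ⟨mem_interior_iff_mem_nhds.2 (Filter.Eventually.filter_mono (nhds_le_nhdsSet hp) hθ1), hGt hp⟩
  have htube : ∀ᶠ t in 𝓝 (0 : ℝ), ∀ a ∈ tsupport χ, (a, c.localRep φ a + (t * χ a) • b) ∈ W := by
    refine hχc.isCompact.eventually_forall_of_forall_eventually fun a ha => ?_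
    have h1 : ContinuousAt (fun p : ℝ × BaseSpace n =>
        (p.2, c.localRep φ p.2 + (p.1 * χ p.2) • b)) (0, a) := by
      have h2 : ContinuousAt (fun p : ℝ × BaseSpace n => c.localRep φ p.2) (0, a) :=
        ContinuousAt.comp (g := c.localRep φ) (f := Prod.snd) (hf a ha) continuousAt_snd
      have h3 : Continuous χ := hχ.continuous
      have h4 : Continuous (fun p : ℝ × BaseSpace n => (p.1 * χ p.2) • b) := by fun_prop
      exact continuousAt_snd.prodMk (h2.add h4.continuousAt)
    refine h1.preimage_mem_nhds (hW.mem_nhds ?_)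
    simp only [zero_mul, zero_smul, add_zero]
    exact hGW ⟨a, ha, rfl⟩
  obtain ⟨ε, hε0, hε⟩ := Metric.eventually_nhds_iff.1 htube
  have hε' : ∀ t ∈ Ioo (-ε) ε, ∀ a ∈ tsupport χ, (a, c.localRep φ a + (t * χ a) • b) ∈ W :=
    fun t ht => hε (by rw [Real.dist_eq, sub_zero]; exact abs_lt.2 ht)
  refine ⟨c.verticalField (fun p => χ p.1 * θ p) b, ε, ?_, ?_, fun t ht a ha => (hε' t ht a ha).2⟩
  · refine isVerticalField_verticalField ?_ hL hLt (fun p hp => by simp [hθ0 p hp]) ?_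
    · exact (hχ.comp contDiff_fst).mul θ.contMDiff.contDiff
    · intro y hy hyK
      have h0 : χ (c.chart y).1 = 0 := by
        refine image_eq_zero_of_notMem_tsupport fun h' => hyK ⟨_, h', ?_⟩
        rw [c.fst_eq _ hy]
        exact (extChartAt (𝓡 (n + 1)) c.center).left_inv (c.base_mem _ hy)
      simp [h0]
  · exact isVariation_shift hφ hsec hχ hχc hχφ hε0 fun t ht a ha =>
      ⟨(hε' t ht a ha).2, interior_subset (s := {p | θ p = 1}) (hε' t ht a ha).1⟩

variable [SigmaCompactSpace X] {F : Type*} [TopologicalSpace F] [ChartedSpace B F]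
  [IsManifold 𝓘(ℝ, B) ∞ F] {ℒ : Density q}

/-- The shifted family is compared with the constant family `φ`, whose action is constant; the
derivative of the difference is both zero by stationarity and the integral of the Euler–Lagrange
expression. -/
theorem integral_smul_eulerLagrange_eq_zero (hX : IsOrientedAtlas n X)
    (hq : IsSmoothFiberBundle B F q) (hℒ : IsSmoothDensity ℒ)
    (hφ : ContMDiff (𝓡 (n + 1)) 𝓘(ℝ, E) ∞ φ) (hsec : ∀ x, q (φ x) = x)
    (hst : IsStationary ℒ φ) (hχ : ContDiff ℝ ∞ χ) (hχc : HasCompactSupport χ)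
    (hχφ : tsupport χ ⊆ c.sectionDomain φ) (b : B) :
    ∫ a, χ a • eulerLagrange (c.lagrangian ℒ) (c.localRep φ) a b = 0 := by
  obtain ⟨V, ε, hV, hvar, hε⟩ := exists_isVariation_shift hφ hsec hχ hχc hχφ b
  set ext := extChartAt (𝓡 (n + 1)) c.center
  set K := ext.symm '' tsupport χ
  have hK : IsCompact K := hχc.isCompact.image_of_continuousOn
    ((continuousOn_extChartAt_symm c.center).mono fun a ha => (hχφ ha).1)
  have hKimg : ext '' K = tsupport χ := by
    rw [image_image]
    exact (image_congr fun a ha => ext.right_inv (hχφ ha).1).trans (image_id _)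
  have hsec₁ : ∀ t ∈ Ioo (-ε) ε, ∀ x, q (c.shift φ χ b t x) = x :=
    fun t ht x => hvar.proj_eq hV hsec ht x
  have h1 := c.hasDerivAt_formIntegral_sub hX hq hℒ hK hK Subset.rfl hvar.pos hvar.smooth
    (Φ₂ := fun _ => φ) ((hφ.comp contMDiff_snd).contMDiffOn) hsec₁ (fun _ _ => hsec)
    hvar.start (fun t _ x hx => shift_of_notMem hx) (by
      rintro _ ⟨a, ha, rfl⟩
      rw [hvar.start]
      exact (hχφ ha).2)
  have h2 := (hst K hK V hV ε _ hvar).sub_const (formIntegral K fun x => ℒ (firstJet q φ x))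
  have h3 := h1.unique h2
  rw [hKimg, hvar.start] at h3
  rw [← setIntegral_eq_integral_of_forall_compl_eq_zero (s := tsupport χ), ← h3]
  · refine setIntegral_congr_fun (isClosed_tsupport χ).measurableSet fun a ha => ?_
    have hε0 : (0 : ℝ) ∈ Ioo (-ε) ε := ⟨by linarith [hvar.pos], hvar.pos⟩
    have h4 : HasDerivAt (fun t => c.localRep (c.shift φ χ b t) a) (χ a • b) 0 := by
      have h5 : HasDerivAt (fun t : ℝ => c.localRep φ a + (t * χ a) • b) (χ a • b) 0 := by
        simpa using
          (((hasDerivAt_id (0 : ℝ)).mul_const (χ a)).smul_const b).const_add (c.localRep φ a)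
      refine h5.congr_of_eventuallyEq ?_
      filter_upwards [isOpen_Ioo.mem_nhds hε0] with t ht
      change (c.chart (c.shift φ χ b t (ext.symm a))).2 = _
      rw [shift_apply_symm hsec t (hχφ ha), c.chart.right_inv (hε t ht a ha)]
    simp only [h4.deriv, deriv_const, sub_zero]
    rw [eulerLagrange_smul, smul_eq_mul]
    have h6 := contDiffOn_fderiv_coordJet c.isOpen_jetTarget (c.contDiffOn_lagrangian hℒ)
      (D := c.sectionDomain φ) (f := c.localRep φ)
      (fun a ha => c.contDiffAt_localRep hφ ha.1 ha.2)
      (fun a ha => coordJet_mem_of_mem_sectionDomain hsec ha)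
    exact (h6.contDiffAt ((isOpen_sectionDomain hφ.continuous).mem_nhds (hχφ ha))).differentiableAt
      (by simp)
  · intro a ha
    rw [image_eq_zero_of_notMem_tsupport ha, zero_smul]

/-- The fundamental lemma gives vanishing almost everywhere on an open set, and continuity gives it
at every point. -/
theorem eulerLagrange_eq_zero_of_isStationary (hX : IsOrientedAtlas n X)
    (hq : IsSmoothFiberBundle B F q) (hℒ : IsSmoothDensity ℒ)
    (hφ : ContMDiff (𝓡 (n + 1)) 𝓘(ℝ, E) ∞ φ) (hsec : ∀ x, q (φ x) = x)
    (hst : IsStationary ℒ φ) {x : X} (hx : φ x ∈ c.chart.source) (b : B) :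
    eulerLagrange (c.lagrangian ℒ) (c.localRep φ) (extChartAt (𝓡 (n + 1)) c.center x) b = 0 := by
  have hopen := isOpen_sectionDomain (c := c) hφ.continuous
  have hcont := continuousOn_eulerLagrange c.isOpen_jetTarget (c.contDiffOn_lagrangian hℒ) hopen
    (fun a ha => c.contDiffAt_localRep hφ ha.1 ha.2)
    (fun a ha => coordJet_mem_of_mem_sectionDomain hsec ha) b
  have hae := hopen.ae_eq_zero_of_integral_contDiff_smul_eq_zero (μ := volume)
    (hcont.locallyIntegrableOn hopen.measurableSet) fun χ hχ hχc hχφ =>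
      integral_smul_eulerLagrange_eq_zero hX hq hℒ hφ hsec hst hχ hχc hχφ b
  have heq := Measure.eqOn_open_of_ae_eq ((ae_restrict_iff' hopen.measurableSet).2 hae) hopen hcont
    (continuousOn_const (c := (0 : ℝ)))
  have hxs := c.mem_source_of_section hsec hx
  refine heq ⟨(extChartAt (𝓡 (n + 1)) c.center).map_source hxs, ?_⟩
  change φ _ ∈ c.chart.source
  rwa [(extChartAt (𝓡 (n + 1)) c.center).left_inv hxs]

end AdaptedChart
end StationaryEquations

end Multisymplectic

end

/-! ### The equivalence -/

theorem theorem3p1 {n : ℕ}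
    {X : Type*} [TopologicalSpace X] [T2Space X] [SigmaCompactSpace X]
    [ChartedSpace (EuclideanSpace ℝ (Fin (n + 1))) X] [IsManifold (𝓡 (n + 1)) ∞ X]
    (hX : Multisymplectic.IsOrientedAtlas n X)
    {E : Type*} [NormedAddCommGroup E] [NormedSpace ℝ E] [FiniteDimensional ℝ E]
    {Y : Type*} [TopologicalSpace Y] [T2Space Y] [SigmaCompactSpace Y]
    [ChartedSpace E Y] [IsManifold 𝓘(ℝ, E) ∞ Y]
    {E' : Type*} [NormedAddCommGroup E'] [NormedSpace ℝ E'] [FiniteDimensional ℝ E']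
    {F : Type*} [TopologicalSpace F] [T2Space F] [SigmaCompactSpace F]
    [ChartedSpace E' F] [IsManifold 𝓘(ℝ, E') ∞ F]
    (q : C^∞⟮𝓘(ℝ, E), Y; 𝓡 (n + 1), X⟯)
    (hq : Multisymplectic.IsSmoothFiberBundle E' F q)
    (ℒ : Multisymplectic.Density q)
    (hℒ : Multisymplectic.IsSmoothDensity ℒ)
    (hreg : Multisymplectic.IsRegular ℒ)
    (φ : X → Y) (hφ : ContMDiff (𝓡 (n + 1)) 𝓘(ℝ, E) ∞ φ) (hsec : ∀ x, q (φ x) = x) :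
    Multisymplectic.IsStationary ℒ φ ↔
      Multisymplectic.IsHamiltonian ℒ (Multisymplectic.conjugateJet ℒ φ) := by
  have : CompleteSpace E := FiniteDimensional.complete ℝ E
  constructor
  · intro hst x U hU v
    obtain ⟨c, -, hc⟩ := Multisymplectic.exists_adaptedChart hq (i := q (φ x)) (y := φ x)
      (mem_extChartAt_source _)
    exact c.canonicalOmega_eq_zero_of_eulerLagrange hℒ hreg hφ hsec hc
      (fun b => Multisymplectic.AdaptedChart.eulerLagrange_eq_zero_of_isStationary hX hq hℒ hφ hsec
        hst hc b) hU v
  · intro hham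
    exact Multisymplectic.isStationary_of_eulerLagrange hX hq hℒ hφ hsec fun c x hx b =>
      c.eulerLagrange_eq_zero_of_isHamiltonian hℒ hreg hφ hsec hham hx b
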